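/- Let $\mathbb K$ be a field of characteristic zero. **Graphs.** For $n\ge 1$, an admissible graph with $n$ external vertices is a directed graph with external vertices $1,\dots,n$ and finitely many unlabelled internal vertices $\bar 1,\bar 2,\dots$, together with a linear order on its edges, such that: there are no double edges (two edges with the same source and target) and no loops; every internal vertex has at most one incoming and at most two outgoing edges; every internal vertex is joined to some external vertex by an (undirected) path. Let $\mathsf{dgraphs}(n)$ be the vector space spanned by these graphs, modulo (i) $\Gamma^\sigma=(-1)^{|\sigma|}\Gamma$ for a permutation $\sigma$ of the order of the edges, and (ii) the generalized IHX relations: take a directed graph satisfying the same conditions, except that one internal vertex $v$ is allowed up to three outgoing edges (and at most one incoming edge); replace $v$ by two internal vertices joined by a new directed edge, placed last in the order, reconnect the edges previously at $v$ to these two vertices in all ways that give an admissible graph, and set the sum equal to $0$. Put $|\Gamma|=2\,\#\{\text{internal vertices}\}-\#\{\text{edges}\}$. Let $\mathfrak g$ be $\prod_{n\ge1}s^{-n+1}\mathsf{dgraphs}(n)$, each $\mathsf{dgraphs}(n)$ being completed with respect to the number of internal vertices, so that $\Gamma$ with $n$ external vertices has degree $|\Gamma|+n-1$. For $\Gamma_1\in\mathsf{dgraphs}(n)$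 and $\Gamma_2\in\mathsf{dgraphs}(r)$ set $$\Gamma_1\star\Gamma_2=\sum_{i=1}^n(-1)^{|\Gamma_2|(1-n)+(i+1)(r-1)}\,\Gamma_1\circ_i\Gamma_2 ,$$ where $\Gamma_1\circ_i\Gamma_2$ replaces the $i$-th external vertex of $\Gamma_1$ by $\Gamma_2$, sums over all ways of reconnecting the edges formerly at that vertex to vertices of $\Gamma_2$ that give admissible graphs, and orders the edges of $\Gamma_1$ before those of $\Gamma_2$. A Maurer–Cartan element is an $\alpha\in\mathfrak g$ of degree $1$ with $\alpha\star\alpha=0$. For $\xi\in\mathfrak g$ of degree $0$ without components having only one vertex, let $\mathrm{ad}_\xi\alpha=\xi\star\alpha-\alpha\star\xi$; the gauge action is $\xi.\alpha=e^{\mathrm{ad}_\xi}\alpha=\sum_k\frac1{k!}\mathrm{ad}_\xi^k\alpha$. **Representation.** Let $L$ be a finite-dimensional Lie algebra over $\mathbb K$ with basis $x_1,\dots,x_d$, $[x_i,x_j]=\sum_k c_{ij}^kx_k$. Put $A=SL\otimes\bigwedge L^*=\mathbb K[x_1,\dots,x_d,p^1,\dots,p^d]$ with $p^i$ of degree $1$,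 $\pi=\frac12\sum c_{ij}^kx_kp^ip^j$ and $\tau=\sum_l\frac{\partial}{\partial p^l}\otimes\frac{\partial}{\partial x_l}$. A graph $\Gamma$ with $n$ external and $m$ internal vertices acts by $$B_\Gamma(f_1,\dots,f_n)=\mu\circ\prod_{(a,b)\in E(\Gamma)}\tau_{ab}\,(\pi\otimes\cdots\otimes\pi\otimes f_1\otimes\cdots\otimes f_n)$$ ($\pi$ at the $m$ internal vertices, the operator $\tau_{ab}$ of the first edge applied first, $\mu$ the graded commutative product). This is well defined on $\mathsf{dgraphs}(n)$ and extends to $\mathfrak g$ (for fixed arguments only finitely many numbers of internal vertices contribute). Let $$d_Af=\sum_l\Big(\frac{\partial\pi}{\partial p^l}\frac{\partial f}{\partial x_l}+\frac{\partial f}{\partial p^l}\frac{\partial\pi}{\partial x_l}\Big),$$ and let $\tilde m_{\mathrm{Duf}}=m_{\mathrm{Duf}}\otimes m_\wedge$, where $m_\wedge$ is the product of $\bigwedge L^*$ and $m_{\mathrm{Duf}}=\mathrm{Duf}^{-1}\circ m_{UL}\circ\mathrm{Duf}^{\otimes2}$ on $SL$, with $\mathrm{Duf}=\mathrm{Sym}\circ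 J^{1/2}:SL\to UL$, $\mathrm{Sym}$ the symmetrization map, and $J(u)=\det\big((e^{\mathrm{ad}_u/2}-e^{-\mathrm{ad}_u/2})/\mathrm{ad}_u\big)$, the power series $J^{1/2}$ acting as a differential operator of infinite order with constant coefficients. Let $\alpha_{\mathrm{Duf}}\in\mathfrak g$ be a Maurer–Cartan element corresponding to the universal $A_\infty$-structure $(d_A,\tilde m_{\mathrm{Duf}},0,\dots)$, i.e. one whose components with $n=1$, $n=2$ and $n\ge3$ external vertices act, for every finite-dimensional Lie algebra $L$ over $\mathbb K$, as $d_A$, $\tilde m_{\mathrm{Duf}}$ and $0$. **Notation for particular graphs.** A graph is written as the ordered list of its edges, with external vertices $1,2,3$ and internal vertices $\bar1,\bar2$. * $n=1$, one internal vertex: $a_1=(\bar1\to1)+(1\to\bar1)$. * $n=2$, no internal vertex: $a_2$ is the graph without edges; $\xi_1=(1\to2)-(2\to1)$. * $n=2$, one internal vertex: $a_3=(\bar1\to1,\bar1\to2)$, $\ \xi_2=(\bar1\to1,\bar1\to2,1\to2)-(\bar1\to1,\bar1\to2,2\to1)$, $\ \xi_3=(2\to\bar1,\bar1\to1,\bar1\to2)-(1\to\bar1,\bar1\to1,\bar1\to2)$.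 * $n=2$, two internal vertices: $a_4=(\bar2\to2,\bar2\to\bar1,\bar1\to1,\bar1\to2)-(\bar2\to1,\bar2\to\bar1,\bar1\to1,\bar1\to2)$, $\ a_5=(\bar1\to1,\bar1\to2,\bar2\to1,\bar2\to2)$, $\ a_6=(\bar1\to1,\bar1\to\bar2,\bar2\to\bar1,\bar2\to2)$. * $n=3$, one internal vertex: $b=(1\to\bar1,\bar1\to2,\bar1\to3)+(\bar1\to1,2\to\bar1,\bar1\to3)+(\bar1\to1,\bar1\to2,3\to\bar1)$. **Proposition.** The element $\alpha_{\mathrm{Duf}}$ is given by $$\alpha_{\mathrm{Duf}}=a_1+a_2+\tfrac12a_3-\tfrac1{12}a_4+\tfrac18a_5+\tfrac1{24}a_6+\cdots .$$ It is gauge equivalent to a Maurer–Cartan element $$\alpha'_{\mathrm{Duf}}=a_1+a_2+\tfrac1{24}b+\cdots ,$$ and the two are related by the gauge action, $\alpha'_{\mathrm{Duf}}=e^{\mathrm{ad}_\xi}\alpha_{\mathrm{Duf}}$, of a degree $0$ element $$\xi=-\tfrac14\xi_1-\tfrac1{16}\xi_2+\tfrac1{48}\xi_3+\cdots .$$ Here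 the dots stand for terms with at least five vertices (internal and external together) in $\alpha_{\mathrm{Duf}}$ and $\alpha'_{\mathrm{Duf}}$, and for terms with at least four vertices in $\xi$. -/

import Mathlib

open scoped TensorProduct

/-! ## Directed graphs -/

/-- Vertices: `ext i` is the external vertex with label `i`, `int k` the internal vertex `k`
(internal vertices carry auxiliary labels, which are divided out below). -/
inductive Vertex : Type
  | ext (i : ℕ)
  | int (k : ℕ)
  deriving DecidableEq

/-- A directed edge, from its first to its second component. -/
abbrev Edge : Type := Vertex × Vertex

/-- The vertices of a graph with `n` external and `m` internal vertices. -/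
def vertices (n m : ℕ) : Multiset Vertex :=
  (Multiset.range n).map (fun i => Vertex.ext (i + 1)) +
    (Multiset.range m).map (fun k => Vertex.int (k + 1))

/-- Every internal vertex can be connected by an (undirected) path with an external vertex. -/
def ConnectedToExternal (n m : ℕ) (E : List Edge) : Prop :=
  ∀ k, Vertex.int k ∈ vertices n m → ∃ i, Vertex.ext i ∈ vertices n m ∧
    Relation.ReflTransGen (fun a b => (a, b) ∈ E ∨ (b, a) ∈ E) (Vertex.int k) (Vertex.ext i)

/-- A graph with `n` external and `m` internal vertices is the list of its edges, the order of
the list being the linear order on the set of edges. -/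
structure Admissible (n m : ℕ) (E : List Edge) : Prop where
  one_le : 1 ≤ n
  mem : ∀ e ∈ E, e.1 ∈ vertices n m ∧ e.2 ∈ vertices n m
  nodup : E.Nodup
  loopless : ∀ e ∈ E, e.1 ≠ e.2
  incoming : ∀ k, Vertex.int k ∈ vertices n m →
    E.countP (fun e => decide (e.2 = Vertex.int k)) ≤ 1
  outgoing : ∀ k, Vertex.int k ∈ vertices n m →
    E.countP (fun e => decide (e.1 = Vertex.int k)) ≤ 2
  connected : ConnectedToExternal n m E

/-- Finite linear combinations of admissible graphs. -/
abbrev Chains (K : Type*) [Field K] (n m : ℕ) : Type _ := {E : List Edge // Admissible n m E} →₀ K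

open Classical in
/-- A graph as a chain; graphs that are not admissible are discarded. -/
noncomputable def toChain (K : Type*) [Field K] (n m : ℕ) (E : List Edge) : Chains K n m :=
  if h : Admissible n m E then Finsupp.single ⟨E, h⟩ 1 else 0

/-- All ways of replacing, in every edge, each endpoint `a` by an element of `p a`. -/
noncomputable def subst (p : Vertex → Multiset Vertex) : List Edge → Multiset (List Edge)
  | [] => {[]}
  | e :: E => (p e.1).bind fun a => (p e.2).bind fun b => (subst p E).map fun s => (a, b) :: s

/-- Apply a map to all endpoints. -/
def mapVertices (g : Vertex → Vertex) (E : List Edge) : List Edge :=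
  E.map (Prod.map g g)

/-- Relabelling of internal vertices. -/
def relabel (ρ : Equiv.Perm ℕ) : Vertex → Vertex
  | .ext i => .ext i
  | .int k => .int (ρ k)

/-- An edge end at the internal vertex `v` may be reconnected to `v` or to `w`. -/
def splitAt (v w : ℕ) (a : Vertex) : Multiset Vertex :=
  if a = .int v then {.int v, .int w} else {a}

/-- The defining relations: a transposition of neighbours in the order of edges gives a sign;
internal vertices are unlabelled; generalized IHX relations. In the last of these an internal
vertex `v` of a loopless graph with `m` internal vertices, all of them connected to external
vertices, is replaced by two vertices `v`, `m + 1`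
that are joined by a new edge from `v` to `m + 1`, which is placed last, and the edges at `v` are
reconnected in all ways that lead to an admissible graph. (No admissible graph arises unless `v`
has at most one incoming and at most three outgoing edges and the other internal vertices satisfy
the valence conditions; for a double edge the sum is zero by antisymmetry.) -/
inductive IsRelation (K : Type*) [Field K] (n : ℕ) : (m : ℕ) → Chains K n m → Prop
  | order (m : ℕ) (l₁ l₂ : List Edge) (e f : Edge) :
      IsRelation K n m (toChain K n m (l₁ ++ e :: f :: l₂) + toChain K n m (l₁ ++ f :: e :: l₂))
  | unlabel (m : ℕ) (ρ : Equiv.Perm ℕ) (hρ : ∀ k, Vertex.int k ∉ vertices n m → ρ k = k)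
      (E : List Edge) :
      IsRelation K n m (toChain K n m (mapVertices (relabel ρ) E) - toChain K n m E)
  | ihx (m : ℕ) (E : List Edge) (hE : ∀ e ∈ E, e.1 ∈ vertices n m ∧ e.2 ∈ vertices n m ∧ e.1 ≠ e.2)
      (hc : ConnectedToExternal n m E) (v : ℕ) (hv : Vertex.int v ∈ vertices n m) :
      IsRelation K n (m + 1) (((subst (splitAt v (m + 1)) E).map fun s =>
        toChain K n (m + 1) (s ++ [(Vertex.int v, Vertex.int (m + 1))])).sum)

/-- The span of the relations. -/
noncomputable def relations (K : Type*) [Field K] (n m : ℕ) : Submodule K (Chains K n m) :=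
  Submodule.span K {x | IsRelation K n m x}

/-- The part of `dgraphs(n)` with `m` internal vertices. -/
abbrev DGraphs (K : Type*) [Field K] (n m : ℕ) : Type _ := Chains K n m ⧸ relations K n m

/-- The class of a graph in `dgraphs(n)` (zero if the graph is not admissible). -/
noncomputable def cls (K : Type*) [Field K] (n m : ℕ) (E : List Edge) : DGraphs K n m :=
  (relations K n m).mkQ (toChain K n m E)

/-! ## Insertion -/

/-- How the vertices of `Γ₁` other than `ext j` are labelled in `Γ₁ ∘_j Γ₂`, where `Γ₂` has `n₂`
external vertices. -/
def outerVertex (j n₂ : ℕ) : Vertex → Vertex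
  | .ext i => if i < j then .ext i else .ext (i + n₂ - 1)
  | .int k => .int k

/-- How the vertices of `Γ₂` are labelled in `Γ₁ ∘_j Γ₂`, where `Γ₁` has `m₁` internal vertices. -/
def innerVertex (j m₁ : ℕ) : Vertex → Vertex
  | .ext i => .ext (i + j - 1)
  | .int k => .int (m₁ + k)

/-- An edge end of `Γ₁` at `ext j` may be reconnected to any vertex of `Γ₂`. -/
def plug (j m₁ n₂ m₂ : ℕ) (a : Vertex) : Multiset Vertex :=
  if a = .ext j then (vertices n₂ m₂).map (innerVertex j m₁) else {outerVertex j n₂ a}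

/-- The operadic composition `Γ₁ ∘_j Γ₂`; here `n = n₁ + n₂ - 1` and `m = m₁ + m₂`. -/
noncomputable def insertion (K : Type*) [Field K] (m₁ n₂ m₂ n m j : ℕ) (E₁ E₂ : List Edge) :
    DGraphs K n m :=
  ((subst (plug j m₁ n₂ m₂) E₁).map fun s =>
    cls K n m (s ++ mapVertices (innerVertex j m₁) E₂)).sum

/-- `Γ₁ ⋆ Γ₂ = ∑_{i=1}^{n₁} (-1)^{|Γ₂|(1-n₁)+(i+1)(n₂-1)} Γ₁ ∘_i Γ₂`, where
`|Γ₂| = 2 m₂ - #edges`. -/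
noncomputable def starGraph (K : Type*) [Field K] (n₁ m₁ n₂ m₂ n m : ℕ) (E₁ E₂ : List Edge) :
    DGraphs K n m :=
  ∑ i ∈ Finset.Icc 1 n₁,
    ((-1 : K) ^ ((2 * m₂ - E₂.length : ℤ) * (1 - n₁) + (i + 1) * (n₂ - 1) : ℤ)) •
      insertion K m₁ n₂ m₂ n m i E₁ E₂

section WellDefined

theorem mem_vertices_ext {n m i : ℕ} : Vertex.ext i ∈ vertices n m ↔ 1 ≤ i ∧ i ≤ n := by
  simp only [vertices, Multiset.mem_add, Multiset.mem_map, Multiset.mem_range, Vertex.ext.injEq,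
    reduceCtorEq, and_false, exists_false, or_false]
  constructor
  · rintro ⟨a, h, rfl⟩; omega
  · rintro ⟨h1, h2⟩; exact ⟨i - 1, by omega, by omega⟩

theorem mem_vertices_int {n m k : ℕ} : Vertex.int k ∈ vertices n m ↔ 1 ≤ k ∧ k ≤ m := by
  simp only [vertices, Multiset.mem_add, Multiset.mem_map, Multiset.mem_range, Vertex.int.injEq,
    reduceCtorEq, and_false, exists_false, false_or]
  constructor
  · rintro ⟨a, h, rfl⟩; omega
  · rintro ⟨h1, h2⟩; exact ⟨k - 1, by omega, by omega⟩

theorem vertices_succ (n m : ℕ) :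
    vertices n (m + 1) = vertices n m + {Vertex.int (m + 1)} := by
  simp [vertices, Multiset.range_succ, add_comm]

theorem connected_iff {n m : ℕ} {E : List Edge} : ConnectedToExternal n m E ↔
    ∀ S : Vertex → Prop, (∀ i, Vertex.ext i ∈ vertices n m → S (.ext i)) →
      (∀ e ∈ E, S e.1 ↔ S e.2) → ∀ k, Vertex.int k ∈ vertices n m → S (.int k) := by
  constructor
  · intro h S h1 h2 k hk
    obtain ⟨i, hi, hp⟩ := h k hk
    have key : ∀ a b, Relation.ReflTransGen (fun a b => (a, b) ∈ E ∨ (b, a) ∈ E) a b →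
        S b → S a := by
      intro a b hab
      induction hab with
      | refl => exact id
      | tail _ hbc ih =>
        intro hc
        apply ih
        rcases hbc with hbc | hbc
        · exact (h2 _ hbc).2 hc
        · exact (h2 _ hbc).1 hc
    exact key _ _ hp (h1 i hi)
  · intro h k hk
    refine h (fun a => ∃ i, Vertex.ext i ∈ vertices n m ∧
      Relation.ReflTransGen (fun a b => (a, b) ∈ E ∨ (b, a) ∈ E) a (.ext i)) ?_ ?_ k hk
    · exact fun i hi => ⟨i, hi, .refl⟩
    · rintro ⟨a, b⟩ he
      constructor
      · rintro ⟨i, hi, hp⟩; exact ⟨i, hi, .head (.inr he) hp⟩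
      · rintro ⟨i, hi, hp⟩; exact ⟨i, hi, .head (.inl he) hp⟩

theorem subst_append (p : Vertex → Multiset Vertex) (E F : List Edge) :
    subst p (E ++ F) = (subst p E).bind fun s => (subst p F).map fun t => s ++ t := by
  induction E with
  | nil => simp [subst]
  | cons e E ih =>
    simp only [List.cons_append, subst, ih, Multiset.bind_assoc, Multiset.map_bind,
      Multiset.bind_map, Multiset.map_map, Function.comp_def]

theorem subst_congr {p q : Vertex → Multiset Vertex} {E : List Edge}
    (h : ∀ e ∈ E, p e.1 = q e.1 ∧ p e.2 = q e.2) : subst p E = subst q E := by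
  induction E with
  | nil => rfl
  | cons e E ih =>
    have h1 := h e (by simp)
    simp only [subst, h1.1, h1.2, ih fun f hf => h f (List.mem_cons_of_mem _ hf)]

theorem subst_pure (g : Vertex → Vertex) (E : List Edge) :
    subst (fun a => {g a}) E = {mapVertices g E} := by
  induction E with
  | nil => rfl
  | cons e E ih => simp [subst, ih, mapVertices, Prod.map]

theorem subst_self {p : Vertex → Multiset Vertex} {E : List Edge}
    (h : ∀ e ∈ E, p e.1 = {e.1} ∧ p e.2 = {e.2}) : subst p E = {E} := by
  rw [subst_congr (q := fun a => {id a}) (by simpa using h), subst_pure]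
  simp [mapVertices]

theorem subst_bind (p q : Vertex → Multiset Vertex) (E : List Edge) :
    (subst p E).bind (subst q) = subst (fun a => (p a).bind q) E := by
  induction E with
  | nil => simp [subst]
  | cons e E ih =>
    simp only [subst, ← ih, Multiset.bind_assoc, Multiset.map_bind, Multiset.bind_map]
    refine Multiset.bind_congr fun a _ => ?_
    conv_rhs => rw [Multiset.bind_bind]
    refine Multiset.bind_congr fun b _ => ?_
    rw [Multiset.bind_bind]
    refine Multiset.bind_congr fun a' _ => ?_
    rw [Multiset.bind_bind]

theorem subst_map (p : Vertex → Multiset Vertex) (g : Vertex → Vertex) (E : List Edge) :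
    (subst p E).map (mapVertices g) = subst (fun a => (p a).map g) E := by
  have : (subst p E).map (mapVertices g) = (subst p E).bind (subst fun a => {g a}) := by
    rw [show (subst fun a => {g a}) = fun E => {mapVertices g E} from funext (subst_pure g)]
    simp [Multiset.bind_singleton]
  rw [this, subst_bind]
  simp [Multiset.bind_singleton]

theorem subst_mapVertices (p : Vertex → Multiset Vertex) (g : Vertex → Vertex) (E : List Edge) :
    subst p (mapVertices g E) = subst (fun a => p (g a)) E := by
  have := subst_bind (fun a => {g a}) p E
  rw [subst_pure] at this
  simpa using this

theorem forall_of_mem_subst {p : Vertex → Multiset Vertex} {E s : List Edge}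
    (h : s ∈ subst p E) : List.Forall₂ (fun e f => f.1 ∈ p e.1 ∧ f.2 ∈ p e.2) E s := by
  induction E generalizing s with
  | nil => simp [subst] at h; simp [h]
  | cons e E ih =>
    simp only [subst, Multiset.mem_bind, Multiset.mem_map] at h
    obtain ⟨a, ha, b, hb, t, ht, rfl⟩ := h
    exact .cons ⟨ha, hb⟩ (ih ht)

theorem subst_mem_right {p : Vertex → Multiset Vertex} {E s : List Edge}
    (h : s ∈ subst p E) {f : Edge} (hf : f ∈ s) : ∃ e ∈ E, f.1 ∈ p e.1 ∧ f.2 ∈ p e.2 := by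
  replace h := forall_of_mem_subst h
  induction h with
  | nil => simp at hf
  | cons h1 _ ih =>
    rcases List.mem_cons.1 hf with rfl | hf
    · exact ⟨_, List.mem_cons_self, h1⟩
    · obtain ⟨e, he, h⟩ := ih hf
      exact ⟨e, List.mem_cons_of_mem _ he, h⟩

theorem subst_mem_left {p : Vertex → Multiset Vertex} {E s : List Edge}
    (h : s ∈ subst p E) {e : Edge} (he : e ∈ E) : ∃ f ∈ s, f.1 ∈ p e.1 ∧ f.2 ∈ p e.2 := by
  replace h := forall_of_mem_subst h
  induction h with
  | nil => simp at he
  | cons h1 _ ih =>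
    rcases List.mem_cons.1 he with rfl | he
    · exact ⟨_, List.mem_cons_self, h1⟩
    · obtain ⟨e, he, h⟩ := ih he
      exact ⟨e, List.mem_cons_of_mem _ he, h⟩

theorem countP_le_of_mem_subst {p : Vertex → Multiset Vertex} {E s : List Edge}
    (h : s ∈ subst p E) (P Q : Edge → Bool)
    (hPQ : ∀ e f : Edge, f.1 ∈ p e.1 → f.2 ∈ p e.2 → P e = true → Q f = true) :
    E.countP P ≤ s.countP Q := by
  replace h := forall_of_mem_subst h
  induction h with
  | nil => simp
  | @cons e f _ _ h1 _ ih =>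
    rw [List.countP_cons, List.countP_cons]
    have := hPQ e f h1.1 h1.2
    split_ifs <;> first | omega | (exfalso; tauto)

theorem sign_move {M : Type*} [AddCommGroup M] {F : List Edge → M}
    (hF : ∀ l₁ l₂ e f, F (l₁ ++ e :: f :: l₂) + F (l₁ ++ f :: e :: l₂) = 0)
    (l₁ l₂ l₃ : List Edge) (e : Edge) :
    F (l₁ ++ e :: (l₂ ++ l₃)) = (-1 : ℤ) ^ l₂.length • F (l₁ ++ (l₂ ++ e :: l₃)) := by
  induction l₂ generalizing l₁ with
  | nil => simp
  | cons f l₂ ih =>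
    have h := ih (l₁ ++ [f])
    simp only [List.append_assoc, List.cons_append, List.nil_append] at h ⊢
    rw [eq_neg_of_add_eq_zero_left (hF l₁ (l₂ ++ l₃) e f), h]
    simp [pow_succ]

theorem eq_zero_of_not_nodup (K : Type*) [Field K] [CharZero K] {M : Type*} [AddCommGroup M]
    [Module K M] {F : List Edge → M}
    (hF : ∀ l₁ l₂ e f, F (l₁ ++ e :: f :: l₂) + F (l₁ ++ f :: e :: l₂) = 0)
    {E : List Edge} (hE : ¬ E.Nodup) : F E = 0 := by
  obtain ⟨e, he⟩ : ∃ e, List.Duplicate e E := by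
    by_contra h
    push Not at h
    exact hE (List.nodup_iff_forall_not_duplicate.2 h)
  obtain ⟨l₁, l₂, l₃, rfl⟩ : ∃ l₁ l₂ l₃, E = l₁ ++ e :: (l₂ ++ e :: l₃) := by
    clear hE
    induction he with
    | cons_mem h =>
      obtain ⟨s, t, rfl⟩ := List.append_of_mem h
      exact ⟨[], s, t, rfl⟩
    | @cons_duplicate y l _ ih =>
      obtain ⟨l₁, l₂, l₃, rfl⟩ := ih
      exact ⟨y :: l₁, l₂, l₃, rfl⟩
  rw [sign_move hF]
  have h := sign_move hF l₁ l₂ (e :: l₃) e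
  have h2 := hF (l₁ ++ l₂) l₃ e e
  simp only [List.append_assoc] at h2
  have h3 : F (l₁ ++ (l₂ ++ e :: e :: l₃)) = 0 := by
    rw [← two_smul K] at h2
    exact (smul_eq_zero_iff_right (two_ne_zero (α := K))).1 h2
  rw [h3, smul_zero]

theorem Admissible.perm {n m : ℕ} {E F : List Edge} (h : Admissible n m E) (p : E.Perm F) :
    Admissible n m F where
  one_le := h.one_le
  mem := fun e he => h.mem e (p.mem_iff.2 he)
  nodup := p.nodup_iff.1 h.nodup
  loopless := fun e he => h.loopless e (p.mem_iff.2 he)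
  incoming := fun k hk => by rw [← p.countP_eq]; exact h.incoming k hk
  outgoing := fun k hk => by rw [← p.countP_eq]; exact h.outgoing k hk
  connected := by
    have h := h.connected
    rw [connected_iff] at h ⊢
    exact fun S h1 h2 => h S h1 fun e he => h2 e (p.mem_iff.1 he)

theorem mapVertices_mapVertices (f g : Vertex → Vertex) (E : List Edge) :
    mapVertices f (mapVertices g E) = mapVertices (f ∘ g) E := by
  simp [mapVertices, Function.comp_def, Prod.map]

theorem relabel_mem {n m : ℕ} {ρ : Equiv.Perm ℕ}
    (hρ : ∀ k, Vertex.int k ∉ vertices n m → ρ k = k) (a : Vertex) :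
    relabel ρ a ∈ vertices n m ↔ a ∈ vertices n m := by
  cases a with
  | ext i => rfl
  | int k =>
    simp only [relabel]
    constructor
    · intro h
      by_contra h1
      rw [hρ k h1] at h
      exact h1 h
    · intro h
      by_contra h1
      exact h1 (by rw [ρ.injective (hρ _ h1)]; exact h)

theorem relabel_injective (ρ : Equiv.Perm ℕ) : Function.Injective (relabel ρ) := by
  rintro (_ | _) (_ | _) h <;> simp_all [relabel]

theorem Admissible.relabel {n m : ℕ} {E : List Edge} {ρ : Equiv.Perm ℕ}
    (hρ : ∀ k, Vertex.int k ∉ vertices n m → ρ k = k) (h : Admissible n m E) :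
    Admissible n m (mapVertices (relabel ρ) E) := by
  have hinj := relabel_injective ρ
  have hk' : ∀ k, Vertex.int k ∈ vertices n m →
      ∃ l, Vertex.int l ∈ vertices n m ∧ ρ l = k := by
    intro k hk
    refine ⟨ρ.symm k, ?_, by simp⟩
    rw [← relabel_mem hρ]
    simpa [_root_.relabel] using hk
  refine ⟨h.one_le, ?_, ?_, ?_, ?_, ?_, ?_⟩
  · intro e he
    obtain ⟨f, hf, rfl⟩ := List.mem_map.1 he
    simpa [relabel_mem hρ] using h.mem f hf
  · exact h.nodup.map (hinj.prodMap hinj)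
  · intro e he
    obtain ⟨f, hf, rfl⟩ := List.mem_map.1 he
    exact fun h' => h.loopless f hf (hinj h')
  · intro k hk
    obtain ⟨l, hl, rfl⟩ := hk' k hk
    have := h.incoming l hl
    rw [mapVertices, List.countP_map]
    convert this using 2
    funext e
    exact decide_eq_decide.2 (hinj.eq_iff (b := Vertex.int l))
  · intro k hk
    obtain ⟨l, hl, rfl⟩ := hk' k hk
    have := h.outgoing l hl
    rw [mapVertices, List.countP_map]
    convert this using 2
    funext e
    exact decide_eq_decide.2 (hinj.eq_iff (b := Vertex.int l))
  · have hc := h.connected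
    rw [connected_iff] at hc ⊢
    intro S h1 h2 k hk
    obtain ⟨l, hl, rfl⟩ := hk' k hk
    exact hc (fun a => S (_root_.relabel ρ a)) h1
      (fun e he => h2 _ (List.mem_map_of_mem (f := Prod.map _ _) he)) l hl

theorem admissible_relabel_iff {n m : ℕ} {E : List Edge} {ρ : Equiv.Perm ℕ}
    (hρ : ∀ k, Vertex.int k ∉ vertices n m → ρ k = k) :
    Admissible n m (mapVertices (relabel ρ) E) ↔ Admissible n m E := by
  refine ⟨fun h => ?_, fun h => h.relabel hρ⟩
  have := h.relabel (ρ := ρ.symm) fun k hk => by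
    rw [Equiv.symm_apply_eq]; exact (hρ k hk).symm
  rw [mapVertices_mapVertices] at this
  convert this
  have : relabel ρ.symm ∘ relabel ρ = id := by
    funext a; cases a <;> simp [relabel]
  simp [this, mapVertices]

section

variable {K : Type*} [Field K]

theorem linearCombination_toChain {M : Type*} [AddCommGroup M] [Module K M] {n m : ℕ}
    (F : List Edge → M) (E : List Edge) [Decidable (Admissible n m E)] :
    Finsupp.linearCombination K (fun E : {E : List Edge // Admissible n m E} => F E.1)
      (toChain K n m E) = if Admissible n m E then F E else 0 := by
  unfold toChain
  split_ifs <;> simp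

theorem cls_order (n m : ℕ) (l₁ l₂ : List Edge) (e f : Edge) :
    cls K n m (l₁ ++ e :: f :: l₂) + cls K n m (l₁ ++ f :: e :: l₂) = 0 := by
  rw [cls, cls, ← map_add, Submodule.mkQ_apply, Submodule.Quotient.mk_eq_zero]
  exact Submodule.subset_span (.order m l₁ l₂ e f)

theorem cls_relabel {n m : ℕ} (ρ : Equiv.Perm ℕ)
    (hρ : ∀ k, Vertex.int k ∉ vertices n m → ρ k = k) (E : List Edge) :
    cls K n m (mapVertices (relabel ρ) E) = cls K n m E := by
  rw [← sub_eq_zero, cls, cls, ← map_sub, Submodule.mkQ_apply, Submodule.Quotient.mk_eq_zero]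
  exact Submodule.subset_span (.unlabel m ρ hρ E)

theorem cls_ihx {n m : ℕ} {E : List Edge}
    (hE : ∀ e ∈ E, e.1 ∈ vertices n m ∧ e.2 ∈ vertices n m ∧ e.1 ≠ e.2)
    (hc : ConnectedToExternal n m E) {v : ℕ} (hv : Vertex.int v ∈ vertices n m) :
    ((subst (splitAt v (m + 1)) E).map fun s =>
      cls K n (m + 1) (s ++ [(Vertex.int v, Vertex.int (m + 1))])).sum = 0 := by
  have : ((subst (splitAt v (m + 1)) E).map fun s =>
      cls K n (m + 1) (s ++ [(Vertex.int v, Vertex.int (m + 1))])).sum =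
      (relations K n (m + 1)).mkQ (((subst (splitAt v (m + 1)) E).map fun s =>
        toChain K n (m + 1) (s ++ [(Vertex.int v, Vertex.int (m + 1))])).sum) := by
    rw [map_multiset_sum, Multiset.map_map]; rfl
  rw [this, Submodule.mkQ_apply, Submodule.Quotient.mk_eq_zero]
  exact Submodule.subset_span (.ihx m E hE hc v hv)

theorem cls_of_not_admissible {n m : ℕ} {E : List Edge} (h : ¬ Admissible n m E) :
    cls K n m E = 0 := by
  simp [cls, toChain, h]

/-- A criterion for a function on graphs to descend to the quotient. -/
theorem relations_le_ker {M : Type*} [AddCommGroup M] [Module K M] [CharZero K] {n m : ℕ}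
    (F : List Edge → M)
    (h1 : ∀ l₁ l₂ e f, F (l₁ ++ e :: f :: l₂) + F (l₁ ++ f :: e :: l₂) = 0)
    (h2 : ∀ ρ : Equiv.Perm ℕ, (∀ k, Vertex.int k ∉ vertices n m → ρ k = k) →
      ∀ E, F (mapVertices (relabel ρ) E) = F E)
    (h3 : ∀ m', m' + 1 = m → ∀ E : List Edge,
      (∀ e ∈ E, e.1 ∈ vertices n m' ∧ e.2 ∈ vertices n m' ∧ e.1 ≠ e.2) →
      ConnectedToExternal n m' E → ∀ v, Vertex.int v ∈ vertices n m' →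
      ((subst (splitAt v (m' + 1)) E).map fun s =>
        F (s ++ [(Vertex.int v, Vertex.int (m' + 1))])).sum = 0)
    (h4 : ∀ (E : List Edge) (k : ℕ), Vertex.int k ∈ vertices n m →
      (1 < E.countP (fun e => decide (e.2 = Vertex.int k)) ∨
        2 < E.countP (fun e => decide (e.1 = Vertex.int k))) → F E = 0) :
    relations K n m ≤ LinearMap.ker
      (Finsupp.linearCombination K fun E : {E : List Edge // Admissible n m E} => F E.1) := by
  classical
  rw [relations, Submodule.span_le]
  intro x hx
  rw [Set.mem_ofPred_eq] at hx
  rw [SetLike.mem_coe, LinearMap.mem_ker]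
  induction hx with
  | order m l₁ l₂ e f =>
    have hp : (l₁ ++ e :: f :: l₂).Perm (l₁ ++ f :: e :: l₂) :=
      (List.Perm.swap f e l₂).append_left l₁
    rw [map_add, linearCombination_toChain, linearCombination_toChain,
      if_congr ⟨fun h => h.perm hp, fun h => h.perm hp.symm⟩ rfl rfl]
    split_ifs
    · exact h1 _ _ _ _
    · simp
  | unlabel m ρ hρ E =>
    rw [map_sub, linearCombination_toChain, linearCombination_toChain,
      if_congr (admissible_relabel_iff hρ) rfl rfl, h2 ρ hρ, sub_self]
  | ihx m E hE hc v hv =>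
    rw [map_multiset_sum, Multiset.map_map, ← h3 m rfl E hE hc v hv]
    congr 1
    refine Multiset.map_congr rfl fun s hs => ?_
    rw [Function.comp_apply, linearCombination_toChain]
    split_ifs with hadm
    · rfl
    symm
    have hvm := mem_vertices_int.1 hv
    by_contra hne
    apply hadm
    have hmem : ∀ a b : Vertex, a ∈ vertices n m → b ∈ splitAt v (m + 1) a →
        b ∈ vertices n (m + 1) := by
      intro a b ha hb
      rw [vertices_succ, Multiset.mem_add]
      unfold splitAt at hb
      split_ifs at hb with h
      · simp only [Multiset.insert_eq_cons, Multiset.mem_cons, Multiset.mem_singleton] at hb ⊢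
        rcases hb with rfl | rfl
        · exact .inl hv
        · exact .inr rfl
      · rw [Multiset.mem_singleton] at hb
        exact .inl (hb ▸ ha)
    refine ⟨?_, ?_, ?_, ?_, ?_, ?_, ?_⟩
    · obtain ⟨i, hi, -⟩ := hc v hv
      have := mem_vertices_ext.1 hi
      omega
    · intro e he
      rcases List.mem_append.1 he with he | he
      · obtain ⟨f, hf, h⟩ := subst_mem_right hs he
        exact ⟨hmem _ _ (hE f hf).1 h.1, hmem _ _ (hE f hf).2.1 h.2⟩
      · rw [List.mem_singleton] at he
        subst he
        exact ⟨mem_vertices_int.2 (by omega), mem_vertices_int.2 (by omega)⟩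
    · by_contra h
      exact hne (eq_zero_of_not_nodup K h1 h)
    · intro e he
      rcases List.mem_append.1 he with he | he
      · obtain ⟨f, hf, h⟩ := subst_mem_right hs he
        have hf' := hE f hf
        have hf1 : f.1 ≠ .int (m + 1) := by
          intro h; rw [h] at hf'; have := mem_vertices_int.1 hf'.1; omega
        have hf2 : f.2 ≠ .int (m + 1) := by
          intro h; rw [h] at hf'; have := mem_vertices_int.1 hf'.2.1; omega
        obtain ⟨ha, hb⟩ := h
        unfold splitAt at ha hb
        intro hab
        rw [hab] at ha
        split_ifs at ha hb with h3 h4 h4 <;>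
          simp only [Multiset.insert_eq_cons, Multiset.mem_cons, Multiset.mem_singleton] at ha hb
        · exact hf'.2.2 (h3.trans h4.symm)
        · rcases ha with ha | ha
          · exact h4 (hb.symm.trans ha)
          · exact hf2 (hb.symm.trans ha)
        · rcases hb with hb | hb
          · exact h3 (ha.symm.trans hb)
          · exact hf1 (ha.symm.trans hb)
        · exact hf'.2.2 (ha.symm.trans hb)
      · rw [List.mem_singleton] at he
        subst he
        intro h
        injection h with h
        omega
    · intro k hk
      by_contra h
      exact hne (h4 _ k hk (.inl (not_le.1 h)))
    · intro k hk
      by_contra h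
      exact hne (h4 _ k hk (.inr (not_le.1 h)))
    · rw [connected_iff] at hc ⊢
      intro S hS1 hS2
      have hvS : S (.int v) ↔ S (.int (m + 1)) := hS2 (.int v, .int (m + 1)) (by simp)
      have hsp : ∀ a b, b ∈ splitAt v (m + 1) a → (S a ↔ S b) := by
        intro a b hb
        unfold splitAt at hb
        split_ifs at hb with h
        · simp only [Multiset.insert_eq_cons, Multiset.mem_cons, Multiset.mem_singleton] at hb
          rcases hb with rfl | rfl
          · rw [h]
          · rw [h, hvS]
        · rw [Multiset.mem_singleton.1 hb]
      have hall := hc S (fun i hi => hS1 i (by rw [vertices_succ]; simp [hi])) fun e he => by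
        obtain ⟨f, hf, h⟩ := subst_mem_left hs he
        rw [hsp _ _ h.1, hsp _ _ h.2]
        exact hS2 f (List.mem_append_left _ hf)
      intro k hk
      rw [vertices_succ, Multiset.mem_add, Multiset.mem_singleton] at hk
      rcases hk with hk | hk
      · exact hall k hk
      · injection hk with hk
        rw [hk, ← hvS]
        exact hall v hv


end

theorem length_of_mem_subst {p : Vertex → Multiset Vertex} {E s : List Edge}
    (h : s ∈ subst p E) : s.length = E.length :=
  (forall_of_mem_subst h).length_eq.symm

theorem bind_rotate {α β γ δ : Type*} (A : Multiset α) (B : Multiset β) (C : Multiset γ)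
    (g : α → β → γ → Multiset δ) :
    (A.bind fun a => B.bind fun b => C.bind fun c => g a b c) =
      C.bind fun c => A.bind fun a => B.bind fun b => g a b c := by
  rw [Multiset.bind_bind C A]
  exact Multiset.bind_congr fun a _ => Multiset.bind_bind _ _

theorem subst_swap (p : Vertex → Multiset Vertex) (l₁ l₂ : List Edge) (e f : Edge) :
    ∃ X : Multiset (List Edge × Edge × Edge × List Edge),
      subst p (l₁ ++ e :: f :: l₂) = X.map (fun x => x.1 ++ x.2.1 :: x.2.2.1 :: x.2.2.2) ∧
      subst p (l₁ ++ f :: e :: l₂) = X.map (fun x => x.1 ++ x.2.2.1 :: x.2.1 :: x.2.2.2) := by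
  refine ⟨(subst p l₁).bind fun s => (p e.1).bind fun a => (p e.2).bind fun b =>
    (p f.1).bind fun c => (p f.2).bind fun d => (subst p l₂).map fun t =>
      (s, (a, b), (c, d), t), ?_, ?_⟩
  · rw [subst_append]
    simp only [subst, Multiset.map_bind, Multiset.map_map, Function.comp_def]
  · rw [subst_append]
    simp only [subst, Multiset.map_bind, Multiset.map_map, Function.comp_def]
    refine Multiset.bind_congr fun s _ => ?_
    rw [bind_rotate (p e.1) (p e.2) (p f.1)]
    refine Multiset.bind_congr fun c _ => ?_
    rw [bind_rotate (p e.1) (p e.2) (p f.2)]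

theorem innerVertex_ne_outerVertex {n₁ m₁ n₂ m₂ j : ℕ} {a b : Vertex}
    (ha : a ∈ vertices n₂ m₂) (hb : b ∈ vertices n₁ m₁) (hbj : b ≠ .ext j) :
    innerVertex j m₁ a ≠ outerVertex j n₂ b := by
  cases a with
  | ext i =>
    cases b with
    | ext k =>
      have := mem_vertices_ext.1 ha
      have := mem_vertices_ext.1 hb
      have : k ≠ j := fun h => hbj (by rw [h])
      simp only [innerVertex, outerVertex]
      split_ifs
      · intro h; injection h with h; omega
      · intro h; injection h with h; omega
    | int k => simp [innerVertex, outerVertex]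
  | int i =>
    cases b with
    | ext k => simp only [innerVertex, outerVertex]; split_ifs <;> simp
    | int k =>
      have := mem_vertices_int.1 ha
      have := mem_vertices_int.1 hb
      simp only [innerVertex, outerVertex]
      intro h; injection h with h; omega

theorem innerVertex_injective {m₁ j : ℕ} (hj : 1 ≤ j) :
    Function.Injective (innerVertex j m₁) := by
  rintro (a | a) (b | b) h <;> simp only [innerVertex, Vertex.ext.injEq, Vertex.int.injEq,
    reduceCtorEq] at h ⊢ <;> omega

theorem outerVertex_inj {n₂ j : ℕ} (hn : 1 ≤ n₂) {a b : Vertex} (ha : a ≠ .ext j)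
    (hb : b ≠ .ext j) (h : outerVertex j n₂ a = outerVertex j n₂ b) : a = b := by
  cases a with
  | ext i =>
    cases b with
    | ext k =>
      have : i ≠ j := fun h => ha (by rw [h])
      have : k ≠ j := fun h => hb (by rw [h])
      simp only [outerVertex] at h
      split_ifs at h <;> injection h with h <;> congr 1 <;> omega
    | int k => simp only [outerVertex] at h; split_ifs at h
  | int i =>
    cases b with
    | ext k => simp only [outerVertex] at h; split_ifs at h
    | int k => simpa [outerVertex] using h

section

variable {n₁ m₁ n₂ m₂ n m j : ℕ}

theorem innerVertex_mem (hn : n₁ + n₂ = n + 1) (hm : m₁ + m₂ = m) (hj : 1 ≤ j ∧ j ≤ n₁)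
    {a : Vertex} (ha : a ∈ vertices n₂ m₂) : innerVertex j m₁ a ∈ vertices n m := by
  cases a with
  | ext i =>
    have := mem_vertices_ext.1 ha
    exact mem_vertices_ext.2 (by omega)
  | int i =>
    have := mem_vertices_int.1 ha
    exact mem_vertices_int.2 (by omega)

theorem plug_mem (hn : n₁ + n₂ = n + 1) (hm : m₁ + m₂ = m) (hj : 1 ≤ j ∧ j ≤ n₁) (hn₂ : 1 ≤ n₂)
    {a b : Vertex} (ha : a ∈ vertices n₁ m₁) (hb : b ∈ plug j m₁ n₂ m₂ a) :
    b ∈ vertices n m := by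
  unfold plug at hb
  split_ifs at hb with h
  · obtain ⟨c, hc, rfl⟩ := Multiset.mem_map.1 hb
    exact innerVertex_mem hn hm hj hc
  · rw [Multiset.mem_singleton] at hb
    subst hb
    cases a with
    | ext i =>
      have := mem_vertices_ext.1 ha
      have : i ≠ j := fun h' => h (by rw [h'])
      simp only [outerVertex]
      split_ifs <;> exact mem_vertices_ext.2 (by omega)
    | int i =>
      have := mem_vertices_int.1 ha
      exact mem_vertices_int.2 (by omega)

theorem plug_disjoint (hn₂ : 1 ≤ n₂) {a b c : Vertex} (ha : a ∈ vertices n₁ m₁)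
    (hb : b ∈ vertices n₁ m₁) (hab : a ≠ b) (hca : c ∈ plug j m₁ n₂ m₂ a) :
    c ∉ plug j m₁ n₂ m₂ b := by
  intro hcb
  unfold plug at hca hcb
  split_ifs at hca hcb with h1 h2 h2
  · exact hab (h1.trans h2.symm)
  · obtain ⟨d, hd, rfl⟩ := Multiset.mem_map.1 hca
    exact innerVertex_ne_outerVertex hd hb h2 (Multiset.mem_singleton.1 hcb)
  · obtain ⟨d, hd, rfl⟩ := Multiset.mem_map.1 hcb
    exact innerVertex_ne_outerVertex hd ha h1 (Multiset.mem_singleton.1 hca)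
  · rw [Multiset.mem_singleton] at hca hcb
    exact hab (outerVertex_inj hn₂ h1 h2 (hca.symm.trans hcb))

theorem composite_good (hn : n₁ + n₂ = n + 1) (hm : m₁ + m₂ = m) (hj : 1 ≤ j ∧ j ≤ n₁)
    (hn₂ : 1 ≤ n₂) {E₁ E₂ s : List Edge}
    (h₁ : ∀ e ∈ E₁, e.1 ∈ vertices n₁ m₁ ∧ e.2 ∈ vertices n₁ m₁ ∧ e.1 ≠ e.2)
    (h₂ : ∀ e ∈ E₂, e.1 ∈ vertices n₂ m₂ ∧ e.2 ∈ vertices n₂ m₂ ∧ e.1 ≠ e.2)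
    (hs : s ∈ subst (plug j m₁ n₂ m₂) E₁) :
    ∀ e ∈ s ++ mapVertices (innerVertex j m₁) E₂,
      e.1 ∈ vertices n m ∧ e.2 ∈ vertices n m ∧ e.1 ≠ e.2 := by
  intro e he
  rcases List.mem_append.1 he with he | he
  · obtain ⟨f, hf, h⟩ := subst_mem_right hs he
    have hf' := h₁ f hf
    refine ⟨plug_mem hn hm hj hn₂ hf'.1 h.1, plug_mem hn hm hj hn₂ hf'.2.1 h.2, ?_⟩
    intro hab
    exact plug_disjoint hn₂ hf'.1 hf'.2.1 hf'.2.2 h.1 (hab ▸ h.2)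
  · obtain ⟨f, hf, rfl⟩ := List.mem_map.1 he
    have hf' := h₂ f hf
    exact ⟨innerVertex_mem hn hm hj hf'.1, innerVertex_mem hn hm hj hf'.2.1,
      fun h => hf'.2.2 (innerVertex_injective hj.1 h)⟩

theorem composite_connected (hn : n₁ + n₂ = n + 1) (hm : m₁ + m₂ = m) (hj : 1 ≤ j ∧ j ≤ n₁)
    (hn₂ : 1 ≤ n₂) {E₁ E₂ s : List Edge}
    (h₁ : ConnectedToExternal n₁ m₁ E₁) (h₂ : ConnectedToExternal n₂ m₂ E₂)
    (hs : s ∈ subst (plug j m₁ n₂ m₂) E₁) :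
    ConnectedToExternal n m (s ++ mapVertices (innerVertex j m₁) E₂) := by
  rw [connected_iff] at h₁ h₂ ⊢
  intro S hS1 hS2
  have hin : ∀ a ∈ vertices n₂ m₂, S (innerVertex j m₁ a) := by
    have hext : ∀ i, Vertex.ext i ∈ vertices n₂ m₂ → S (innerVertex j m₁ (.ext i)) :=
      fun i hi => hS1 _ (innerVertex_mem hn hm hj hi)
    rintro (i | i) hi
    · exact hext i hi
    · exact h₂ (fun a => S (innerVertex j m₁ a)) hext
        (fun e he => hS2 _ (List.mem_append_right _ (List.mem_map_of_mem (f := Prod.map _ _) he)))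
        i hi
  have hpl : ∀ a b, b ∈ plug j m₁ n₂ m₂ a → ((a = .ext j ∨ S (outerVertex j n₂ a)) ↔ S b) := by
    intro a b hb
    unfold plug at hb
    split_ifs at hb with h
    · obtain ⟨c, hc, rfl⟩ := Multiset.mem_map.1 hb
      simp [h, hin c hc]
    · rw [Multiset.mem_singleton.1 hb]
      simp [h]
  have hout := h₁ (fun a => a = .ext j ∨ S (outerVertex j n₂ a)) (by
      intro i hi
      by_cases h : Vertex.ext i = .ext j
      · exact .inl h
      · refine .inr ?_
        have hmem := plug_mem (m₂ := m₂) hn hm hj hn₂ hi (b := outerVertex j n₂ (.ext i))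
          (by simp [plug, h])
        simp only [outerVertex] at hmem ⊢
        split_ifs at hmem ⊢ <;> exact hS1 _ hmem) (by
      intro e he
      obtain ⟨f, hf, h⟩ := subst_mem_left hs he
      rw [hpl _ _ h.1, hpl _ _ h.2]
      exact hS2 f (List.mem_append_left _ hf))
  intro k hk
  have hk' := mem_vertices_int.1 hk
  by_cases hkm : k ≤ m₁
  · simpa [outerVertex] using hout k (mem_vertices_int.2 ⟨hk'.1, hkm⟩)
  · have := hin (.int (k - m₁)) (mem_vertices_int.2 (by omega))
    simp only [innerVertex] at this
    rwa [show m₁ + (k - m₁) = k by omega] at this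

variable {K : Type*} [Field K]

theorem insertion_order_left (E₂ l₁ l₂ : List Edge) (e f : Edge) :
    insertion K m₁ n₂ m₂ n m j (l₁ ++ e :: f :: l₂) E₂ +
      insertion K m₁ n₂ m₂ n m j (l₁ ++ f :: e :: l₂) E₂ = 0 := by
  obtain ⟨X, h1, h2⟩ := subst_swap (plug j m₁ n₂ m₂) l₁ l₂ e f
  rw [insertion, insertion, h1, h2, Multiset.map_map, Multiset.map_map, ← Multiset.sum_map_add]
  refine Multiset.sum_eq_zero fun y hy => ?_
  obtain ⟨x, -, rfl⟩ := Multiset.mem_map.1 hy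
  simpa using cls_order (K := K) n m x.1
    (x.2.2.2 ++ mapVertices (innerVertex j m₁) E₂) x.2.1 x.2.2.1

theorem insertion_order_right (E₁ l₁ l₂ : List Edge) (e f : Edge) :
    insertion K m₁ n₂ m₂ n m j E₁ (l₁ ++ e :: f :: l₂) +
      insertion K m₁ n₂ m₂ n m j E₁ (l₁ ++ f :: e :: l₂) = 0 := by
  rw [insertion, insertion, ← Multiset.sum_map_add]
  refine Multiset.sum_eq_zero fun y hy => ?_
  obtain ⟨s, -, rfl⟩ := Multiset.mem_map.1 hy
  simpa [mapVertices] using cls_order (K := K) n m (s ++ mapVertices (innerVertex j m₁) l₁)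
    (mapVertices (innerVertex j m₁) l₂) (Prod.map (innerVertex j m₁) (innerVertex j m₁) e)
    (Prod.map (innerVertex j m₁) (innerVertex j m₁) f)

theorem mapVertices_congr {f g : Vertex → Vertex} {E : List Edge}
    (h : ∀ e ∈ E, f e.1 = g e.1 ∧ f e.2 = g e.2) : mapVertices f E = mapVertices g E :=
  List.map_congr_left fun e he => Prod.ext (h e he).1 (h e he).2

theorem insertion_relabel_left (hm : m₁ + m₂ = m) {ρ : Equiv.Perm ℕ}
    (hρ : ∀ k, Vertex.int k ∉ vertices n₁ m₁ → ρ k = k) (E₁ : List Edge) {E₂ : List Edge}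
    (h₂ : ∀ e ∈ E₂, e.1 ∈ vertices n₂ m₂ ∧ e.2 ∈ vertices n₂ m₂) :
    insertion K m₁ n₂ m₂ n m j (mapVertices (relabel ρ) E₁) E₂ =
      insertion K m₁ n₂ m₂ n m j E₁ E₂ := by
  have hin : ∀ a ∈ vertices n₂ m₂, relabel ρ (innerVertex j m₁ a) = innerVertex j m₁ a := by
    rintro (i | i) hi
    · rfl
    · have := mem_vertices_int.1 hi
      simp only [innerVertex, relabel]
      rw [hρ]
      rw [mem_vertices_int]
      omega
  have hpl : (fun a => plug j m₁ n₂ m₂ (relabel ρ a)) =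
      fun a => (plug j m₁ n₂ m₂ a).map (relabel ρ) := by
    funext a
    cases a with
    | ext i =>
      change plug j m₁ n₂ m₂ (.ext i) = _
      unfold plug
      split_ifs with h
      · rw [Multiset.map_map]
        exact Multiset.map_congr rfl fun a ha => (hin a ha).symm
      · rw [outerVertex]
        split_ifs <;> rfl
    | int k => simp [plug, relabel, outerVertex]
  have hE₂ : mapVertices (innerVertex j m₁) E₂ =
      mapVertices (relabel ρ) (mapVertices (innerVertex j m₁) E₂) := by
    rw [mapVertices_mapVertices]
    exact mapVertices_congr fun e he => ⟨(hin _ (h₂ e he).1).symm, (hin _ (h₂ e he).2).symm⟩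
  rw [insertion, insertion, subst_mapVertices, hpl, ← subst_map, Multiset.map_map]
  congr 1
  refine Multiset.map_congr rfl fun s _ => ?_
  rw [Function.comp_apply, ← cls_relabel ρ (fun k hk => hρ k fun hk' => hk ?_)
    (s ++ mapVertices (innerVertex j m₁) E₂)]
  · conv_lhs => rw [hE₂]
    simp [mapVertices]
  · have := mem_vertices_int.1 hk'
    exact mem_vertices_int.2 (by omega)

theorem nodup_vertices (n m : ℕ) : (vertices n m).Nodup := by
  rw [vertices, Multiset.nodup_add]
  refine ⟨(Multiset.nodup_range n).map ?_, (Multiset.nodup_range m).map ?_, ?_⟩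
  · intro a b h; simpa using h
  · intro a b h; simpa using h
  · rw [Multiset.disjoint_left]
    intro a ha hb
    obtain ⟨i, -, rfl⟩ := Multiset.mem_map.1 ha
    obtain ⟨k, -, hk⟩ := Multiset.mem_map.1 hb
    cases hk

theorem vertices_relabel {n m : ℕ} {ρ : Equiv.Perm ℕ}
    (hρ : ∀ k, Vertex.int k ∉ vertices n m → ρ k = k) :
    (vertices n m).map (relabel ρ) = vertices n m := by
  refine (Multiset.Nodup.ext ((nodup_vertices n m).map (relabel_injective ρ))
    (nodup_vertices n m)).2 fun a => ?_
  rw [Multiset.mem_map]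
  constructor
  · rintro ⟨b, hb, rfl⟩
    exact (relabel_mem hρ b).2 hb
  · intro ha
    have : relabel ρ (relabel ρ.symm a) = a := by cases a <;> simp [relabel]
    exact ⟨relabel ρ.symm a, by rw [← relabel_mem hρ, this]; exact ha, this⟩

theorem exists_shift (m₁ : ℕ) (ρ : Equiv.Perm ℕ) (h0 : ρ 0 = 0) :
    ∃ τ : Equiv.Perm ℕ, (∀ k ≤ m₁, τ k = k) ∧ ∀ k, τ (m₁ + k) = m₁ + ρ k := by
  have h0' : ρ.symm 0 = 0 := by rw [Equiv.symm_apply_eq, h0]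
  have key : ∀ (σ : Equiv.Perm ℕ), σ 0 = 0 → ∀ k, m₁ < k → m₁ < m₁ + σ (k - m₁) := by
    intro σ hσ k hk
    have : σ (k - m₁) ≠ 0 := fun h => by
      have := σ.injective (h.trans hσ.symm)
      omega
    omega
  refine ⟨⟨fun k => if k ≤ m₁ then k else m₁ + ρ (k - m₁),
    fun k => if k ≤ m₁ then k else m₁ + ρ.symm (k - m₁), ?_, ?_⟩, ?_, ?_⟩
  · intro k
    by_cases hk : k ≤ m₁
    · simp [hk]
    · have := key ρ h0 k (by omega)
      simp only [hk, if_false, if_neg (not_le.2 this)]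
      simp; omega
  · intro k
    by_cases hk : k ≤ m₁
    · simp [hk]
    · have := key ρ.symm h0' k (by omega)
      simp only [hk, if_false, if_neg (not_le.2 this)]
      simp; omega
  · intro k hk
    simp [hk]
  · intro k
    rcases Nat.eq_zero_or_pos k with rfl | hk
    · simp [h0]
    · simp [hk.ne']

theorem insertion_relabel_right (hm : m₁ + m₂ = m) {ρ : Equiv.Perm ℕ}
    (hρ : ∀ k, Vertex.int k ∉ vertices n₂ m₂ → ρ k = k) (E₂ : List Edge) {E₁ : List Edge}
    (h₁ : ∀ e ∈ E₁, e.1 ∈ vertices n₁ m₁ ∧ e.2 ∈ vertices n₁ m₁) :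
    insertion K m₁ n₂ m₂ n m j E₁ (mapVertices (relabel ρ) E₂) =
      insertion K m₁ n₂ m₂ n m j E₁ E₂ := by
  obtain ⟨τ, hτ1, hτ2⟩ := exists_shift m₁ ρ (hρ 0 (by rw [mem_vertices_int]; omega))
  have hin : ∀ a, innerVertex j m₁ (relabel ρ a) = relabel τ (innerVertex j m₁ a) := by
    rintro (i | i)
    · rfl
    · simp [relabel, innerVertex, hτ2]
  have hpl : ∀ a ∈ vertices n₁ m₁,
      plug j m₁ n₂ m₂ a = (plug j m₁ n₂ m₂ a).map (relabel τ) := by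
    intro a ha
    unfold plug
    split_ifs with h
    · rw [Multiset.map_map]
      conv_lhs => rw [← vertices_relabel hρ, Multiset.map_map]
      exact Multiset.map_congr rfl fun a _ => hin a
    · cases a with
      | ext i => simp only [outerVertex]; split_ifs <;> simp [relabel]
      | int k => simp [outerVertex, relabel, hτ1 k (mem_vertices_int.1 ha).2]
  have hs : subst (plug j m₁ n₂ m₂) E₁ =
      (subst (plug j m₁ n₂ m₂) E₁).map (mapVertices (relabel τ)) := by
    rw [subst_map]
    exact subst_congr fun e he => ⟨hpl _ (h₁ e he).1, hpl _ (h₁ e he).2⟩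
  rw [insertion, insertion]
  conv_lhs => rw [hs, Multiset.map_map]
  congr 1
  refine Multiset.map_congr rfl fun s _ => ?_
  rw [Function.comp_apply, mapVertices_mapVertices,
    mapVertices_congr (f := innerVertex j m₁ ∘ relabel ρ) (g := relabel τ ∘ innerVertex j m₁)
      (fun e _ => ⟨hin _, hin _⟩),
    ← mapVertices_mapVertices, ← cls_relabel (K := K) τ (fun k hk => ?_)
      (s ++ mapVertices (innerVertex j m₁) E₂)]
  · simp [mapVertices]
  · rw [mem_vertices_int] at hk
    by_cases hk' : k ≤ m₁
    · exact hτ1 k hk'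
    · have h := hτ2 (k - m₁)
      rw [hρ (k - m₁) (by rw [mem_vertices_int]; omega)] at h
      rwa [show m₁ + (k - m₁) = k by omega] at h

theorem insertion_valence_left (hm : m₁ + m₂ = m) (E₁ E₂ : List Edge) (k : ℕ)
    (hk : Vertex.int k ∈ vertices n₁ m₁)
    (h : 1 < E₁.countP (fun e => decide (e.2 = Vertex.int k)) ∨
      2 < E₁.countP (fun e => decide (e.1 = Vertex.int k))) :
    insertion K m₁ n₂ m₂ n m j E₁ E₂ = 0 := by
  refine Multiset.sum_eq_zero fun y hy => ?_
  obtain ⟨s, hs, rfl⟩ := Multiset.mem_map.1 hy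
  refine cls_of_not_admissible fun hadm => ?_
  have hk' : Vertex.int k ∈ vertices n m := by
    have := mem_vertices_int.1 hk
    exact mem_vertices_int.2 (by omega)
  have hpl : plug j m₁ n₂ m₂ (.int k) = {.int k} := by simp [plug, outerVertex]
  rcases h with h | h
  · have h1 := hadm.incoming k hk'
    have h2 := countP_le_of_mem_subst hs (fun e => decide (e.2 = Vertex.int k))
      (fun e => decide (e.2 = Vertex.int k)) (by
        intro e f _ h2 h3
        rw [decide_eq_true_eq] at h3 ⊢
        rw [h3, hpl] at h2
        exact Multiset.mem_singleton.1 h2)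
    rw [List.countP_append] at h1
    omega
  · have h1 := hadm.outgoing k hk'
    have h2 := countP_le_of_mem_subst hs (fun e => decide (e.1 = Vertex.int k))
      (fun e => decide (e.1 = Vertex.int k)) (by
        intro e f h2 _ h3
        rw [decide_eq_true_eq] at h3 ⊢
        rw [h3, hpl] at h2
        exact Multiset.mem_singleton.1 h2)
    rw [List.countP_append] at h1
    omega

theorem insertion_valence_right (hm : m₁ + m₂ = m) (E₁ E₂ : List Edge) (k : ℕ)
    (hk : Vertex.int k ∈ vertices n₂ m₂)
    (h : 1 < E₂.countP (fun e => decide (e.2 = Vertex.int k)) ∨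
      2 < E₂.countP (fun e => decide (e.1 = Vertex.int k))) :
    insertion K m₁ n₂ m₂ n m j E₁ E₂ = 0 := by
  refine Multiset.sum_eq_zero fun y hy => ?_
  obtain ⟨s, hs, rfl⟩ := Multiset.mem_map.1 hy
  refine cls_of_not_admissible fun hadm => ?_
  have hk' : Vertex.int (m₁ + k) ∈ vertices n m := by
    have := mem_vertices_int.1 hk
    exact mem_vertices_int.2 (by omega)
  rcases h with h | h
  · have h1 := hadm.incoming _ hk'
    rw [List.countP_append, mapVertices, List.countP_map] at h1
    have : E₂.countP (fun e => decide (e.2 = Vertex.int k)) ≤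
        E₂.countP ((fun e : Edge => decide (e.2 = Vertex.int (m₁ + k))) ∘
          Prod.map (innerVertex j m₁) (innerVertex j m₁)) :=
      List.countP_mono_left fun e _ he => by
        rw [decide_eq_true_eq] at he
        simp [he, innerVertex]
    omega
  · have h1 := hadm.outgoing _ hk'
    rw [List.countP_append, mapVertices, List.countP_map] at h1
    have : E₂.countP (fun e => decide (e.1 = Vertex.int k)) ≤
        E₂.countP ((fun e : Edge => decide (e.1 = Vertex.int (m₁ + k))) ∘
          Prod.map (innerVertex j m₁) (innerVertex j m₁)) :=
      List.countP_mono_left fun e _ he => by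
        rw [decide_eq_true_eq] at he
        simp [he, innerVertex]
    omega


theorem insertion_ihx_right (hn : n₁ + n₂ = n + 1) (hj : 1 ≤ j ∧ j ≤ n₁) {E₁ E : List Edge}
    (h₁ : Admissible n₁ m₁ E₁)
    (hE : ∀ e ∈ E, e.1 ∈ vertices n₂ m₂ ∧ e.2 ∈ vertices n₂ m₂ ∧ e.1 ≠ e.2)
    (hc : ConnectedToExternal n₂ m₂ E) {v : ℕ} (hv : Vertex.int v ∈ vertices n₂ m₂) :
    ((subst (splitAt v (m₂ + 1)) E).map fun s =>
      insertion K m₁ n₂ (m₂ + 1) n (m₁ + m₂ + 1) j E₁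
        (s ++ [(Vertex.int v, Vertex.int (m₂ + 1))])).sum = 0 := by
  have hv' := mem_vertices_int.1 hv
  have hn₂ : 1 ≤ n₂ := by
    obtain ⟨i, hi, -⟩ := hc v hv
    have := mem_vertices_ext.1 hi
    omega
  have hsp : ∀ a, splitAt (m₁ + v) (m₁ + m₂ + 1) (innerVertex j m₁ a) =
      (splitAt v (m₂ + 1) a).map (innerVertex j m₁) := by
    rintro (i | k)
    · simp [splitAt, innerVertex]
    · unfold splitAt
      by_cases h : k = v
      · subst h; simp [innerVertex, add_assoc]
      · simp [innerVertex, h]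
  have hpl : ∀ a ∈ vertices n₁ m₁,
      (plug j m₁ n₂ m₂ a).bind (splitAt (m₁ + v) (m₁ + m₂ + 1)) =
        plug j m₁ n₂ (m₂ + 1) a := by
    intro a ha
    unfold plug
    split_ifs with h
    · rw [Multiset.bind_map, vertices_succ, Multiset.map_add]
      obtain ⟨R, hR⟩ := Multiset.exists_cons_of_mem hv
      have hnd := nodup_vertices n₂ m₂
      rw [hR, Multiset.nodup_cons] at hnd
      have hRb : R.bind (fun a => splitAt (m₁ + v) (m₁ + m₂ + 1) (innerVertex j m₁ a)) =
          R.map (innerVertex j m₁) := by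
        rw [← Multiset.bind_singleton]
        refine Multiset.bind_congr fun a ha => ?_
        rw [hsp, splitAt, if_neg (fun h : a = .int v => hnd.1 (h ▸ ha))]
        rfl
      rw [hR, Multiset.cons_bind, hRb, hsp]
      simp only [splitAt, if_pos, Multiset.map_cons, Multiset.insert_eq_cons,
        Multiset.map_singleton, Multiset.cons_add, Multiset.singleton_add]
      congr 1
      rw [← Multiset.singleton_add, add_comm]
    · rw [Multiset.singleton_bind, splitAt, if_neg]
      cases a with
      | ext i => simp only [outerVertex]; split_ifs <;> simp
      | int k =>
        have := mem_vertices_int.1 ha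
        simp only [outerVertex]
        intro h; injection h with h; omega
  have key : (subst (plug j m₁ n₂ m₂) E₁).bind (fun w =>
        subst (splitAt (m₁ + v) (m₁ + m₂ + 1)) (w ++ mapVertices (innerVertex j m₁) E)) =
      (subst (splitAt v (m₂ + 1)) E).bind fun s =>
        (subst (plug j m₁ n₂ (m₂ + 1)) E₁).map fun t => t ++ mapVertices (innerVertex j m₁) s := by
    simp only [subst_append, subst_mapVertices, hsp]
    simp only [← subst_map, Multiset.map_map, Function.comp_def]
    rw [← Multiset.bind_assoc, subst_bind,
      subst_congr (q := plug j m₁ n₂ (m₂ + 1)) fun e he =>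
        ⟨hpl _ (h₁.mem e he).1, hpl _ (h₁.mem e he).2⟩, Multiset.bind_map_comm]
  have hsum := congrArg (fun X : Multiset (List Edge) => (X.map fun x =>
    cls K n (m₁ + m₂ + 1) (x ++ [(Vertex.int (m₁ + v), Vertex.int (m₁ + m₂ + 1))])).sum) key
  simp only [Multiset.map_bind, Multiset.sum_bind, Multiset.map_map] at hsum
  rw [Multiset.sum_eq_zero] at hsum
  · rw [hsum]
    congr 1
    refine Multiset.map_congr rfl fun s _ => ?_
    rw [insertion]
    congr 1
    refine Multiset.map_congr rfl fun t _ => ?_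
    simp [mapVertices, innerVertex, add_assoc]
  · intro y hy
    obtain ⟨w, hw, rfl⟩ := Multiset.mem_map.1 hy
    refine cls_ihx (composite_good hn rfl hj hn₂
      (fun e he => ⟨(h₁.mem e he).1, (h₁.mem e he).2, h₁.loopless e he⟩) hE hw)
      (composite_connected hn rfl hj hn₂ h₁.connected hc hw) ?_
    exact mem_vertices_int.2 (by omega)

theorem exists_cycle (μ m₂ : ℕ) : ∃ ρ : Equiv.Perm ℕ, (∀ k ≤ μ, ρ k = k) ∧
    ρ (μ + 1) = μ + m₂ + 1 ∧ (∀ b, 1 ≤ b → b ≤ m₂ → ρ (μ + 1 + b) = μ + b) ∧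
    ∀ k, μ + m₂ + 1 < k → ρ k = k := by
  refine ⟨⟨fun k => if k ≤ μ ∨ μ + m₂ + 1 < k then k else
      if k = μ + 1 then μ + m₂ + 1 else k - 1,
    fun k => if k ≤ μ ∨ μ + m₂ + 1 < k then k else
      if k = μ + m₂ + 1 then μ + 1 else k + 1, ?_, ?_⟩, ?_, ?_, ?_, ?_⟩
  · intro k
    dsimp only
    split_ifs <;> omega
  · intro k
    dsimp only
    split_ifs <;> omega
  · intro k hk
    simp [hk]
  · simp only [Equiv.coe_fn_mk]
    split_ifs <;> omega
  · intro b h1 h2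
    simp only [Equiv.coe_fn_mk]
    split_ifs <;> omega
  · intro k hk
    simp [hk]

theorem insertion_ihx_left (hn : n₁ + n₂ = n + 1) (hj : 1 ≤ j ∧ j ≤ n₁) {E E₂ : List Edge}
    (h₂ : Admissible n₂ m₂ E₂)
    (hE : ∀ e ∈ E, e.1 ∈ vertices n₁ m₁ ∧ e.2 ∈ vertices n₁ m₁ ∧ e.1 ≠ e.2)
    (hc : ConnectedToExternal n₁ m₁ E) {v : ℕ} (hv : Vertex.int v ∈ vertices n₁ m₁) :
    ((subst (splitAt v (m₁ + 1)) E).map fun s =>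
      insertion K (m₁ + 1) n₂ m₂ n (m₁ + m₂ + 1) j
        (s ++ [(Vertex.int v, Vertex.int (m₁ + 1))]) E₂).sum = 0 := by
  have hv' := mem_vertices_int.1 hv
  have hn₂ : 1 ≤ n₂ := h₂.one_le
  obtain ⟨ρ, hρ1, hρ2, hρ3, hρ4⟩ := exists_cycle m₁ m₂
  have hin : ∀ a ∈ vertices n₂ m₂,
      relabel ρ (innerVertex j (m₁ + 1) a) = innerVertex j m₁ a := by
    rintro (i | k) hk
    · rfl
    · have := mem_vertices_int.1 hk
      simp [innerVertex, relabel, hρ3 k this.1 this.2]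
  have hsp : ∀ a ∈ vertices n₂ m₂,
      splitAt v (m₁ + m₂ + 1) (innerVertex j m₁ a) = {innerVertex j m₁ a} := by
    rintro (i | k) hk
    · simp [splitAt, innerVertex]
    · have := mem_vertices_int.1 hk
      rw [splitAt, if_neg]
      simp only [innerVertex]
      intro h; injection h with h; omega
  have hpl : ∀ a ∈ vertices n₁ m₁,
      (plug j m₁ n₂ m₂ a).bind (splitAt v (m₁ + m₂ + 1)) =
        ((splitAt v (m₁ + 1) a).bind (plug j (m₁ + 1) n₂ m₂)).map (relabel ρ) := by
    intro a ha
    cases a with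
    | ext i =>
      rw [splitAt, if_neg (by simp), Multiset.singleton_bind]
      unfold plug
      split_ifs with h
      · rw [Multiset.bind_map, Multiset.map_map, ← Multiset.bind_singleton]
        refine Multiset.bind_congr fun a ha => ?_
        rw [hsp a ha, Function.comp_apply, hin a ha]
      · rw [Multiset.singleton_bind, outerVertex]
        split_ifs <;> rfl
    | int k =>
      have hk := mem_vertices_int.1 ha
      have hplk : ∀ μ k, plug j μ n₂ m₂ (.int k) = {.int k} := by simp [plug, outerVertex]
      rw [hplk, Multiset.singleton_bind]
      unfold splitAt
      split_ifs with h
      · injection h with h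
        simp [hplk, relabel, hρ1 v hv'.2, hρ2]
      · simp [hplk, relabel, hρ1 k hk.2]
  have hE₂ : mapVertices (relabel ρ) (mapVertices (innerVertex j (m₁ + 1)) E₂) =
      mapVertices (innerVertex j m₁) E₂ := by
    rw [mapVertices_mapVertices]
    exact mapVertices_congr fun e he => ⟨hin _ (h₂.mem e he).1, hin _ (h₂.mem e he).2⟩
  have key : (subst (plug j m₁ n₂ m₂) E).bind (fun w =>
        subst (splitAt v (m₁ + m₂ + 1)) (w ++ mapVertices (innerVertex j m₁) E₂)) =
      (subst (splitAt v (m₁ + 1)) E).bind fun s =>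
        (subst (plug j (m₁ + 1) n₂ m₂) s).map fun t =>
          mapVertices (relabel ρ) t ++ mapVertices (innerVertex j m₁) E₂ := by
    have hself : subst (splitAt v (m₁ + m₂ + 1)) (mapVertices (innerVertex j m₁) E₂) =
        {mapVertices (innerVertex j m₁) E₂} := subst_self fun e he => by
      obtain ⟨f, hf, rfl⟩ := List.mem_map.1 he
      exact ⟨hsp _ (h₂.mem f hf).1, hsp _ (h₂.mem f hf).2⟩
    simp only [subst_append, hself, Multiset.map_singleton, Multiset.bind_singleton]
    have h := subst_map (fun a => (splitAt v (m₁ + 1) a).bind (plug j (m₁ + 1) n₂ m₂))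
      (relabel ρ) E
    have h₀ : subst (fun a => (plug j m₁ n₂ m₂ a).bind (splitAt v (m₁ + m₂ + 1))) E =
        subst (fun a =>
          ((splitAt v (m₁ + 1) a).bind (plug j (m₁ + 1) n₂ m₂)).map (relabel ρ)) E :=
      subst_congr fun e he => ⟨hpl _ (hE e he).1, hpl _ (hE e he).2.1⟩
    rw [← h₀, ← subst_bind, ← subst_bind] at h
    have h' := congrArg (Multiset.map fun s => s ++ mapVertices (innerVertex j m₁) E₂) h
    rw [Multiset.map_map, Multiset.map_bind, Multiset.map_bind] at h'
    exact h'.symm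
  have hsum := congrArg (fun X : Multiset (List Edge) => (X.map fun x =>
    cls K n (m₁ + m₂ + 1) (x ++ [(Vertex.int v, Vertex.int (m₁ + m₂ + 1))])).sum) key
  simp only [Multiset.map_bind, Multiset.sum_bind, Multiset.map_map] at hsum
  rw [Multiset.sum_eq_zero] at hsum
  · have hterm : ∀ s, insertion K (m₁ + 1) n₂ m₂ n (m₁ + m₂ + 1) j
        (s ++ [(Vertex.int v, Vertex.int (m₁ + 1))]) E₂ =
        (-1 : ℤ) ^ E₂.length • ((subst (plug j (m₁ + 1) n₂ m₂) s).map fun t =>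
          cls K n (m₁ + m₂ + 1) ((mapVertices (relabel ρ) t ++
            mapVertices (innerVertex j m₁) E₂) ++
              [(Vertex.int v, Vertex.int (m₁ + m₂ + 1))])).sum := by
      intro s
      have he : subst (plug j (m₁ + 1) n₂ m₂) [(Vertex.int v, Vertex.int (m₁ + 1))] =
          {[(Vertex.int v, Vertex.int (m₁ + 1))]} := by
        simp [subst, plug, outerVertex]
      rw [insertion, subst_append, he]
      simp only [Multiset.map_singleton, Multiset.bind_singleton, Multiset.map_map]
      rw [← Multiset.sum_map_zsmul]
      congr 1
      refine Multiset.map_congr rfl fun t _ => ?_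
      have h := sign_move (F := cls K n (m₁ + m₂ + 1)) (cls_order n (m₁ + m₂ + 1)) t
        (mapVertices (innerVertex j (m₁ + 1)) E₂) [] (Vertex.int v, Vertex.int (m₁ + 1))
      rw [List.append_nil] at h
      rw [Function.comp_apply, List.append_assoc, List.singleton_append, h]
      congr 1
      · simp [mapVertices]
      · rw [← cls_relabel ρ (fun k hk => ?_) (t ++ _)]
        · congr 1
          rw [← hE₂]
          simp [mapVertices, relabel, hρ1 v hv'.2, hρ2]
        · rw [mem_vertices_int] at hk
          by_cases h0 : k ≤ m₁
          · exact hρ1 k h0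
          · exact hρ4 k (by omega)
    simp only [hterm]
    rw [Multiset.sum_map_zsmul]
    simp only [Function.comp_def] at hsum
    rw [← hsum, smul_zero]
  · intro y hy
    obtain ⟨w, hw, rfl⟩ := Multiset.mem_map.1 hy
    refine cls_ihx (composite_good hn rfl hj hn₂ hE
      (fun e he => ⟨(h₂.mem e he).1, (h₂.mem e he).2, h₂.loopless e he⟩) hw)
      (composite_connected hn rfl hj hn₂ hc h₂.connected hw) ?_
    exact mem_vertices_int.2 (by omega)

end

section

variable {K : Type*} [Field K] {n₁ m₁ n₂ m₂ n m : ℕ}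

theorem sum_map_finset_sum {M ι : Type*} [AddCommGroup M] [Module K M] (X : Multiset (List Edge))
    (I : Finset ι) (c : ι → K) (f : ι → List Edge → M) :
    (X.map fun s => ∑ i ∈ I, c i • f i s).sum = ∑ i ∈ I, c i • (X.map (f i)).sum := by
  induction X using Multiset.induction with
  | empty => simp
  | cons a X ih => simp [ih, smul_add, Finset.sum_add_distrib]

theorem relations_le_ker_right [CharZero K] (hn : n₁ + n₂ = n + 1) (hm : m₁ + m₂ = m)
    (E₁ : {E : List Edge // Admissible n₁ m₁ E}) :
    relations K n₂ m₂ ≤ LinearMap.ker (Finsupp.linearCombination K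
      fun E : {E : List Edge // Admissible n₂ m₂ E} =>
        starGraph K n₁ m₁ n₂ m₂ n m E₁.1 E.1) := by
  refine relations_le_ker (starGraph K n₁ m₁ n₂ m₂ n m E₁.1) ?_ ?_ ?_ ?_
  · intro l₁ l₂ e f
    rw [starGraph, starGraph, ← Finset.sum_add_distrib]
    refine Finset.sum_eq_zero fun i _ => ?_
    simp only [List.length_append, List.length_cons]
    rw [← smul_add, insertion_order_right, smul_zero]
  · intro ρ hρ E
    refine Finset.sum_congr rfl fun i _ => ?_
    rw [insertion_relabel_right hm hρ _ E₁.2.mem]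
    simp [mapVertices]
  · rintro m' rfl E hE hc v hv
    subst hm
    have hs : ((subst (splitAt v (m' + 1)) E).map fun s =>
        starGraph K n₁ m₁ n₂ (m' + 1) n (m₁ + (m' + 1)) E₁.1
          (s ++ [(Vertex.int v, Vertex.int (m' + 1))])) =
        (subst (splitAt v (m' + 1)) E).map fun s => ∑ i ∈ Finset.Icc 1 n₁,
          ((-1 : K) ^ ((2 * (m' + 1 : ℕ) - (E.length + 1 : ℕ) : ℤ) * (1 - n₁) +
            (i + 1) * (n₂ - 1) : ℤ)) •
          insertion K m₁ n₂ (m' + 1) n (m₁ + (m' + 1)) i E₁.1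
            (s ++ [(Vertex.int v, Vertex.int (m' + 1))]) := by
      refine Multiset.map_congr rfl fun s hs => ?_
      rw [starGraph, List.length_append, length_of_mem_subst hs, List.length_singleton]
    rw [hs, sum_map_finset_sum]
    refine Finset.sum_eq_zero fun i hi => ?_
    rw [← add_assoc, insertion_ihx_right hn (Finset.mem_Icc.1 hi) E₁.2 hE hc hv, smul_zero]
  · intro E k hk h
    refine Finset.sum_eq_zero fun i _ => ?_
    rw [insertion_valence_right hm _ _ k hk h, smul_zero]

theorem relations_le_ker_left [CharZero K] (hn : n₁ + n₂ = n + 1) (hm : m₁ + m₂ = m)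
    (E₂ : {E : List Edge // Admissible n₂ m₂ E}) :
    relations K n₁ m₁ ≤ LinearMap.ker (Finsupp.linearCombination K
      fun E : {E : List Edge // Admissible n₁ m₁ E} =>
        starGraph K n₁ m₁ n₂ m₂ n m E.1 E₂.1) := by
  refine relations_le_ker (fun E => starGraph K n₁ m₁ n₂ m₂ n m E E₂.1) ?_ ?_ ?_ ?_
  · intro l₁ l₂ e f
    rw [starGraph, starGraph, ← Finset.sum_add_distrib]
    refine Finset.sum_eq_zero fun i _ => ?_
    rw [← smul_add, insertion_order_left, smul_zero]
  · intro ρ hρ E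
    refine Finset.sum_congr rfl fun i _ => ?_
    rw [insertion_relabel_left hm hρ _ E₂.2.mem]
  · rintro m' rfl E hE hc v hv
    subst hm
    simp only [starGraph]
    rw [sum_map_finset_sum]
    refine Finset.sum_eq_zero fun i hi => ?_
    rw [show m' + 1 + m₂ = m' + m₂ + 1 by omega,
      insertion_ihx_left hn (Finset.mem_Icc.1 hi) E₂.2 hE hc hv, smul_zero]
  · intro E k hk h
    refine Finset.sum_eq_zero fun i _ => ?_
    rw [insertion_valence_left hm _ _ k hk h, smul_zero]

end

end WellDefined

/-- The bilinear extension of `starGraph` to `dgraphs`, for `n₁ + n₂ = n + 1`, `m₁ + m₂ = m`. -/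
noncomputable def starComponent (K : Type*) [Field K] [CharZero K] {n₁ m₁ n₂ m₂ n m : ℕ}
    (hn : n₁ + n₂ = n + 1) (hm : m₁ + m₂ = m) :
    DGraphs K n₁ m₁ →ₗ[K] DGraphs K n₂ m₂ →ₗ[K] DGraphs K n m :=
  (relations K n₁ m₁).liftQ
    (Finsupp.linearCombination K fun E₁ : {E : List Edge // Admissible n₁ m₁ E} =>
      (relations K n₂ m₂).liftQ
        (Finsupp.linearCombination K fun E₂ : {E : List Edge // Admissible n₂ m₂ E} =>
          starGraph K n₁ m₁ n₂ m₂ n m E₁.1 E₂.1)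
        (relations_le_ker_right hn hm E₁))
    (by
      intro x hx
      rw [LinearMap.mem_ker]
      refine Submodule.linearMap_qext _ (Finsupp.lhom_ext' fun E₂ => LinearMap.ext_ring ?_)
      have h := relations_le_ker_left hn hm E₂ hx
      rw [LinearMap.mem_ker, Finsupp.linearCombination_apply, Finsupp.sum] at h
      simpa [Finsupp.linearCombination_apply, Finsupp.sum, LinearMap.sum_apply] using h)

/-! ## The graded Lie algebra -/

/-- The underlying space `∏_{n ≥ 1} ∏_m dgraphs(n)_m` of the graded Lie algebra (for `n = 0` there
are no admissible graphs), completed with respect to the number of internal vertices. -/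
abbrev GraphLie (K : Type*) [Field K] : Type _ := (n m : ℕ) → DGraphs K n m

/-- A single graph as an element of `GraphLie K`. -/
noncomputable def ofGraph (K : Type*) [Field K] (n m : ℕ) (E : List Edge) : GraphLie K :=
  fun n' m' => if n' = n ∧ m' = m then cls K n' m' E else 0

/-- The pre-Lie product `⋆`. -/
noncomputable def starProduct {K : Type*} [Field K] [CharZero K] (F G : GraphLie K) : GraphLie K :=
  fun n m => ∑ p ∈ (Finset.HasAntidiagonal.antidiagonal (n + 1)).attach,
    ∑ q ∈ (Finset.HasAntidiagonal.antidiagonal m).attach,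
    starComponent K (Finset.HasAntidiagonal.mem_antidiagonal.1 p.2)
      (Finset.HasAntidiagonal.mem_antidiagonal.1 q.2)
      (F p.1.1 q.1.1) (G p.1.2 q.1.2)

/-- The homogeneous elements of degree `d`; a graph with `n` external and `m` internal vertices has
degree `|Γ| + n - 1 = 2 m - #edges + n - 1` in `GraphLie K`. -/
def HasDegree {K : Type*} [Field K] (d : ℤ) (F : GraphLie K) : Prop :=
  ∀ n m : ℕ, F n m ∈ Submodule.span K
    {x | ∃ E : List Edge, 2 * (m : ℤ) - E.length + n - 1 = d ∧ x = cls K n m E}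

/-- Maurer–Cartan elements. -/
def IsMaurerCartan {K : Type*} [Field K] [CharZero K] (α : GraphLie K) : Prop :=
  HasDegree 1 α ∧ starProduct α α = 0

/-- `ad_ξ = [ξ, -]` for `ξ` of degree zero (the graded commutator is then the commutator). -/
noncomputable def adjoint {K : Type*} [Field K] [CharZero K] (ξ α : GraphLie K) : GraphLie K :=
  starProduct ξ α - starProduct α ξ

/-- The gauge action `e^{ad_ξ} α = ∑_k (1/k!) ad_ξ^k α`, for `ξ` whose components all have at least
two vertices: `ad_ξ` then raises the total number of vertices, and the terms with `k ≥ n + m` do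
not contribute to the component with `n + m` vertices. -/
noncomputable def gaugeAction {K : Type*} [Field K] [CharZero K] (ξ α : GraphLie K) :
    GraphLie K :=
  fun n m => ∑ k ∈ Finset.range (n + m), (k.factorial : K)⁻¹ • ((adjoint ξ)^[k] α) n m

/-- Equality of the parts with at most `N` vertices (external and internal). -/
def EqUpTo {K : Type*} [Field K] (N : ℕ) (F G : GraphLie K) : Prop :=
  ∀ n m, n + m ≤ N → F n m = G n m

section Graphs

open Vertex

variable (K : Type*) [Field K]

noncomputable def a₁ : GraphLie K :=
  ofGraph K 1 1 [(int 1, ext 1)] + ofGraph K 1 1 [(ext 1, int 1)]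

noncomputable def a₂ : GraphLie K := ofGraph K 2 0 []

noncomputable def a₃ : GraphLie K := ofGraph K 2 1 [(int 1, ext 1), (int 1, ext 2)]

noncomputable def a₄ : GraphLie K :=
  ofGraph K 2 2 [(int 2, ext 2), (int 2, int 1), (int 1, ext 1), (int 1, ext 2)] -
    ofGraph K 2 2 [(int 2, ext 1), (int 2, int 1), (int 1, ext 1), (int 1, ext 2)]

noncomputable def a₅ : GraphLie K :=
  ofGraph K 2 2 [(int 1, ext 1), (int 1, ext 2), (int 2, ext 1), (int 2, ext 2)]

noncomputable def a₆ : GraphLie K :=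
  ofGraph K 2 2 [(int 1, ext 1), (int 1, int 2), (int 2, int 1), (int 2, ext 2)]

/-- The graph denoted `b`: one trivalent internal vertex with undirected edges. -/
noncomputable def obstructionGraph : GraphLie K :=
  ofGraph K 3 1 [(ext 1, int 1), (int 1, ext 2), (int 1, ext 3)] +
    ofGraph K 3 1 [(int 1, ext 1), (ext 2, int 1), (int 1, ext 3)] +
    ofGraph K 3 1 [(int 1, ext 1), (int 1, ext 2), (ext 3, int 1)]

noncomputable def ξ₁ : GraphLie K :=
  ofGraph K 2 0 [(ext 1, ext 2)] - ofGraph K 2 0 [(ext 2, ext 1)]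

noncomputable def ξ₂ : GraphLie K :=
  ofGraph K 2 1 [(int 1, ext 1), (int 1, ext 2), (ext 1, ext 2)] -
    ofGraph K 2 1 [(int 1, ext 1), (int 1, ext 2), (ext 2, ext 1)]

noncomputable def ξ₃ : GraphLie K :=
  ofGraph K 2 1 [(ext 2, int 1), (int 1, ext 1), (int 1, ext 2)] -
    ofGraph K 2 1 [(ext 1, int 1), (int 1, ext 1), (int 1, ext 2)]

end Graphs

/-! ## The representation on `S𝔤 ⊗ ⋀𝔤*` -/

/-- The polynomial algebra `K[x_s, p^s : s ∈ σ]` with `x_s` of degree `0` and `p^s` of degree `1`.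
For `σ = Fin d` this is `A = S𝔤 ⊗ ⋀𝔤*`, for `σ = I × Fin d` it contains the tensor power `A^{⊗ I}`
with the Koszul sign rule. -/
abbrev SuperPoly (K σ : Type*) [Field K] : Type _ :=
  MvPolynomial σ K ⊗[K] ExteriorAlgebra K (σ →₀ K)

section SuperPoly

variable {K σ τ : Type*} [Field K]

/-- Substitution of variables. -/
noncomputable def superMap (g : σ → τ) : SuperPoly K σ →ₐ[K] SuperPoly K τ :=
  Algebra.TensorProduct.map (MvPolynomial.rename g)
    (ExteriorAlgebra.map (Finsupp.lmapDomain K K g))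

/-- `∂/∂x_s`. -/
noncomputable def partialX (s : σ) : SuperPoly K σ →ₗ[K] SuperPoly K σ :=
  LinearMap.rTensor _ (MvPolynomial.pderiv s).toLinearMap

/-- `∂/∂p^s`, a left derivation of degree `-1`. -/
noncomputable def partialP (s : σ) : SuperPoly K σ →ₗ[K] SuperPoly K σ :=
  LinearMap.lTensor _ (CliffordAlgebra.contractLeft (Finsupp.lapply s))

end SuperPoly

/-- `τ_{ab} = ∑_l ∂/∂p^l ⊗ ∂/∂x_l` acting on the tensor factors `a` and `b`. -/
noncomputable def edgeOperator (K : Type*) [Field K] (d : ℕ) (e : Edge) :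
    SuperPoly K (Vertex × Fin d) →ₗ[K] SuperPoly K (Vertex × Fin d) :=
  ∑ l : Fin d, partialP (e.1, l) ∘ₗ partialX (e.2, l)

section Representation

variable {K : Type*} [Field K] {L : Type*} [LieRing L] [LieAlgebra K L] {d : ℕ}

/-- Structure constants: `[x_i, x_j] = ∑_k c_{ij}^k x_k`. -/
noncomputable def structureConstant (x : Module.Basis (Fin d) K L) (i j k : Fin d) : K :=
  x.repr ⁅x i, x j⁆ k

/-- The Poisson bivector field `π = ½ ∑ c_{ij}^k x_k p^i p^j`. -/
noncomputable def bivector (x : Module.Basis (Fin d) K L) : SuperPoly K (Fin d) :=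
  ∑ i, ∑ j, ∑ k, (structureConstant x i j k / 2) • (MvPolynomial.X k ⊗ₜ[K]
    (ExteriorAlgebra.ι K (Finsupp.single i 1) * ExteriorAlgebra.ι K (Finsupp.single j 1)))

/-- `B_Γ(f_1, …, f_n) = μ ∏_{(a,b) ∈ E(Γ)} τ_{ab} (π ⊗ ⋯ ⊗ π ⊗ f_1 ⊗ ⋯ ⊗ f_n)`, the operator of the
first edge being applied first. -/
noncomputable def graphOperator (x : Module.Basis (Fin d) K L) (n m : ℕ) (E : List Edge)
    (f : Fin n → SuperPoly K (Fin d)) : SuperPoly K (Fin d) :=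
  superMap (K := K) (Prod.snd : Vertex × Fin d → Fin d) (E.foldl
    (fun t e => edgeOperator K d e t)
    (((List.range m).map fun k =>
        superMap (K := K) (fun l : Fin d => (Vertex.int (k + 1), l)) (bivector x)).prod *
      (List.ofFn fun i : Fin n =>
        superMap (K := K) (fun l : Fin d => (Vertex.ext (i + 1), l)) (f i)).prod))

/-- Linear extension of `B`. -/
noncomputable def chainOperator (x : Module.Basis (Fin d) K L) {n m : ℕ} (a : Chains K n m)
    (f : Fin n → SuperPoly K (Fin d)) : SuperPoly K (Fin d) :=
  a.sum fun E c => c • graphOperator x n m E.1 f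

/-- The differential `d_A f = ∑_l (∂π/∂p^l · ∂f/∂x_l + ∂f/∂p^l · ∂π/∂x_l)`. -/
noncomputable def differential (x : Module.Basis (Fin d) K L) (f : SuperPoly K (Fin d)) :
    SuperPoly K (Fin d) :=
  ∑ l, (partialP l (bivector x) * partialX l f + partialP l f * partialX l (bivector x))

/-- The matrix of `ad_u` for the generic element `u = ∑ u_i x_i`. -/
noncomputable def adMatrix (x : Module.Basis (Fin d) K L) :
    Matrix (Fin d) (Fin d) (MvPolynomial (Fin d) K) :=
  Matrix.of fun k j => ∑ i, MvPolynomial.C (structureConstant x i j k) * MvPolynomial.X i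

/-- The matrix of `(e^{ad_u/2} - e^{-ad_u/2}) / ad_u = ∑_r ad_u^{2r} / (4^r (2r+1)!)`, whose entries
are formal power series in `u`; since `ad_u^{2r}` is homogeneous of degree `2r`, only `r ≤ |s|`
can contribute to the coefficient of `u^s`. -/
noncomputable def sinhMatrix (x : Module.Basis (Fin d) K L) :
    Matrix (Fin d) (Fin d) (MvPowerSeries (Fin d) K) :=
  Matrix.of fun i j => fun s => ∑ r ∈ Finset.range (s.degree + 1),
    MvPolynomial.coeff s ((adMatrix x ^ (2 * r)) i j) / (4 ^ r * (2 * r + 1).factorial)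

/-- The Duflo element `J(u) = det ((e^{ad_u/2} - e^{-ad_u/2}) / ad_u)`. -/
noncomputable def dufloElement (x : Module.Basis (Fin d) K L) : MvPowerSeries (Fin d) K :=
  (sinhMatrix x).det

/-- `J^{1/2} = ∑_r binom(1/2, r) (J - 1)^r`; as `J - 1` has no constant term, only `r ≤ |s|`
can contribute to the coefficient of `u^s`. -/
noncomputable def dufloSqrt (x : Module.Basis (Fin d) K L) : MvPowerSeries (Fin d) K :=
  fun s => ∑ r ∈ Finset.range (s.degree + 1),
    (∏ t ∈ Finset.range r, ((1 / 2 : K) - t)) / r.factorial *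
      MvPowerSeries.coeff s ((dufloElement x - 1) ^ r)

/-- A formal power series in `u` as a differential operator of infinite order with constant
coefficients, `u_i` acting as `∂/∂x_i`. -/
noncomputable def diffOperator (J : MvPowerSeries (Fin d) K) :
    MvPolynomial (Fin d) K →ₗ[K] MvPolynomial (Fin d) K :=
  (MvPolynomial.basisMonomials (Fin d) K).constr K fun s =>
    ∑ t ∈ Finset.Iic s, MvPolynomial.monomial (s - t)
      (MvPowerSeries.coeff t J * ∏ i, ((s i).descFactorial (t i) : K))

/-- The symmetrization map `S𝔤 → U𝔤`, `v_1 ⋯ v_n ↦ (1/n!) ∑_σ v_{σ(1)} ⋯ v_{σ(n)}`. -/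
noncomputable def symmetrization (x : Module.Basis (Fin d) K L) :
    MvPolynomial (Fin d) K →ₗ[K] UniversalEnvelopingAlgebra K L :=
  (MvPolynomial.basisMonomials (Fin d) K).constr K fun s =>
    (s.degree.factorial : K)⁻¹ • (s.toMultiset.toList.permutations.map fun l =>
      (l.map fun i => UniversalEnvelopingAlgebra.ι K (x i)).prod).sum

/-- The Duflo map `Duf = Sym ∘ J^{1/2} : S𝔤 → U𝔤`. -/
noncomputable def dufloMap (x : Module.Basis (Fin d) K L) :
    MvPolynomial (Fin d) K →ₗ[K] UniversalEnvelopingAlgebra K L :=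
  symmetrization x ∘ₗ diffOperator (dufloSqrt x)

/-- The product `m_Duf = Duf⁻¹ ∘ m_{U𝔤} ∘ Duf^{⊗ 2}` on `S𝔤` (`Duf` is bijective, by the
Poincaré–Birkhoff–Witt theorem). -/
noncomputable def dufloProduct (x : Module.Basis (Fin d) K L) (g h : MvPolynomial (Fin d) K) :
    MvPolynomial (Fin d) K :=
  Function.invFun (dufloMap x) (dufloMap x g * dufloMap x h)

end Representation

/-- The `n`-ary operation on `A` given by (a representative of) `α` takes the value `y` at `f`.
The sum over the number of internal vertices is required to become stationary. -/
def OperationEq {K : Type*} [Field K] {L : Type*} [LieRing L] [LieAlgebra K L] {d : ℕ}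
    (x : Module.Basis (Fin d) K L) (a : (n m : ℕ) → Chains K n m) {n : ℕ}
    (f : Fin n → SuperPoly K (Fin d)) (y : SuperPoly K (Fin d)) : Prop :=
  ∀ᶠ M in Filter.atTop, ∑ m ∈ Finset.range M, chainOperator x (a n m) f = y

/-- `α` corresponds to the universal `A_∞`-structure `(d_A, m_Duf ⊗ m_⋀, 0, …)` on
`A = S𝔤 ⊗ ⋀𝔤*`, `𝔤` being an arbitrary finite dimensional Lie algebra with basis `x`. -/
def CorrespondsToDuflo.{u} {K : Type u} [Field K] (α : GraphLie K) : Prop :=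
  ∃ a : (n m : ℕ) → Chains K n m, (∀ n m, (relations K n m).mkQ (a n m) = α n m) ∧
    ∀ (L : Type u) [LieRing L] [LieAlgebra K L] (d : ℕ) (x : Module.Basis (Fin d) K L),
      (∀ f, OperationEq x a ![f] (differential x f)) ∧
      (∀ (g h : MvPolynomial (Fin d) K) (v w : ExteriorAlgebra K (Fin d →₀ K)),
        OperationEq x a ![g ⊗ₜ[K] v, h ⊗ₜ[K] w] (dufloProduct x g h ⊗ₜ[K] (v * w))) ∧
      ∀ n, 3 ≤ n → ∀ f : Fin n → SuperPoly K (Fin d), OperationEq x a f 0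

/-! ## Operadic composition -/

/-! There are two independent tasks: the gauge transformation, and the determination of the
low-order part of `α_Duf` from its action on Lie algebras.

Gauge transformation. Insertion of graphs satisfies the two operad axioms: nested insertions are
associative (`composites_nested`), and insertions at different vertices commute up to the sign for
exchanging two blocks of edges (`sum_composites_parallel`). Hence only the parallel insertions
survive in the associator of `⋆`, and this gives the graded pre-Lie identity `starAssoc_graph_swap`,
which passes from graphs to arbitrary homogeneous series by truncation (`starAssoc_swap`). It
follows that `ad_ξ` with `ξ` of degree `0` is a derivation of the symmetric bracket `β ⋆ γ + γ ⋆ β`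
in degree `1`, and so its exponential preserves Maurer–Cartan elements
(`IsMaurerCartan.gaugeAction`). Therefore `ξ` may be taken to be exactly the displayed finite sum,
and `α'` to be the transform of `α`; only the terms of `α'` with at most four vertices remain to be
found. Since `ad_ξ` raises the number of vertices, these involve just the powers `ad_ξ^k` with `k ≤
3`. After clearing denominators the required identity is a combination of four IHX relations,
verified by computation (`gauge_computation`, `expAd_low`).

Coefficients of `α_Duf`. A component of degree `1` with `n` external and `m` internal vertices is a
combination of graphs with `2m + n - 2` edges. For `n + m ≤ 4` these are listed up to order and
labelling, and some of them are eliminated by IHX relations. For each remaining graph `G` there is a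
linear form on graphs, a test, which is non-zero on `G` and zero on the other remaining graphs: the
edges of `G` are labelled by basis vectors of a suitable small Lie algebra, the arguments are the
monomials that these edges can contract, and the result is paired with a monomial. A system of dual
tests with known values determines the component (`eq_sum_of_isTest`). This proves at the same time
that the representation is faithful in these orders; compatibility of the tests with IHX is needed
only for the finitely many eliminated graphs.

The values of the tests come from the hypothesis on the action. For `n = 1` they are read off from
`d_A`, and for `n ≥ 3` they are zero. For `n = 2` the value is zero if the letters `p` of the
arguments do not match those of the output. The graphs without edges starting at external vertices
leave no such freedom; they are detected by the algebra `[x_0, x_1] = x_1`. There `J^{1/2} = 1 +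
u_0² / 48 + ⋯`, and a few Duflo products are found by reordering words in the enveloping algebra
(`coeff_dufloProduct_affine`). The injectivity of the Duflo map that this requires follows from an
explicit representation by differential operators (`dufloMap_injective`). -/

/-- A graph that satisfies all conditions of admissibility except those on valences and double
edges. -/
structure Good (n m : ℕ) (E : List Edge) : Prop where
  one_le : 1 ≤ n
  edges : ∀ e ∈ E, e.1 ∈ vertices n m ∧ e.2 ∈ vertices n m ∧ e.1 ≠ e.2
  connected : ConnectedToExternal n m E

theorem Admissible.good {n m : ℕ} {E : List Edge} (h : Admissible n m E) : Good n m E :=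
  ⟨h.one_le, fun e he => ⟨(h.mem e he).1, (h.mem e he).2, h.loopless e he⟩, h.connected⟩

/-- The terms of the operadic composition `E₁ ∘_j E₂`. -/
noncomputable def composites (j m₁ n₂ m₂ : ℕ) (E₁ E₂ : List Edge) : Multiset (List Edge) :=
  (subst (plug j m₁ n₂ m₂) E₁).map fun s => s ++ mapVertices (innerVertex j m₁) E₂

theorem insertion_eq_sum_composites (K : Type*) [Field K] (m₁ n₂ m₂ n m j : ℕ)
    (E₁ E₂ : List Edge) :
    insertion K m₁ n₂ m₂ n m j E₁ E₂ =
      ((composites j m₁ n₂ m₂ E₁ E₂).map (cls K n m)).sum := by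
  rw [insertion, composites, Multiset.map_map]
  rfl

theorem length_of_mem_composites {j m₁ n₂ m₂ : ℕ} {E₁ E₂ s : List Edge}
    (hs : s ∈ composites j m₁ n₂ m₂ E₁ E₂) : s.length = E₁.length + E₂.length := by
  obtain ⟨t, ht, rfl⟩ := Multiset.mem_map.1 hs
  simp [length_of_mem_subst ht, mapVertices]

section

variable {n₁ m₁ n₂ m₂ n₃ m₃ n m i j k : ℕ}

theorem Good.of_mem_composites {E₁ E₂ s : List Edge} (h₁ : Good n₁ m₁ E₁) (h₂ : Good n₂ m₂ E₂)
    (hn : n₁ + n₂ = n + 1) (hm : m₁ + m₂ = m) (hj : 1 ≤ j ∧ j ≤ n₁)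
    (hs : s ∈ composites j m₁ n₂ m₂ E₁ E₂) : Good n m s := by
  obtain ⟨t, ht, rfl⟩ := Multiset.mem_map.1 hs
  exact ⟨by have := h₂.one_le; omega, composite_good hn hm hj h₂.one_le h₁.edges h₂.edges ht,
    composite_connected hn hm hj h₂.one_le h₁.connected h₂.connected ht⟩

theorem nodup_plug (hj : 1 ≤ j) (a : Vertex) : (plug j m₁ n₂ m₂ a).Nodup := by
  unfold plug
  split_ifs
  · exact (nodup_vertices _ _).map (innerVertex_injective hj)
  · exact Multiset.nodup_singleton _

/-- Both sides are free of duplicates, so it suffices to compare members, and the label of a vertex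
of the composite decides whether it comes from the inserted graph or from the outer one. This turns
two successive substitutions at one vertex into a single one. -/
theorem vertices_bind_plug (hn : n₁ + n₂ = n + 1) (hn₂ : 1 ≤ n₂) (hj : 1 ≤ j ∧ j ≤ n₁) :
    (vertices n₁ m₁).bind (plug j m₁ n₂ m₂) = vertices n (m₁ + m₂) := by
  refine (Multiset.Nodup.ext ?_ (nodup_vertices _ _)).2 fun a => ?_
  · rw [Multiset.nodup_bind]
    refine ⟨fun a _ => nodup_plug hj.1 a, ?_⟩
    refine Multiset.Nodup.pairwise (fun a ha b hb hab => ?_) (nodup_vertices _ _)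
    rw [Function.onFun, Multiset.disjoint_left]
    exact fun hc => plug_disjoint hn₂ ha hb hab hc
  · rw [Multiset.mem_bind]
    constructor
    · rintro ⟨b, hb, hab⟩
      exact plug_mem hn rfl hj hn₂ hb hab
    · intro ha
      cases a with
      | ext l =>
        have hl := mem_vertices_ext.1 ha
        by_cases h1 : l < j
        · refine ⟨.ext l, mem_vertices_ext.2 (by omega), ?_⟩
          rw [plug, if_neg (by simp; omega)]
          simp [outerVertex, h1]
        · by_cases h2 : l < j + n₂
          · refine ⟨.ext j, mem_vertices_ext.2 hj, ?_⟩
            rw [plug, if_pos rfl]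
            refine Multiset.mem_map.2 ⟨.ext (l + 1 - j), mem_vertices_ext.2 (by omega), ?_⟩
            simp only [innerVertex, Vertex.ext.injEq]
            omega
          · refine ⟨.ext (l + 1 - n₂), mem_vertices_ext.2 (by omega), ?_⟩
            rw [plug, if_neg (by simp; omega), Multiset.mem_singleton, outerVertex,
              if_neg (by omega)]
            simp only [Vertex.ext.injEq]
            omega
      | int l =>
        have hl := mem_vertices_int.1 ha
        by_cases h1 : l ≤ m₁
        · refine ⟨.int l, mem_vertices_int.2 (by omega), ?_⟩
          simp [plug, outerVertex]
        · refine ⟨.ext j, mem_vertices_ext.2 hj, ?_⟩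
          rw [plug, if_pos rfl]
          refine Multiset.mem_map.2 ⟨.int (l - m₁), mem_vertices_int.2 (by omega), ?_⟩
          simp only [innerVertex, Vertex.int.injEq]
          omega

theorem innerVertex_innerVertex (hi : 1 ≤ i) (hj : 1 ≤ j) (a : Vertex) (ha : a ≠ .ext 0) :
    innerVertex i m₁ (innerVertex j m₂ a) = innerVertex (i + j - 1) (m₁ + m₂) a := by
  cases a with
  | ext l =>
    have : l ≠ 0 := fun h => ha (by rw [h])
    simp only [innerVertex, Vertex.ext.injEq]; omega
  | int l => simp only [innerVertex, Vertex.int.injEq]; omega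

theorem ne_ext_zero_of_mem {a : Vertex} (ha : a ∈ vertices n m) : a ≠ .ext 0 := by
  rintro rfl
  have := mem_vertices_ext.1 ha
  omega

/-- Reconnection inside the second graph is equivariant under the shift of labels caused by its
insertion into the first one. In the associativity of nested insertions this handles the edges of
the second graph. -/
theorem plug_innerVertex (hi : 1 ≤ i) (hj : 1 ≤ j) (hn₃ : 1 ≤ n₃) (a : Vertex)
    (ha : a ≠ .ext 0) :
    plug (i + j - 1) (m₁ + m₂) n₃ m₃ (innerVertex i m₁ a) =
      (plug j m₂ n₃ m₃ a).map (innerVertex i m₁) := by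
  unfold plug
  have h : innerVertex i m₁ a = .ext (i + j - 1) ↔ a = .ext j := by
    cases a with
    | ext l => simp only [innerVertex, Vertex.ext.injEq]; omega
    | int l => simp [innerVertex]
  rw [if_congr h rfl rfl]
  split_ifs with h1
  · rw [Multiset.map_map]
    refine Multiset.map_congr rfl fun b hb => ?_
    rw [Function.comp_apply, innerVertex_innerVertex hi hj _ (ne_ext_zero_of_mem hb)]
  · rw [Multiset.map_singleton]
    congr 1
    cases a with
    | ext l =>
      have : l ≠ 0 := fun h => ha (by rw [h])
      simp only [innerVertex, outerVertex]
      split_ifs <;> first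
        | (exfalso; omega)
        | (congr 1 <;> omega)
    | int l => simp [innerVertex, outerVertex]

theorem plug_outerVertex_nested (hi : 1 ≤ i) (hj : 1 ≤ j ∧ j ≤ n₂)
    (hn : n₂ + n₃ = n + 1) {a : Vertex} (ha : a ≠ .ext i) :
    plug (i + j - 1) (m₁ + m₂) n₃ m₃ (outerVertex i n₂ a) = {outerVertex i n a} := by
  cases a with
  | ext l =>
    have : l ≠ i := fun h => ha (by rw [h])
    by_cases h : l < i
    · rw [outerVertex, if_pos h, plug, if_neg (by simp; omega), outerVertex, outerVertex,
        if_pos h, if_pos (by omega)]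
    · rw [outerVertex, if_neg h, plug, if_neg (by simp; omega), outerVertex, outerVertex,
        if_neg h, if_neg (by omega)]
      congr 2
      omega
  | int l => simp [outerVertex, plug]

/-- Sequential composition is associative. -/
theorem composites_nested {E₁ E₂ E₃ : List Edge} (h₂ : Good n₂ m₂ E₂)
    (h₃ : Good n₃ m₃ E₃) (hi : 1 ≤ i) (hj : 1 ≤ j ∧ j ≤ n₂) (hn : n₂ + n₃ = n + 1) :
    ((composites i m₁ n₂ m₂ E₁ E₂).bind fun s =>
        composites (i + j - 1) (m₁ + m₂) n₃ m₃ s E₃) =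
      (composites j m₂ n₃ m₃ E₂ E₃).bind fun t => composites i m₁ n (m₂ + m₃) E₁ t := by
  -- The three groups of edges are compared separately: those of `E₃` are only relabelled, those of
  -- `E₂` are substituted once, those of `E₁` twice.
  have hE₃ : mapVertices (innerVertex i m₁) (mapVertices (innerVertex j m₂) E₃) =
      mapVertices (innerVertex (i + j - 1) (m₁ + m₂)) E₃ := by
    rw [mapVertices_mapVertices]
    exact mapVertices_congr fun e he =>
      ⟨innerVertex_innerVertex hi hj.1 _ (ne_ext_zero_of_mem (h₃.edges e he).1),
        innerVertex_innerVertex hi hj.1 _ (ne_ext_zero_of_mem (h₃.edges e he).2.1)⟩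
  have hE₂ : subst (plug (i + j - 1) (m₁ + m₂) n₃ m₃) (mapVertices (innerVertex i m₁) E₂) =
      (subst (plug j m₂ n₃ m₃) E₂).map (mapVertices (innerVertex i m₁)) := by
    rw [subst_mapVertices, subst_map]
    exact subst_congr fun e he =>
      ⟨plug_innerVertex hi hj.1 h₃.one_le _ (ne_ext_zero_of_mem (h₂.edges e he).1),
        plug_innerVertex hi hj.1 h₃.one_le _ (ne_ext_zero_of_mem (h₂.edges e he).2.1)⟩
  have hpl : ∀ a, (plug i m₁ n₂ m₂ a).bind (plug (i + j - 1) (m₁ + m₂) n₃ m₃) =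
      plug i m₁ n (m₂ + m₃) a := by
    intro a
    rw [plug, plug]
    split_ifs with h
    · rw [Multiset.bind_map, ← vertices_bind_plug hn h₃.one_le hj, Multiset.map_bind]
      exact Multiset.bind_congr fun b hb =>
        plug_innerVertex hi hj.1 h₃.one_le _ (ne_ext_zero_of_mem hb)
    · rw [Multiset.singleton_bind, plug_outerVertex_nested hi hj hn h]
  have hE₁ : (subst (plug i m₁ n₂ m₂) E₁).bind (subst (plug (i + j - 1) (m₁ + m₂) n₃ m₃)) =
      subst (plug i m₁ n (m₂ + m₃)) E₁ := by
    rw [subst_bind]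
    exact subst_congr fun e _ => ⟨hpl _, hpl _⟩
  simp only [composites, Multiset.bind_map, subst_append, hE₂, Multiset.map_bind,
    Multiset.map_map, Function.comp_def]
  rw [← hE₁]
  simp only [Multiset.map_bind]
  rw [Multiset.bind_bind (subst (plug j m₂ n₃ m₃) E₂)]
  refine Multiset.bind_congr fun s _ => ?_
  rw [Multiset.bind_map_comm]
  refine Multiset.bind_congr fun t _ => ?_
  refine Multiset.map_congr rfl fun u _ => ?_
  simp only [mapVertices, List.map_append, List.append_assoc] at hE₃ ⊢
  rw [hE₃]

/-- The two orders of parallel insertion number the internal vertices in blocks of sizes `m₁, m₂,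
m₃` and `m₁, m₃, m₂`; this permutation translates between the numberings and is absorbed by the
unlabelling relation. -/
theorem exists_blockSwap (m₁ m₂ m₃ : ℕ) : ∃ ρ : Equiv.Perm ℕ, (∀ k ≤ m₁, ρ k = k) ∧
    (∀ b, 1 ≤ b → b ≤ m₃ → ρ (m₁ + b) = m₁ + m₂ + b) ∧
    (∀ b, 1 ≤ b → b ≤ m₂ → ρ (m₁ + m₃ + b) = m₁ + b) ∧
    ∀ k, m₁ + m₂ + m₃ < k → ρ k = k := by
  refine ⟨⟨fun k => if k ≤ m₁ ∨ m₁ + m₂ + m₃ < k then k else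
      if k ≤ m₁ + m₃ then k + m₂ else k - m₃,
    fun k => if k ≤ m₁ ∨ m₁ + m₂ + m₃ < k then k else
      if k ≤ m₁ + m₂ then k + m₃ else k - m₂, ?_, ?_⟩, ?_, ?_, ?_, ?_⟩
  · intro k
    dsimp only
    split_ifs <;> omega
  · intro k
    dsimp only
    split_ifs <;> omega
  · intro k hk
    simp [hk]
  · intro b h1 h2
    simp only [Equiv.coe_fn_mk]
    split_ifs <;> omega
  · intro b h1 h2
    simp only [Equiv.coe_fn_mk]
    split_ifs <;> omega
  · intro k hk
    simp [hk]

/-- Every edge of one block passes every edge of the other exactly once. -/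
theorem sign_swap {M : Type*} [AddCommGroup M] {F : List Edge → M}
    (hF : ∀ l₁ l₂ e f, F (l₁ ++ e :: f :: l₂) + F (l₁ ++ f :: e :: l₂) = 0)
    (l A B : List Edge) :
    F (l ++ (A ++ B)) = (-1 : ℤ) ^ (A.length * B.length) • F (l ++ (B ++ A)) := by
  induction A generalizing l with
  | nil => simp
  | cons e A ih =>
    have h1 := ih (l ++ [e])
    have h2 := sign_move hF l B A e
    simp only [List.append_assoc, List.cons_append, List.nil_append] at h1 h2 ⊢
    rw [h1, h2, smul_smul, ← pow_add]
    congr 2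
    simp only [List.length_cons]
    ring

/-- Compositions at different vertices commute. -/
theorem sum_composites_parallel (K : Type*) [Field K] {E₁ E₂ E₃ : List Edge}
    (h₁ : Good n₁ m₁ E₁) (h₂ : Good n₂ m₂ E₂) (h₃ : Good n₃ m₃ E₃) (hi : 1 ≤ i) (hik : i < k)
    (hm : m₁ + m₂ + m₃ = m) :
    (((composites i m₁ n₂ m₂ E₁ E₂).bind fun s =>
        composites (k + n₂ - 1) (m₁ + m₂) n₃ m₃ s E₃).map (cls K n m)).sum =
      (-1 : ℤ) ^ (E₂.length * E₃.length) •
        (((composites k m₁ n₃ m₃ E₁ E₃).bind fun t =>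
          composites i (m₁ + m₃) n₂ m₂ t E₂).map (cls K n m)).sum := by
  obtain ⟨ρ, hρ1, hρ2, hρ3, hρ4⟩ := exists_blockSwap m₁ m₂ m₃
  have hn₂ := h₂.one_le
  have hn₃ := h₃.one_le
  have hpl₂ : ∀ a ∈ vertices n₂ m₂,
      plug (k + n₂ - 1) (m₁ + m₂) n₃ m₃ (innerVertex i m₁ a) = {innerVertex i m₁ a} := by
    intro a ha
    cases a with
    | ext l =>
      have := mem_vertices_ext.1 ha
      rw [innerVertex, plug, if_neg (by simp; omega), outerVertex, if_pos (by omega)]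
    | int l => simp [innerVertex, plug, outerVertex]
  have hpl₃ : ∀ a ∈ vertices n₃ m₃,
      (plug i (m₁ + m₃) n₂ m₂ (innerVertex k m₁ a)).map (relabel ρ) =
        {innerVertex (k + n₂ - 1) (m₁ + m₂) a} := by
    intro a ha
    cases a with
    | ext l =>
      have := mem_vertices_ext.1 ha
      rw [innerVertex, plug, if_neg (by simp; omega), outerVertex, if_neg (by omega)]
      simp only [Multiset.map_singleton, relabel, innerVertex]
      congr 2
      omega
    | int l =>
      have := mem_vertices_int.1 ha
      simp [innerVertex, plug, outerVertex, relabel, hρ2 l this.1 this.2]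
  have hin₂ : ∀ a ∈ vertices n₂ m₂,
      relabel ρ (innerVertex i (m₁ + m₃) a) = innerVertex i m₁ a := by
    rintro (l | l) ha
    · rfl
    · have := mem_vertices_int.1 ha
      simp [innerVertex, relabel, hρ3 l this.1 this.2]
  -- The cases are the two insertion points, the other external labels (below `i`, between `i` and
  -- `k`, above `k`) and the internal vertices, which the block exchange fixes.
  have hpl₁ : ∀ a ∈ vertices n₁ m₁,
      ((plug k m₁ n₃ m₃ a).bind (plug i (m₁ + m₃) n₂ m₂)).map (relabel ρ) =
        (plug i m₁ n₂ m₂ a).bind (plug (k + n₂ - 1) (m₁ + m₂) n₃ m₃) := by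
    intro a ha
    cases a with
    | ext l =>
      have hl := mem_vertices_ext.1 ha
      by_cases hlk : l = k
      · subst hlk
        rw [plug, if_pos rfl, Multiset.bind_map, Multiset.map_bind, Multiset.bind_congr hpl₃,
          Multiset.bind_singleton, plug, if_neg (by simp; omega), Multiset.singleton_bind,
          outerVertex, if_neg (by omega), plug, if_pos rfl]
      · rw [plug, if_neg (by simpa using hlk), Multiset.singleton_bind]
        by_cases hli : l = i
        · subst hli
          rw [outerVertex, if_pos hik, plug, if_pos rfl, plug, if_pos rfl, Multiset.bind_map,
            Multiset.bind_congr hpl₂, Multiset.bind_singleton, Multiset.map_map]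
          exact Multiset.map_congr rfl hin₂
        · rw [plug.eq_def i m₁, if_neg (by simpa using hli), Multiset.singleton_bind]
          simp only [outerVertex, plug]
          by_cases h1 : l < i
          · simp [h1, show l < k by omega, show l < k + n₂ - 1 by omega,
              show l ≠ k + n₂ - 1 by omega, hli, relabel]
          · by_cases h2 : l < k
            · simp [h1, h2, show l + n₂ - 1 < k + n₂ - 1 by omega,
                show l + n₂ - 1 ≠ k + n₂ - 1 by omega, hli, relabel]
            · simp [h1, h2, show ¬ l + n₂ - 1 < k + n₂ - 1 by omega,
                show l + n₂ - 1 ≠ k + n₂ - 1 by omega, show l + n₃ - 1 ≠ i by omega,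
                show ¬ l + n₃ - 1 < i by omega, relabel]
              omega
    | int l =>
      have hl := mem_vertices_int.1 ha
      simp [plug, outerVertex, relabel, hρ1 l hl.2]
  have hleft : ((composites i m₁ n₂ m₂ E₁ E₂).bind fun s =>
        composites (k + n₂ - 1) (m₁ + m₂) n₃ m₃ s E₃) =
      (subst (fun a => (plug i m₁ n₂ m₂ a).bind (plug (k + n₂ - 1) (m₁ + m₂) n₃ m₃)) E₁).map
        fun u => u ++ (mapVertices (innerVertex i m₁) E₂ ++
          mapVertices (innerVertex (k + n₂ - 1) (m₁ + m₂)) E₃) := by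
    have hself : subst (plug (k + n₂ - 1) (m₁ + m₂) n₃ m₃) (mapVertices (innerVertex i m₁) E₂) =
        {mapVertices (innerVertex i m₁) E₂} := subst_self fun e he => by
      obtain ⟨f, hf, rfl⟩ := List.mem_map.1 he
      exact ⟨hpl₂ _ (h₂.edges f hf).1, hpl₂ _ (h₂.edges f hf).2.1⟩
    rw [← subst_bind]
    simp only [composites, Multiset.bind_map, subst_append, hself, Multiset.map_bind,
      Multiset.map_singleton, Multiset.bind_singleton, Multiset.map_map, Function.comp_def,
      List.append_assoc]
  have hright : (((composites k m₁ n₃ m₃ E₁ E₃).bind fun t =>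
        composites i (m₁ + m₃) n₂ m₂ t E₂).map (mapVertices (relabel ρ))) =
      (subst (fun a => (plug i m₁ n₂ m₂ a).bind (plug (k + n₂ - 1) (m₁ + m₂) n₃ m₃)) E₁).map
        fun u => u ++ (mapVertices (innerVertex (k + n₂ - 1) (m₁ + m₂)) E₃ ++
          mapVertices (innerVertex i m₁) E₂) := by
    have hthird : (subst (plug i (m₁ + m₃) n₂ m₂) (mapVertices (innerVertex k m₁) E₃)).map
        (mapVertices (relabel ρ)) = {mapVertices (innerVertex (k + n₂ - 1) (m₁ + m₂)) E₃} := by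
      rw [subst_map, subst_mapVertices, ← subst_pure]
      exact subst_congr fun e he => ⟨hpl₃ _ (h₃.edges e he).1, hpl₃ _ (h₃.edges e he).2.1⟩
    have hsecond : mapVertices (relabel ρ) (mapVertices (innerVertex i (m₁ + m₃)) E₂) =
        mapVertices (innerVertex i m₁) E₂ := by
      rw [mapVertices_mapVertices]
      exact mapVertices_congr fun e he => ⟨hin₂ _ (h₂.edges e he).1, hin₂ _ (h₂.edges e he).2.1⟩
    have hfirst : ((subst (plug k m₁ n₃ m₃) E₁).bind
        (subst (plug i (m₁ + m₃) n₂ m₂))).map (mapVertices (relabel ρ)) =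
        subst (fun a => (plug i m₁ n₂ m₂ a).bind (plug (k + n₂ - 1) (m₁ + m₂) n₃ m₃)) E₁ := by
      rw [subst_bind, subst_map]
      exact subst_congr fun e he => ⟨hpl₁ _ (h₁.edges e he).1, hpl₁ _ (h₁.edges e he).2.1⟩
    have hmap : ∀ s t, mapVertices (relabel ρ) (s ++ t) =
        mapVertices (relabel ρ) s ++ mapVertices (relabel ρ) t := by simp [mapVertices]
    rw [← hfirst]
    simp only [composites, Multiset.bind_map, subst_append, Multiset.map_bind,
      Multiset.map_map, Function.comp_def, hmap, hsecond, List.append_assoc]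
    refine Multiset.bind_congr fun s _ => ?_
    conv_rhs => rw [← Multiset.bind_singleton]
    refine Multiset.bind_congr fun t _ => ?_
    have h := congrArg (Multiset.map fun w => mapVertices (relabel ρ) t ++
      (w ++ mapVertices (innerVertex i m₁) E₂)) hthird
    simpa only [Multiset.map_map, Multiset.map_singleton, Function.comp_def] using h
  have hrel : ∀ X : Multiset (List Edge), (X.map (cls K n m)).sum =
      ((X.map (mapVertices (relabel ρ))).map (cls K n m)).sum := by
    intro X
    rw [Multiset.map_map]
    congr 1
    refine Multiset.map_congr rfl fun s _ => (cls_relabel ρ (fun k hk => ?_) s).symm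
    rw [mem_vertices_int] at hk
    by_cases h0 : k ≤ m₁
    · exact hρ1 k h0
    · exact hρ4 k (by omega)
  -- After renumbering, the two sums run over the same words, except that the blocks of edges of
  -- `E₂` and `E₃` are interchanged.
  rw [hleft, hrel (Multiset.bind _ _), hright, Multiset.map_map, Multiset.map_map,
    ← Multiset.sum_map_zsmul]
  congr 1
  refine Multiset.map_congr rfl fun s _ => ?_
  rw [Function.comp_apply, Function.comp_apply, sign_swap (cls_order n m)]
  simp [mapVertices]

end

/-! ## The graded pre-Lie identity -/

section

variable {K : Type*} [Field K] {n₁ m₁ n₂ m₂ n₃ m₃ n m i j k : ℕ}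

/-- These defects are exactly those that force a composition to vanish: a repeated edge does so by
antisymmetry, an excessive valence because an internal vertex keeps its edges under insertion. -/
theorem Good.not_admissible_cases {E : List Edge} (h : Good n m E) (hE : ¬ Admissible n m E) :
    ¬ E.Nodup ∨ ∃ k, Vertex.int k ∈ vertices n m ∧
      (1 < E.countP (fun e => decide (e.2 = Vertex.int k)) ∨
        2 < E.countP (fun e => decide (e.1 = Vertex.int k))) := by
  by_contra! hc
  exact hE ⟨h.one_le, fun e he => ⟨(h.edges e he).1, (h.edges e he).2.1⟩, hc.1,
    fun e he => (h.edges e he).2.2, fun k hk => (hc.2 k hk).1, fun k hk => (hc.2 k hk).2,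
    h.connected⟩

theorem starGraph_eq_zero_left [CharZero K] (hm : m₁ + m₂ = m) {E₁ E₂ : List Edge}
    (h₁ : Good n₁ m₁ E₁)
    (hE : ¬ Admissible n₁ m₁ E₁) : starGraph K n₁ m₁ n₂ m₂ n m E₁ E₂ = 0 := by
  refine Finset.sum_eq_zero fun i _ => ?_
  rcases h₁.not_admissible_cases hE with h | ⟨k, hk, h⟩
  · rw [eq_zero_of_not_nodup K (F := fun E => insertion K m₁ n₂ m₂ n m i E E₂)
      (fun l₁ l₂ e f => insertion_order_left E₂ l₁ l₂ e f) h, smul_zero]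
  · rw [insertion_valence_left hm _ _ k hk h, smul_zero]

theorem starGraph_eq_zero_right [CharZero K] (hm : m₁ + m₂ = m) {E₁ E₂ : List Edge}
    (h₂ : Good n₂ m₂ E₂)
    (hE : ¬ Admissible n₂ m₂ E₂) : starGraph K n₁ m₁ n₂ m₂ n m E₁ E₂ = 0 := by
  refine Finset.sum_eq_zero fun i _ => ?_
  rcases h₂.not_admissible_cases hE with h | ⟨k, hk, h⟩
  · rw [eq_zero_of_not_nodup K (F := fun E => insertion K m₁ n₂ m₂ n m i E₁ E)
      (fun l₁ l₂ e f => insertion_order_right E₁ l₁ l₂ e f) h, smul_zero]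
  · rw [insertion_valence_right hm _ _ k hk h, smul_zero]

/-- The class of a graph that is not admissible is zero, so on such graphs one has to know that the
explicit formula vanishes too. This allows the terms of a composition to be composed again although
they may violate the valence conditions or have double edges. -/
theorem starComponent_cls [CharZero K] (hn : n₁ + n₂ = n + 1) (hm : m₁ + m₂ = m) {E₁ E₂ : List Edge}
    (h₁ : Good n₁ m₁ E₁) (h₂ : Good n₂ m₂ E₂) :
    starComponent K hn hm (cls K n₁ m₁ E₁) (cls K n₂ m₂ E₂) =
      starGraph K n₁ m₁ n₂ m₂ n m E₁ E₂ := by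
  by_cases a₁ : Admissible n₁ m₁ E₁
  · by_cases a₂ : Admissible n₂ m₂ E₂
    · simp [cls, toChain, a₁, a₂, starComponent, Finsupp.linearCombination_single]
    · rw [cls_of_not_admissible a₂, map_zero, starGraph_eq_zero_right hm h₂ a₂]
  · rw [cls_of_not_admissible a₁, map_zero, LinearMap.zero_apply,
      starGraph_eq_zero_left hm h₁ a₁]

/-- The sign in `starGraph`. -/
def starSign (K : Type*) [Field K] (n₁ n₂ m₂ l₂ i : ℕ) : K :=
  (-1 : K) ^ ((2 * m₂ - l₂ : ℤ) * (1 - n₁) + (i + 1) * (n₂ - 1) : ℤ)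

/-- The external vertices of `E₁ ∘_i E₂` are those of `E₂`, with shifted labels, and those of `E₁`
other than `i`. The first sum will give nested insertions, the second one parallel insertions. -/
theorem sum_Icc_split {M : Type*} [AddCommMonoid M] (hi : i ∈ Finset.Icc 1 n₁) (hn₂ : 1 ≤ n₂)
    (g : ℕ → M) :
    ∑ j ∈ Finset.Icc 1 (n₁ + n₂ - 1), g j = ∑ j ∈ Finset.Icc 1 n₂, g (i + j - 1) +
      ∑ k ∈ (Finset.Icc 1 n₁).erase i, g (if k < i then k else k + n₂ - 1) := by
  rw [Finset.mem_Icc] at hi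
  have h1 : ∑ j ∈ Finset.Icc 1 n₂, g (i + j - 1) =
      ∑ j ∈ (Finset.Icc 1 n₂).image (fun j => i + j - 1), g j :=
    (Finset.sum_image fun a ha b hb h => by
      simp only [Finset.coe_Icc, Set.mem_Icc] at ha hb h; omega).symm
  have h2 : ∑ k ∈ (Finset.Icc 1 n₁).erase i, g (if k < i then k else k + n₂ - 1) =
      ∑ j ∈ ((Finset.Icc 1 n₁).erase i).image (fun k => if k < i then k else k + n₂ - 1), g j :=
    (Finset.sum_image fun a ha b hb h => by
      simp only [Finset.coe_erase, Finset.coe_Icc, Set.mem_sdiff, Set.mem_Icc,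
        Set.mem_singleton_iff] at ha hb h
      split_ifs at h <;> omega).symm
  rw [h1, h2, ← Finset.sum_union]
  · congr 1
    ext x
    simp only [Finset.mem_Icc, Finset.mem_union, Finset.mem_image, Finset.mem_erase]
    constructor
    · intro hx
      by_cases h3 : x < i
      · exact .inr ⟨x, by omega, by simp [h3]⟩
      · by_cases h4 : x < i + n₂
        · exact .inl ⟨x + 1 - i, by omega, by omega⟩
        · exact .inr ⟨x + 1 - n₂, by omega, by rw [if_neg (by omega)]; omega⟩
    · rintro (⟨a, ha, rfl⟩ | ⟨a, ha, rfl⟩)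
      · omega
      · split_ifs <;> omega
  · rw [Finset.disjoint_left]
    intro x hx hx'
    simp only [Finset.mem_Icc, Finset.mem_image, Finset.mem_erase] at hx hx'
    obtain ⟨a, ha, rfl⟩ := hx
    obtain ⟨b, hb, hab⟩ := hx'
    split_ifs at hab <;> omega

theorem sum_map_smul_finset_sum {M : Type*} [AddCommGroup M] [Module K M]
    (X : Multiset (List Edge)) (I : Finset ℕ) (c : ℕ → K) (f : ℕ → List Edge → Multiset (List Edge))
    (g : List Edge → M) :
    (X.map fun s => ∑ i ∈ I, c i • ((f i s).map g).sum).sum =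
      ∑ i ∈ I, c i • ((X.bind (f i)).map g).sum := by
  induction X using Multiset.induction with
  | empty => simp
  | cons a X ih => simp [ih, smul_add, Finset.sum_add_distrib]

variable (K) in
/-- The space `GraphLie K` with its structure of a vector space. -/
def GraphSpace : Type _ := GraphLie K

noncomputable instance : AddCommGroup (GraphSpace K) := inferInstanceAs (AddCommGroup (GraphLie K))

noncomputable instance : Module K (GraphSpace K) := inferInstanceAs (Module K (GraphLie K))

variable (K) in
/-- The projection to a component. -/
noncomputable def component (n m : ℕ) : GraphSpace K →ₗ[K] DGraphs K n m where
  toFun F := F n m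
  map_add' _ _ := rfl
  map_smul' _ _ := rfl

theorem GraphSpace.ext {F G : GraphSpace K} (h : ∀ n m, component K n m F = component K n m G) :
    F = G :=
  funext fun n => funext fun m => h n m

variable (K) in
/-- A graph as an element of `GraphSpace K`. -/
noncomputable def graph (n m : ℕ) (E : List Edge) : GraphSpace K := ofGraph K n m E

theorem component_graph (n m n' m' : ℕ) (E : List Edge) :
    component K n' m' (graph K n m E) = if n' = n ∧ m' = m then cls K n' m' E else 0 := rfl

theorem component_sum_graph (X : Multiset (List Edge)) (n' m' : ℕ) :
    component K n' m' (X.map (graph K n m)).sum =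
      if n' = n ∧ m' = m then (X.map (cls K n' m')).sum else 0 := by
  rw [map_multiset_sum, Multiset.map_map]
  simp only [Function.comp_def, component_graph]
  split_ifs <;> simp

theorem sum_graph_eq (X Y : Multiset (List Edge)) (c : ℤ)
    (h : ∀ n' m', n' = n → m' = m → (X.map (cls K n' m')).sum = c • (Y.map (cls K n' m')).sum) :
    (X.map (graph K n m)).sum = c • (Y.map (graph K n m)).sum := by
  refine GraphSpace.ext fun n' m' => ?_
  rw [map_zsmul, component_sum_graph, component_sum_graph]
  split_ifs with hh
  · exact h n' m' hh.1 hh.2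
  · simp

section

variable [CharZero K]

/-- The product `⋆` on `GraphSpace K`. -/
noncomputable def starFun (F G : GraphSpace K) : GraphSpace K := starProduct (K := K) F G

theorem component_starFun (F G : GraphSpace K) (n m : ℕ) :
    component K n m (starFun F G) =
    ∑ p ∈ (Finset.HasAntidiagonal.antidiagonal (n + 1)).attach,
      ∑ q ∈ (Finset.HasAntidiagonal.antidiagonal m).attach,
      starComponent K (Finset.HasAntidiagonal.mem_antidiagonal.1 p.2)
        (Finset.HasAntidiagonal.mem_antidiagonal.1 q.2)
        (component K p.1.1 q.1.1 F) (component K p.1.2 q.1.2 G) := rfl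

variable (K) in
/-- The product `⋆` as a bilinear map. -/
noncomputable def star : GraphSpace K →ₗ[K] GraphSpace K →ₗ[K] GraphSpace K :=
  LinearMap.mk₂ K starFun
    (fun F F' G => GraphSpace.ext fun n m => by
      simp only [map_add, component_starFun, LinearMap.add_apply, Finset.sum_add_distrib])
    (fun c F G => GraphSpace.ext fun n m => by
      simp only [map_smul, component_starFun, LinearMap.smul_apply, Finset.smul_sum])
    (fun F G G' => GraphSpace.ext fun n m => by
      simp only [map_add, component_starFun, Finset.sum_add_distrib])
    (fun c F G => GraphSpace.ext fun n m => by
      simp only [map_smul, component_starFun, Finset.smul_sum])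

theorem component_star (F G : GraphSpace K) (n m : ℕ) : component K n m (star K F G) =
    ∑ p ∈ (Finset.HasAntidiagonal.antidiagonal (n + 1)).attach,
      ∑ q ∈ (Finset.HasAntidiagonal.antidiagonal m).attach,
      starComponent K (Finset.HasAntidiagonal.mem_antidiagonal.1 p.2)
        (Finset.HasAntidiagonal.mem_antidiagonal.1 q.2)
        (component K p.1.1 q.1.1 F) (component K p.1.2 q.1.2 G) := rfl

/-- Each factor lives in a single component, so only one pair in each antidiagonal contributes. -/
theorem Good.star_graph {E₁ E₂ : List Edge} (h₁ : Good n₁ m₁ E₁) (h₂ : Good n₂ m₂ E₂) :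
    star K (graph K n₁ m₁ E₁) (graph K n₂ m₂ E₂) =
      ∑ i ∈ Finset.Icc 1 n₁, starSign K n₁ n₂ m₂ E₂.length i •
        ((composites i m₁ n₂ m₂ E₁ E₂).map (graph K (n₁ + n₂ - 1) (m₁ + m₂))).sum := by
  refine GraphSpace.ext fun n m => ?_
  have hn₁ := h₁.one_le
  have hn₂ := h₂.one_le
  rw [map_sum, component_star]
  simp only [map_smul, component_sum_graph]
  by_cases hnm : n₁ + n₂ = n + 1 ∧ m₁ + m₂ = m
  · obtain ⟨hn, rfl⟩ := hnm
    rw [Finset.sum_eq_single ⟨(n₁, n₂), Finset.HasAntidiagonal.mem_antidiagonal.2 hn⟩,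
      Finset.sum_eq_single ⟨(m₁, m₂), Finset.HasAntidiagonal.mem_antidiagonal.2 rfl⟩]
    · simp only [component_graph, and_self, if_true]
      rw [starComponent_cls hn rfl h₁ h₂, starGraph]
      refine Finset.sum_congr rfl fun i _ => ?_
      rw [insertion_eq_sum_composites, starSign]
      simp [show n = n₁ + n₂ - 1 by omega]
    · rintro ⟨⟨a, b⟩, hab⟩ - hne
      have hab' := Finset.HasAntidiagonal.mem_antidiagonal.1 hab
      simp only at hab'
      have : a ≠ m₁ := by rintro rfl; exact hne (by simp; omega)
      simp [component_graph, this]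
    · simp
    · rintro ⟨⟨a, b⟩, hab⟩ - hne
      have hab' := Finset.HasAntidiagonal.mem_antidiagonal.1 hab
      simp only at hab'
      have : a ≠ n₁ := by rintro rfl; exact hne (by simp; omega)
      simp [component_graph, this]
    · simp
  · rw [Finset.sum_eq_zero, Finset.sum_eq_zero]
    · intro i _
      have : ¬ (n = n₁ + n₂ - 1 ∧ m = m₁ + m₂) := by omega
      simp [this]
    · rintro ⟨⟨a, b⟩, hab⟩ -
      refine Finset.sum_eq_zero ?_
      rintro ⟨⟨c, d⟩, hcd⟩ -
      have hab' := Finset.HasAntidiagonal.mem_antidiagonal.1 hab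
      have hcd' := Finset.HasAntidiagonal.mem_antidiagonal.1 hcd
      simp only at hab' hcd'
      simp only [component_graph]
      split_ifs with g1 g2
      · exfalso; omega
      all_goals simp

/-- The associator of `⋆`. -/
noncomputable def starAssoc (F G H : GraphSpace K) : GraphSpace K :=
  star K (star K F G) H - star K F (star K G H)

/-- The sum of the terms of `(E₁ ∘_i E₂) ∘_k E₃`, `i ≠ k` denoting vertices of `E₁`. -/
noncomputable def parallelSum (K : Type*) [Field K] (n₁ m₁ n₂ m₂ n₃ m₃ : ℕ)
    (E₁ E₂ E₃ : List Edge) (i k : ℕ) : GraphSpace K :=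
  (((composites i m₁ n₂ m₂ E₁ E₂).bind fun s =>
    composites (if k < i then k else k + n₂ - 1) (m₁ + m₂) n₃ m₃ s E₃).map
      (graph K (n₁ + n₂ + n₃ - 2) (m₁ + m₂ + m₃))).sum

theorem star_star_left {E₁ E₂ E₃ : List Edge} (h₁ : Good n₁ m₁ E₁)
    (h₂ : Good n₂ m₂ E₂) (h₃ : Good n₃ m₃ E₃) :
    star K (star K (graph K n₁ m₁ E₁) (graph K n₂ m₂ E₂)) (graph K n₃ m₃ E₃) =
      ∑ i ∈ Finset.Icc 1 n₁, starSign K n₁ n₂ m₂ E₂.length i •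
        ∑ j ∈ Finset.Icc 1 (n₁ + n₂ - 1), starSign K (n₁ + n₂ - 1) n₃ m₃ E₃.length j •
          (((composites i m₁ n₂ m₂ E₁ E₂).bind fun s =>
            composites j (m₁ + m₂) n₃ m₃ s E₃).map
              (graph K (n₁ + n₂ + n₃ - 2) (m₁ + m₂ + m₃))).sum := by
  rw [h₁.star_graph h₂, map_sum, LinearMap.sum_apply]
  refine Finset.sum_congr rfl fun i hi => ?_
  rw [map_smul, LinearMap.smul_apply]
  congr 1
  rw [← sum_map_smul_finset_sum, ← LinearMap.flip_apply, map_multiset_sum, Multiset.map_map]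
  congr 1
  refine Multiset.map_congr rfl fun s hs => ?_
  have hn₁ := h₁.one_le
  have hg := h₁.of_mem_composites h₂ (show n₁ + n₂ = n₁ + n₂ - 1 + 1 by omega) rfl
    (Finset.mem_Icc.1 hi) hs
  rw [Function.comp_apply, LinearMap.flip_apply, hg.star_graph h₃,
    show n₁ + n₂ - 1 + n₃ - 1 = n₁ + n₂ + n₃ - 2 by omega]

theorem star_star_right {E₁ E₂ E₃ : List Edge} (h₁ : Good n₁ m₁ E₁)
    (h₂ : Good n₂ m₂ E₂) (h₃ : Good n₃ m₃ E₃) :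
    star K (graph K n₁ m₁ E₁) (star K (graph K n₂ m₂ E₂) (graph K n₃ m₃ E₃)) =
      ∑ j ∈ Finset.Icc 1 n₂, starSign K n₂ n₃ m₃ E₃.length j •
        ∑ i ∈ Finset.Icc 1 n₁,
          starSign K n₁ (n₂ + n₃ - 1) (m₂ + m₃) (E₂.length + E₃.length) i •
          (((composites j m₂ n₃ m₃ E₂ E₃).bind fun t =>
            composites i m₁ (n₂ + n₃ - 1) (m₂ + m₃) E₁ t).map
              (graph K (n₁ + n₂ + n₃ - 2) (m₁ + m₂ + m₃))).sum := by
  rw [h₂.star_graph h₃, map_sum]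
  refine Finset.sum_congr rfl fun j hj => ?_
  rw [map_smul]
  congr 1
  rw [← sum_map_smul_finset_sum, map_multiset_sum, Multiset.map_map]
  congr 1
  refine Multiset.map_congr rfl fun s hs => ?_
  have hn₂ := h₂.one_le
  have hn₃ := h₃.one_le
  have hg := h₂.of_mem_composites h₃ (show n₂ + n₃ = n₂ + n₃ - 1 + 1 by omega) rfl
    (Finset.mem_Icc.1 hj) hs
  rw [Function.comp_apply, h₁.star_graph hg, length_of_mem_composites hs,
    show n₁ + (n₂ + n₃ - 1) - 1 = n₁ + n₂ + n₃ - 2 by omega, ← add_assoc m₁]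

theorem negOne_zpow_congr {a b : ℤ} (h : Even (a - b)) : (-1 : K) ^ a = (-1 : K) ^ b := by
  rw [← sub_add_cancel a b, zpow_add₀ (by simp), h.neg_one_zpow, one_mul]

/-- The terms of `(E₁ ⋆ E₂) ⋆ E₃` in which `E₃` is inserted into a vertex of `E₂` cancel against `E₁
⋆ (E₂ ⋆ E₃)` by associativity of nested insertion. -/
theorem starAssoc_graph {E₁ E₂ E₃ : List Edge} (h₁ : Good n₁ m₁ E₁)
    (h₂ : Good n₂ m₂ E₂) (h₃ : Good n₃ m₃ E₃) :
    starAssoc (graph K n₁ m₁ E₁) (graph K n₂ m₂ E₂) (graph K n₃ m₃ E₃) =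
      ∑ i ∈ Finset.Icc 1 n₁, ∑ k ∈ (Finset.Icc 1 n₁).erase i,
        (starSign K n₁ n₂ m₂ E₂.length i * starSign K (n₁ + n₂ - 1) n₃ m₃ E₃.length
          (if k < i then k else k + n₂ - 1)) •
        parallelSum K n₁ m₁ n₂ m₂ n₃ m₃ E₁ E₂ E₃ i k := by
  have hn₁ := h₁.one_le
  have hn₂ := h₂.one_le
  have hn₃ := h₃.one_le
  rw [starAssoc, sub_eq_iff_eq_add, star_star_left h₁ h₂ h₃,
    star_star_right h₁ h₂ h₃]
  simp only [Finset.smul_sum, smul_smul]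
  rw [Finset.sum_comm (s := Finset.Icc 1 n₂), ← Finset.sum_add_distrib]
  refine Finset.sum_congr rfl fun i hi => ?_
  rw [sum_Icc_split hi hn₂, add_comm]
  congr 1
  refine Finset.sum_congr rfl fun j hj => ?_
  rw [composites_nested h₂ h₃ (Finset.mem_Icc.1 hi).1 (Finset.mem_Icc.1 hj)
    (show n₂ + n₃ = n₂ + n₃ - 1 + 1 by omega)]
  congr 1
  rw [starSign, starSign, starSign, starSign, ← zpow_add₀ (by simp), ← zpow_add₀ (by simp)]
  -- The exponents of the two signs differ by twice this integer.
  refine negOne_zpow_congr ⟨-(n₃ - 1), ?_⟩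
  have := (Finset.mem_Icc.1 hj).1
  push_cast [show 1 ≤ n₁ + n₂ by omega, show 1 ≤ n₂ + n₃ by omega, show 1 ≤ i + j by omega]
  ring

end

theorem parallelSum_swap {E₁ E₂ E₃ : List Edge} (h₁ : Good n₁ m₁ E₁)
    (h₂ : Good n₂ m₂ E₂) (h₃ : Good n₃ m₃ E₃) (hi : 1 ≤ i) (hik : i < k) :
    parallelSum K n₁ m₁ n₂ m₂ n₃ m₃ E₁ E₂ E₃ i k =
      (-1 : ℤ) ^ (E₂.length * E₃.length) •
        parallelSum K n₁ m₁ n₃ m₃ n₂ m₂ E₁ E₃ E₂ k i := by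
  rw [parallelSum, parallelSum, if_neg (by omega), if_pos hik,
    show n₁ + n₃ + n₂ - 2 = n₁ + n₂ + n₃ - 2 by omega, show m₁ + m₃ + m₂ = m₁ + m₂ + m₃ by omega]
  refine sum_graph_eq _ _ _ fun n' m' _ hm' => ?_
  exact sum_composites_parallel K h₁ h₂ h₃ hi hik hm'.symm

/-- The graded pre-Lie identity for graphs. -/
theorem starAssoc_graph_swap [CharZero K] {E₁ E₂ E₃ : List Edge} (h₁ : Good n₁ m₁ E₁)
    (h₂ : Good n₂ m₂ E₂) (h₃ : Good n₃ m₃ E₃) :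
    starAssoc (graph K n₁ m₁ E₁) (graph K n₂ m₂ E₂) (graph K n₃ m₃ E₃) =
      ((-1 : K) ^ ((2 * m₂ - E₂.length + n₂ - 1 : ℤ) * (2 * m₃ - E₃.length + n₃ - 1) : ℤ)) •
        starAssoc (graph K n₁ m₁ E₁) (graph K n₃ m₃ E₃) (graph K n₂ m₂ E₂) := by
  have hn₁ := h₁.one_le
  have hn₂ := h₂.one_le
  have hn₃ := h₃.one_le
  have hsign : ∀ (l : ℕ) (x : GraphSpace K), (-1 : ℤ) ^ l • x = (-1 : K) ^ (l : ℤ) • x := by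
    intro l x
    rw [zpow_natCast]
    rcases Nat.even_or_odd l with h | h <;> simp [h.neg_one_pow]
  rw [starAssoc_graph h₁ h₂ h₃, starAssoc_graph h₁ h₃ h₂]
  -- Interchanging the order of summation pairs the term with `E₂` at `i` and `E₃` at `k` of one
  -- associator with the same configuration in the other.
  have hset : ∀ f : ℕ → ℕ → GraphSpace K,
      ∑ i ∈ Finset.Icc 1 n₁, ∑ k ∈ (Finset.Icc 1 n₁).erase i, f i k =
        ∑ k ∈ Finset.Icc 1 n₁, ∑ i ∈ (Finset.Icc 1 n₁).erase k, f i k := by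
    intro f
    refine Finset.sum_comm' fun i k => ?_
    simp only [Finset.mem_erase, Finset.mem_Icc]
    tauto
  rw [hset, Finset.smul_sum]
  refine Finset.sum_congr rfl fun k hk => ?_
  rw [Finset.smul_sum]
  refine Finset.sum_congr rfl fun i hi => ?_
  rw [Finset.mem_erase, Finset.mem_Icc] at hi
  rw [Finset.mem_Icc] at hk
  rw [smul_smul]
  -- The position of an insertion shifts only if the earlier insertion took place at a smaller
  -- label, so the signs have to be compared separately for the two relative positions.
  rcases lt_or_gt_of_ne hi.1 with hik | hik
  · rw [parallelSum_swap h₁ h₂ h₃ hi.2.1 hik, if_neg (by omega), if_pos hik, hsign, smul_smul]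
    congr 1
    simp only [starSign]
    simp only [← zpow_add₀ (show (-1 : K) ≠ 0 by simp)]
    refine negOne_zpow_congr ?_
    push_cast [show 1 ≤ n₁ + n₂ by omega, show 1 ≤ n₁ + n₃ by omega, show 1 ≤ k + n₂ by omega]
    refine ⟨-(2 * m₂ * m₃) + m₂ * E₃.length + m₃ * E₂.length +
      (1 - n₂ : ℤ) * (2 * m₃ - E₃.length), ?_⟩
    ring
  · rw [parallelSum_swap h₁ h₃ h₂ hk.1 hik, if_pos hik, if_neg (by omega), hsign, smul_smul]
    congr 1
    simp only [starSign]
    simp only [← zpow_add₀ (show (-1 : K) ≠ 0 by simp)]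
    refine negOne_zpow_congr ?_
    push_cast [show 1 ≤ n₁ + n₂ by omega, show 1 ≤ n₁ + n₃ by omega, show 1 ≤ i + n₃ by omega]
    refine ⟨-1 - 2 * m₂ * m₃ + m₂ * E₃.length + E₂.length * m₃ - E₂.length * E₃.length + n₂ -
      2 * n₂ * m₃ + n₂ * E₃.length - n₂ * n₃ + 2 * m₃ - E₃.length + n₃, ?_⟩
    ring

end

/-! ## Gauge invariance of Maurer–Cartan elements -/

section

variable {K : Type*} [Field K] {n₁ m₁ n₂ m₂ n₃ m₃ n m i j k : ℕ}

variable (K) in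
/-- The homogeneous elements of degree `d`. -/
noncomputable def homogeneous (d : ℤ) : Submodule K (GraphSpace K) :=
  ⨅ n : ℕ, ⨅ m : ℕ, (Submodule.span K {x | ∃ E : List Edge, 2 * (m : ℤ) - E.length + n - 1 = d ∧
    x = cls K n m E}).comap (component K n m)

theorem mem_homogeneous {d : ℤ} {F : GraphSpace K} : F ∈ homogeneous K d ↔
    HasDegree (K := K) d F := by
  simp only [homogeneous, Submodule.mem_iInf, Submodule.mem_comap, HasDegree]
  rfl

theorem component_mem {d : ℤ} {F : GraphSpace K} : F ∈ homogeneous K d ↔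
    ∀ n m : ℕ, component K n m F ∈ Submodule.span K
      {x | ∃ E : List Edge, 2 * (m : ℤ) - E.length + n - 1 = d ∧ x = cls K n m E} := by
  simp only [homogeneous, Submodule.mem_iInf, Submodule.mem_comap]

variable (K) in
/-- The span of the admissible graphs of degree `d`. -/
noncomputable def graphSpan (d : ℤ) : Submodule K (GraphSpace K) :=
  Submodule.span K {F | ∃ n m E, Admissible n m E ∧ 2 * (m : ℤ) - E.length + n - 1 = d ∧
    F = graph K n m E}

theorem graph_mem_homogeneous {d : ℤ} {E : List Edge} (h : 2 * (m : ℤ) - E.length + n - 1 = d) :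
    graph K n m E ∈ homogeneous K d := by
  rw [component_mem]
  intro n' m'
  rw [component_graph]
  split_ifs with hh
  · obtain ⟨rfl, rfl⟩ := hh
    exact Submodule.subset_span ⟨E, h, rfl⟩
  · exact Submodule.zero_mem _

/-- Homogeneity is a condition on each component, which is a finite combination of classes; lifting
these graph by graph isolates one component as a finite sum. Classes of graphs that are not
admissible are zero and are lifted to zero. -/
theorem exists_component_eq {d : ℤ} {F : GraphSpace K} (hF : F ∈ homogeneous K d) (n m : ℕ) :
    ∃ F' ∈ graphSpan K d, ∀ n' m', component K n' m' F' =
      if n' = n ∧ m' = m then component K n' m' F else 0 := by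
  have h := component_mem.1 hF n m
  obtain ⟨y, hy⟩ : ∃ y, y = component K n m F := ⟨_, rfl⟩
  rw [← hy] at h
  have key : ∃ F' ∈ graphSpan K d, ∀ n' m', n' = n → m' = m → ∀ _ : True,
      component K n m F' = y ∧ ∀ n' m', ¬ (n' = n ∧ m' = m) → component K n' m' F' = 0 := by
    clear hy
    induction h using Submodule.span_induction with
    | mem x hx =>
      obtain ⟨E, hE, rfl⟩ := hx
      by_cases hA : Admissible n m E
      · refine ⟨graph K n m E, Submodule.subset_span ⟨n, m, E, hA, hE, rfl⟩, ?_⟩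
        rintro - - - - -
        exact ⟨by simp [component_graph], fun n' m' h => by rw [component_graph, if_neg h]⟩
      · refine ⟨0, Submodule.zero_mem _, ?_⟩
        rintro - - - - -
        exact ⟨by rw [cls_of_not_admissible hA, map_zero], fun _ _ _ => map_zero _⟩
    | zero => exact ⟨0, Submodule.zero_mem _, fun _ _ _ _ _ => ⟨map_zero _,
      fun _ _ _ => map_zero _⟩⟩
    | add x y _ _ hx hy =>
      obtain ⟨F, hF, h1⟩ := hx
      obtain ⟨G, hG, h2⟩ := hy
      have h1 := h1 n m rfl rfl trivial
      have h2 := h2 n m rfl rfl trivial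
      exact ⟨F + G, Submodule.add_mem _ hF hG, fun _ _ _ _ _ => ⟨by rw [map_add, h1.1, h2.1],
        fun n' m' h => by rw [map_add, h1.2 _ _ h, h2.2 _ _ h, add_zero]⟩⟩
    | smul c x _ hx =>
      obtain ⟨F, hF, h1⟩ := hx
      have h1 := h1 n m rfl rfl trivial
      exact ⟨c • F, Submodule.smul_mem _ _ hF, fun _ _ _ _ _ => ⟨by rw [map_smul, h1.1],
        fun n' m' h => by rw [map_smul, h1.2 _ _ h, smul_zero]⟩⟩
  obtain ⟨F', hF', h'⟩ := key
  have h' := h' n m rfl rfl trivial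
  refine ⟨F', hF', fun n' m' => ?_⟩
  split_ifs with hh
  · obtain ⟨rfl, rfl⟩ := hh
    rw [h'.1, hy]
  · exact h'.2 _ _ hh

/-- Homogeneous elements are locally finite sums of graphs. -/
theorem exists_truncation {d : ℤ} {F : GraphSpace K} (hF : F ∈ homogeneous K d) (N : ℕ) :
    ∃ F' ∈ graphSpan K d, ∀ n ≤ N, ∀ m ≤ N, component K n m F' = component K n m F := by
  choose g hg hg' using exists_component_eq hF
  refine ⟨∑ n ∈ Finset.range (N + 1), ∑ m ∈ Finset.range (N + 1), g n m,
    Submodule.sum_mem _ fun n _ => Submodule.sum_mem _ fun m _ => hg n m, fun n hn m hm => ?_⟩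
  simp only [map_sum, hg']
  rw [Finset.sum_eq_single n, Finset.sum_eq_single m]
  · simp
  · intro b _ hb; rw [if_neg (fun h => hb h.2.symm)]
  · intro h; exact absurd (Finset.mem_range.2 (by omega)) h
  · intro b _ hb; exact Finset.sum_eq_zero fun _ _ => if_neg (fun h => hb h.1.symm)
  · intro h; exact absurd (Finset.mem_range.2 (by omega)) h

theorem component_zero_left (F : GraphSpace K) (m : ℕ) : component K 0 m F = 0 := by
  obtain ⟨x, hx⟩ := (relations K 0 m).mkQ_surjective (component K 0 m F)
  have : x = 0 := by
    ext E
    exact absurd E.2.one_le (by norm_num)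
  rw [← hx, this, map_zero]

/-- The elements whose components have more than `w` vertices. -/
def HasWeight (w : ℕ) (F : GraphSpace K) : Prop := ∀ n m, n + m ≤ w → component K n m F = 0

/-- There are no graphs without external vertices, so this holds for every element; it starts the
induction on powers of `ad_ξ`. -/
theorem hasWeight_zero (F : GraphSpace K) : HasWeight 0 F := by
  intro n m h
  obtain ⟨rfl, rfl⟩ : n = 0 ∧ m = 0 := by omega
  exact component_zero_left F 0

section

variable [CharZero K]

/-- In a composition `n₁ + n₂ = n + 1` and `m₁ + m₂ = m`. So a component of a product depends on
finitely many components of the factors, with one more external vertex at most. -/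
theorem component_star_congr {F F' G G' : GraphSpace K} {N : ℕ}
    (hF : ∀ n ≤ N + 1, ∀ m ≤ N, component K n m F = component K n m F')
    (hG : ∀ n ≤ N + 1, ∀ m ≤ N, component K n m G = component K n m G') (hn : n ≤ N) (hm : m ≤ N) :
    component K n m (star K F G) = component K n m (star K F' G') := by
  rw [component_star, component_star]
  refine Finset.sum_congr rfl fun p _ => Finset.sum_congr rfl fun q _ => ?_
  have hp := Finset.HasAntidiagonal.mem_antidiagonal.1 p.2
  have hq := Finset.HasAntidiagonal.mem_antidiagonal.1 q.2
  rw [hF _ (by omega) _ (by omega), hG _ (by omega) _ (by omega)]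

theorem component_star_eq_of_le {F F' G G' : GraphSpace K} {N : ℕ}
    (hF : ∀ n ≤ N + 1, ∀ m ≤ N + 1, component K n m F = component K n m F')
    (hG : ∀ n ≤ N + 1, ∀ m ≤ N + 1, component K n m G = component K n m G') :
    ∀ n ≤ N, ∀ m ≤ N, component K n m (star K F G) = component K n m (star K F' G') :=
  fun _ hn _ hm => component_star_congr (fun n hn m hm => hF n hn m (by omega))
    (fun n hn m hm => hG n hn m (by omega)) hn hm

theorem Good.star_graph_mem {d e : ℤ} {E₁ E₂ : List Edge} (h₁ : Good n₁ m₁ E₁) (h₂ : Good n₂ m₂ E₂)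
    (hd : 2 * (m₁ : ℤ) - E₁.length + n₁ - 1 = d) (he : 2 * (m₂ : ℤ) - E₂.length + n₂ - 1 = e) :
    star K (graph K n₁ m₁ E₁) (graph K n₂ m₂ E₂) ∈ homogeneous K (d + e) := by
  rw [h₁.star_graph h₂]
  refine Submodule.sum_mem _ fun i _ => Submodule.smul_mem _ _ (multiset_sum_mem _ ?_)
  intro x hx
  obtain ⟨s, hs, rfl⟩ := Multiset.mem_map.1 hx
  refine graph_mem_homogeneous ?_
  rw [length_of_mem_composites hs]
  have := h₁.one_le
  push_cast [show 1 ≤ n₁ + n₂ by omega]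
  linarith

/-- Composition adds internal vertices and edges and loses one external vertex, which is compensated
by the shift by `n - 1` in the degree. The general case follows by bilinearity and truncation. -/
theorem star_mem_homogeneous {d e : ℤ} {F G : GraphSpace K} (hF : F ∈ homogeneous K d)
    (hG : G ∈ homogeneous K e) : star K F G ∈ homogeneous K (d + e) := by
  have key : ∀ F ∈ graphSpan K d, ∀ G ∈ graphSpan K e, star K F G ∈ homogeneous K (d + e) := by
    intro F hF G hG
    refine Submodule.span_induction₂ (p := fun F G _ _ => star K F G ∈ homogeneous K (d + e))
      ?_ ?_ ?_ ?_ ?_ ?_ ?_ hF hG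
    · rintro _ _ ⟨n₁, m₁, E₁, h₁, hd, rfl⟩ ⟨n₂, m₂, E₂, h₂, he, rfl⟩
      exact h₁.good.star_graph_mem h₂.good hd he
    · intro y _; rw [map_zero]; exact Submodule.zero_mem _
    · intro y _; rw [map_zero]; exact Submodule.zero_mem _
    · intro x y z _ _ _ h1 h2; rw [map_add]; exact Submodule.add_mem _ h1 h2
    · intro x y z _ _ _ h1 h2; rw [map_add]; exact Submodule.add_mem _ h1 h2
    · intro c x y _ _ h; rw [map_smul]; exact Submodule.smul_mem _ _ h
    · intro c x y _ _ h; rw [map_smul]; exact Submodule.smul_mem _ _ h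
  rw [component_mem]
  intro n m
  obtain ⟨F', hF', hF⟩ := exists_truncation hF (n + m + 1)
  obtain ⟨G', hG', hG⟩ := exists_truncation hG (n + m + 1)
  have h := component_mem.1 (key F' hF' G' hG') n m
  rwa [component_star_eq_of_le hF hG n (by omega) m (by omega)] at h

/-- Both sides are trilinear, so the identity for graphs extends to finite combinations; a given
component of an associator sees only a truncation of its arguments. -/
theorem starAssoc_swap {d e f : ℤ} {F G H : GraphSpace K} (hF : F ∈ homogeneous K d)
    (hG : G ∈ homogeneous K e) (hH : H ∈ homogeneous K f) :
    starAssoc F G H = ((-1 : K) ^ (e * f)) • starAssoc F H G := by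
  have key : ∀ F ∈ graphSpan K d, ∀ G ∈ graphSpan K e, ∀ H ∈ graphSpan K f,
      starAssoc F G H = ((-1 : K) ^ (e * f)) • starAssoc F H G := by
    intro F hF G hG H hH
    simp only [starAssoc]
    induction hF using Submodule.span_induction with
    | zero => simp
    | add x y _ _ hx hy =>
      simp only [map_add, LinearMap.add_apply, add_sub_add_comm, hx, hy, smul_add]
    | smul c x _ hx =>
      simp only [map_smul, LinearMap.smul_apply, ← smul_sub, hx, smul_comm c]
    | mem F hF =>
    induction hG using Submodule.span_induction with
    | zero => simp
    | add x y _ _ hx hy =>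
      simp only [map_add, LinearMap.add_apply, add_sub_add_comm, hx, hy, smul_add]
    | smul c x _ hx =>
      simp only [map_smul, LinearMap.smul_apply, ← smul_sub, hx, smul_comm c]
    | mem G hG =>
    induction hH using Submodule.span_induction with
    | zero => simp
    | add x y _ _ hx hy =>
      simp only [map_add, LinearMap.add_apply, add_sub_add_comm, hx, hy, smul_add]
    | smul c x _ hx =>
      simp only [map_smul, LinearMap.smul_apply, ← smul_sub, hx, smul_comm c]
    | mem H hH =>
    obtain ⟨n₁, m₁, E₁, h₁, -, rfl⟩ := hF
    obtain ⟨n₂, m₂, E₂, h₂, rfl, rfl⟩ := hG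
    obtain ⟨n₃, m₃, E₃, h₃, rfl, rfl⟩ := hH
    exact starAssoc_graph_swap h₁.good h₂.good h₃.good
  refine GraphSpace.ext fun n m => ?_
  -- Each of the two nested products costs one unit of the truncation bound.
  obtain ⟨F', hF', hF⟩ := exists_truncation hF (n + m + 2)
  obtain ⟨G', hG', hG⟩ := exists_truncation hG (n + m + 2)
  obtain ⟨H', hH', hH⟩ := exists_truncation hH (n + m + 2)
  have mono : ∀ {F F' : GraphSpace K}, (∀ n' ≤ n + m + 2, ∀ m' ≤ n + m + 2,
      component K n' m' F' = component K n' m' F) → ∀ n' ≤ n + m + 1, ∀ m' ≤ n + m + 1,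
      component K n' m' F' = component K n' m' F :=
    fun h n' hn' m' hm' => h n' (by omega) m' (by omega)
  have h := congrArg (component K n m) (key F' hF' G' hG' H' hH')
  simp only [starAssoc, map_sub, map_smul] at h ⊢
  rw [component_star_eq_of_le (component_star_eq_of_le hF hG) (mono hH) n (by omega) m (by omega),
    component_star_eq_of_le (mono hF) (component_star_eq_of_le hG hH) n (by omega) m (by omega),
    component_star_eq_of_le (component_star_eq_of_le hF hH) (mono hG) n (by omega) m (by omega),
    component_star_eq_of_le (mono hF) (component_star_eq_of_le hH hG) n (by omega) m
      (by omega)] at h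
  exact h

/-- Composition destroys exactly one vertex: if both factors have more than `v` and `w` vertices,
the result has more than `v + w`. -/
theorem HasWeight.star {v w : ℕ} {F G : GraphSpace K} (hF : HasWeight v F) (hG : HasWeight w G) :
    HasWeight (v + w) (star K F G) := by
  intro n m h
  rw [component_star]
  refine Finset.sum_eq_zero fun p _ => Finset.sum_eq_zero fun q _ => ?_
  have hp := Finset.HasAntidiagonal.mem_antidiagonal.1 p.2
  have hq := Finset.HasAntidiagonal.mem_antidiagonal.1 q.2
  by_cases h1 : p.1.1 + q.1.1 ≤ v
  · rw [hF _ _ h1, map_zero, LinearMap.zero_apply]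
  · rw [hG _ _ (show p.1.2 + q.1.2 ≤ w by omega), map_zero]

/-- `ad_ξ` as a linear map. -/
noncomputable def adStar (ξ : GraphSpace K) : GraphSpace K →ₗ[K] GraphSpace K :=
  star K ξ - (star K).flip ξ

theorem adStar_apply (ξ α : GraphSpace K) : adStar ξ α = star K ξ α - star K α ξ := rfl

theorem adStar_mem {d : ℤ} {ξ α : GraphSpace K} (hξ : ξ ∈ homogeneous K 0)
    (hα : α ∈ homogeneous K d) : adStar ξ α ∈ homogeneous K d := by
  have h1 := star_mem_homogeneous hξ hα
  have h2 := star_mem_homogeneous hα hξ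
  rw [zero_add] at h1
  rw [add_zero] at h2
  exact Submodule.sub_mem _ h1 h2

theorem HasWeight.adStar {w : ℕ} {ξ α : GraphSpace K} (hξ : HasWeight 1 ξ) (hα : HasWeight w α) :
    HasWeight (w + 1) (adStar ξ α) := by
  intro n m h
  rw [adStar_apply, map_sub, hξ.star hα n m (by omega), hα.star hξ n m (by omega), sub_zero]

theorem adStar_pow_mem {d : ℤ} {ξ α : GraphSpace K} (hξ : ξ ∈ homogeneous K 0)
    (hα : α ∈ homogeneous K d) (k : ℕ) : (adStar ξ ^ k) α ∈ homogeneous K d := by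
  induction k with
  | zero => exact hα
  | succ k ih => rw [pow_succ', Module.End.mul_apply]; exact adStar_mem hξ ih

theorem HasWeight.adStar_pow {ξ : GraphSpace K} (hξ : HasWeight 1 ξ) (α : GraphSpace K) (k : ℕ) :
    HasWeight k ((_root_.adStar ξ ^ k) α) := by
  induction k with
  | zero => exact hasWeight_zero _
  | succ k ih => rw [pow_succ', Module.End.mul_apply]; exact hξ.adStar ih

/-- The combination of the pre-Lie identities for the triples `(ξ, β, γ)`, `(β, ξ, γ)` and `(γ, ξ,
β)`. The first carries the sign `-1`, since `β` and `γ` are odd, the other two carry `+1`, since `ξ`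
is even. -/
theorem adStar_bracket {ξ β γ : GraphSpace K} (hξ : ξ ∈ homogeneous K 0)
    (hβ : β ∈ homogeneous K 1) (hγ : γ ∈ homogeneous K 1) :
    adStar ξ (star K β γ + star K γ β) =
      (star K (adStar ξ β) γ + star K γ (adStar ξ β)) +
        (star K β (adStar ξ γ) + star K (adStar ξ γ) β) := by
  have h1 := starAssoc_swap hξ hβ hγ
  have h2 := starAssoc_swap hβ hξ hγ
  have h3 := starAssoc_swap hγ hξ hβ
  simp only [starAssoc, mul_one, zpow_one, zpow_zero, one_smul, neg_smul] at h1 h2 h3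
  simp only [adStar_apply, map_add, map_sub, LinearMap.sub_apply]
  linear_combination (norm := abel) -h1 + h2 + h3

/-- The exponential series of `ad_ξ`, truncated. -/
noncomputable def expAd (N : ℕ) (ξ α : GraphSpace K) : GraphSpace K :=
  ∑ k ∈ Finset.range N, (k.factorial : K)⁻¹ • (adStar ξ ^ k) α

theorem gaugeAction_apply (ξ α : GraphSpace K) (n m : ℕ) :
    component K n m (gaugeAction (K := K) ξ α) = component K n m (expAd (n + m) ξ α) := by
  have h : ∀ k, (adjoint (K := K) ξ)^[k] α = (adStar ξ ^ k) α := by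
    intro k
    induction k with
    | zero => rfl
    | succ k ih =>
      refine (Function.iterate_succ_apply' _ _ _).trans ?_
      rw [pow_succ', Module.End.mul_apply, ← ih]
      rfl
  simp only [expAd, map_sum, ← h]
  rfl

/-- Additional terms of the exponential series have too many vertices to contribute, so one bound
`N` can serve all components that occur in a calculation. -/
theorem component_gaugeAction {ξ : GraphSpace K} (hξ : HasWeight 1 ξ) (α : GraphSpace K) {N : ℕ}
    (h : n + m ≤ N) :
    component K n m (gaugeAction (K := K) ξ α) = component K n m (expAd N ξ α) := by
  rw [gaugeAction_apply, expAd, expAd, ← Finset.sum_range_add_sum_Ico _ h, map_add, left_eq_add,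
    map_sum]
  refine Finset.sum_eq_zero fun k hk => ?_
  rw [map_smul, hξ.adStar_pow α k n m (Finset.mem_Ico.1 hk).1, smul_zero]

/-- This is `ad_ξ^s [α, α] = 0`, expanded by the iterated Leibniz rule; the induction step is
Pascal's rule together with `adStar_bracket`. -/
theorem sum_antidiagonal_bracket {ξ α : GraphSpace K} (hξ : ξ ∈ homogeneous K 0)
    (hα : α ∈ homogeneous K 1) (h : star K α α = 0) (s : ℕ) :
    ∑ p ∈ Finset.HasAntidiagonal.antidiagonal s, s.choose p.1 •
      (star K ((adStar ξ ^ p.1) α) ((adStar ξ ^ p.2) α) +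
        star K ((adStar ξ ^ p.2) α) ((adStar ξ ^ p.1) α)) = 0 := by
  induction s with
  | zero => simp [h]
  | succ s ih =>
    rw [Finset.sum_antidiagonal_choose_succ_nsmul (fun p q =>
      star K ((adStar ξ ^ p) α) ((adStar ξ ^ q) α) + star K ((adStar ξ ^ q) α) ((adStar ξ ^ p) α))]
    have h2 := congrArg (adStar ξ) ih
    rw [map_zero, map_sum] at h2
    rw [← h2, ← Finset.sum_add_distrib]
    refine Finset.sum_congr rfl fun p hp => ?_
    rw [map_nsmul, adStar_bracket hξ (adStar_pow_mem hξ hα _) (adStar_pow_mem hξ hα _),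
      ← (Nat.choose_symm_of_eq_add (Finset.HasAntidiagonal.mem_antidiagonal.1 hp).symm),
        ← smul_add, add_comm]
    simp only [pow_succ', Module.End.mul_apply]

/-- The product of the exponential series with itself is sorted by the total power `s` of `ad_ξ`;
for each `s` the terms add up to a multiple of `ad_ξ^s [α, α]`. -/
theorem star_expAd_self {ξ α : GraphSpace K} (hξ : ξ ∈ homogeneous K 0) (hξ' : HasWeight 1 ξ)
    (hα : α ∈ homogeneous K 1) (h : star K α α = 0) (hN : n + m ≤ N) :
    component K n m (star K (expAd N ξ α) (expAd N ξ α)) = 0 := by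
  have h2 : ∀ s, ∑ p ∈ Finset.HasAntidiagonal.antidiagonal s, ((p.1.factorial : K)⁻¹ *
    (p.2.factorial : K)⁻¹) •
      star K ((adStar ξ ^ p.1) α) ((adStar ξ ^ p.2) α) = 0 := by
    intro s
    set T := ∑ p ∈ Finset.HasAntidiagonal.antidiagonal s, ((p.1.factorial : K)⁻¹ *
      (p.2.factorial : K)⁻¹) •
      star K ((adStar ξ ^ p.1) α) ((adStar ξ ^ p.2) α) with hT
    have hT' : T = ∑ p ∈ Finset.HasAntidiagonal.antidiagonal s, ((p.1.factorial : K)⁻¹ *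
      (p.2.factorial : K)⁻¹) •
        star K ((adStar ξ ^ p.2) α) ((adStar ξ ^ p.1) α) := by
      rw [hT, ← Finset.Nat.sum_antidiagonal_swap]
      simp [mul_comm]
    have h3 := sum_antidiagonal_bracket hξ hα h s
    -- Averaging `T` with its reflection symmetrizes the product, and `s!` turns the inverse
    -- factorials into binomial coefficients.
    have h4 : (2 * (s.factorial : K)) • T = 0 := by
      rw [mul_comm, mul_smul, two_smul]
      nth_rewrite 2 [hT']
      rw [hT, ← Finset.sum_add_distrib, Finset.smul_sum, ← h3]
      refine Finset.sum_congr rfl fun p hp => ?_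
      have hp := Finset.HasAntidiagonal.mem_antidiagonal.1 hp
      rw [← smul_add, smul_smul, ← Nat.cast_smul_eq_nsmul K]
      congr 1
      rw [Nat.choose_eq_factorial_div_factorial (by omega), show s - p.1 = p.2 by omega,
        Nat.cast_div _ _, Nat.cast_mul]
      · field_simp
      · rw [← hp]; exact Nat.factorial_mul_factorial_dvd_factorial_add _ _
      · norm_cast; positivity
    exact (smul_eq_zero.1 h4).resolve_left (by norm_cast; positivity)
  simp only [expAd, map_sum, LinearMap.sum_apply, map_smul, LinearMap.smul_apply, Finset.smul_sum,
    smul_smul]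
  rw [Finset.sum_comm]
  rw [← Finset.sum_product',
    ← Finset.sum_filter_add_sum_filter_not _ (fun p : ℕ × ℕ => p.1 + p.2 < N)]
  -- The pairs outside the triangle `p.1 + p.2 < N`, which would spoil the grouping by total power,
  -- do not contribute for reasons of weight.
  have h5 : ∀ p ∈ (Finset.range N ×ˢ Finset.range N).filter (fun p : ℕ × ℕ => ¬ p.1 + p.2 < N),
      ((p.2.factorial : K)⁻¹ * (p.1.factorial : K)⁻¹) •
      component K n m (star K ((adStar ξ ^ p.1) α) ((adStar ξ ^ p.2) α)) = 0 := by
    intro p hp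
    rw [Finset.mem_filter] at hp
    rw [((hξ'.adStar_pow α p.1).star (hξ'.adStar_pow α p.2)) n m (by omega), smul_zero]
  rw [Finset.sum_eq_zero h5, add_zero,
    ← Finset.sum_fiberwise_of_maps_to (t := Finset.range N) (g := fun p : ℕ × ℕ => p.1 + p.2)]
  · refine Finset.sum_eq_zero fun s hs => ?_
    have h6 := congrArg (component K n m) (h2 s)
    rw [map_zero, map_sum] at h6
    rw [← h6]
    refine Finset.sum_congr ?_ fun p _ => by rw [map_smul, mul_comm]
    ext p
    simp only [Finset.mem_filter, Finset.mem_product, Finset.mem_range,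
      Finset.HasAntidiagonal.mem_antidiagonal] at hs ⊢
    omega
  · intro p hp
    simpa using (Finset.mem_filter.1 hp).2

/-- The gauge action preserves Maurer–Cartan elements. -/
theorem IsMaurerCartan.gaugeAction {ξ α : GraphSpace K} (hξ : ξ ∈ homogeneous K 0)
    (hξ' : HasWeight 1 ξ) (hα : IsMaurerCartan (K := K) α) :
    IsMaurerCartan (K := K) (gaugeAction (K := K) ξ α) := by
  have h1 : α ∈ homogeneous K 1 := mem_homogeneous.2 hα.1
  have h2 : star K α α = 0 := hα.2
  constructor
  · refine mem_homogeneous.1 (component_mem.2 fun n m => ?_)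
    have h3 : expAd (n + m) ξ α ∈ homogeneous K 1 :=
      Submodule.sum_mem _ fun k _ => Submodule.smul_mem _ _ (adStar_pow_mem hξ h1 k)
    have h4 := component_mem.1 h3 n m
    rwa [← gaugeAction_apply] at h4
  · refine GraphSpace.ext fun n m => ?_
    change component K n m (star K (_root_.gaugeAction (K := K) ξ α)
      (_root_.gaugeAction (K := K) ξ α)) = _
    -- All components of the factors that enter the `(n, m)` component have at most `2 (n + m + 1)`
    -- vertices, so a single truncated exponential replaces both factors.
    have h3 : ∀ n' ≤ n + m + 1, ∀ m' ≤ n + m + 1,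
        component K n' m' (_root_.gaugeAction (K := K) ξ α) =
        component K n' m' (expAd (2 * (n + m + 1)) ξ α) :=
      fun n' _ m' _ => component_gaugeAction hξ' α (by omega)
    rw [component_star_eq_of_le h3 h3 n (by omega) m (by omega),
      star_expAd_self hξ hξ' h1 h2 (by omega)]
    rfl

end

end

/-! ## Computation with finite sums of graphs -/

section

variable {n m : ℕ}

/-- A list enumerating `vertices n m`. -/
def vertexList (n m : ℕ) : List Vertex :=
  (List.range n).map (fun i => Vertex.ext (i + 1)) ++
    (List.range m).map (fun k => Vertex.int (k + 1))

theorem mem_vertexList {a : Vertex} : a ∈ vertexList n m ↔ a ∈ vertices n m := Iff.rfl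

/-- `subst` for lists. -/
def substList (p : Vertex → List Vertex) : List Edge → List (List Edge)
  | [] => [[]]
  | e :: E => (p e.1).flatMap fun a => (p e.2).flatMap fun b =>
      (substList p E).map fun s => (a, b) :: s

theorem coe_substList (p : Vertex → List Vertex) (E : List Edge) :
    (substList p E : Multiset (List Edge)) = subst (fun a => (p a : Multiset Vertex)) E := by
  induction E with
  | nil => rfl
  | cons e E ih =>
    simp only [substList, subst, ← ih, ← Multiset.coe_bind, ← Multiset.map_coe]

/-- `plug` for lists. -/
def plugList (j m₁ n₂ m₂ : ℕ) (a : Vertex) : List Vertex :=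
  if a = .ext j then (vertexList n₂ m₂).map (innerVertex j m₁) else [outerVertex j n₂ a]

theorem coe_plugList (j m₁ n₂ m₂ : ℕ) (a : Vertex) :
    (plugList j m₁ n₂ m₂ a : Multiset Vertex) = plug j m₁ n₂ m₂ a := by
  unfold plugList plug
  split_ifs <;> rfl

/-- `splitAt` for lists. -/
def splitList (v w : ℕ) (a : Vertex) : List Vertex :=
  if a = .int v then [.int v, .int w] else [a]

theorem coe_splitList (v w : ℕ) (a : Vertex) :
    (splitList v w a : Multiset Vertex) = splitAt v w a := by
  unfold splitList splitAt
  split_ifs <;> rfl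

/-- The vertices found to be connected with external ones after `k` rounds. -/
def reach (n : ℕ) (E : List Edge) : ℕ → List Vertex
  | 0 => vertexList n 0
  | k + 1 => E.foldl (fun S e => if e.1 ∈ S then e.2 :: S else if e.2 ∈ S then e.1 :: S else S)
      (reach n E k)

/-- A vertex is added only if it is joined by an edge to one found before, so the path grows by one
edge. That the search finds every connected vertex is not needed for soundness. -/
theorem connected_of_mem_reach {E : List Edge} {k : ℕ} {a : Vertex} (ha : a ∈ reach n E k) :
    ∃ i, Vertex.ext i ∈ vertices n m ∧
      Relation.ReflTransGen (fun a b => (a, b) ∈ E ∨ (b, a) ∈ E) a (Vertex.ext i) := by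
  induction k generalizing a with
  | zero =>
    obtain ⟨i, hi⟩ : ∃ i, a = Vertex.ext i := by
      simp only [reach, vertexList, List.range_zero, List.map_nil, List.append_nil,
        List.mem_map] at ha
      exact ⟨_, ha.choose_spec.2.symm⟩
    subst hi
    exact ⟨i, mem_vertices_ext.2 (mem_vertices_ext.1 (mem_vertexList.1 ha)), .refl⟩
  | succ k ih =>
    have key : ∀ (F : List Edge) (S : List Vertex), (∀ e ∈ F, e ∈ E) → (∀ b ∈ S, ∃ i,
        Vertex.ext i ∈ vertices n m ∧
        Relation.ReflTransGen (fun a b => (a, b) ∈ E ∨ (b, a) ∈ E) b (Vertex.ext i)) →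
        ∀ b ∈ F.foldl (fun S e => if e.1 ∈ S then e.2 :: S else if e.2 ∈ S then e.1 :: S else S) S,
        ∃ i, Vertex.ext i ∈ vertices n m ∧
        Relation.ReflTransGen (fun a b => (a, b) ∈ E ∨ (b, a) ∈ E) b (Vertex.ext i) := by
      intro F
      induction F with
      | nil => exact fun S _ hS => hS
      | cons e F ihF =>
        intro S hF hS
        refine ihF _ (fun f hf => hF f (List.mem_cons_of_mem _ hf)) ?_
        have he := hF e List.mem_cons_self
        dsimp only
        split_ifs with h1 h2
        · intro b hb
          rcases List.mem_cons.1 hb with rfl | hb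
          · obtain ⟨i, hi, hp⟩ := hS _ h1
            exact ⟨i, hi, .head (.inr he) hp⟩
          · exact hS b hb
        · intro b hb
          rcases List.mem_cons.1 hb with rfl | hb
          · obtain ⟨i, hi, hp⟩ := hS _ h2
            exact ⟨i, hi, .head (.inl he) hp⟩
          · exact hS b hb
        · exact hS
    exact key E _ (fun _ h => h) (fun b hb => ih hb) a ha

/-- A decision procedure for `Good`. -/
def isGood (n m : ℕ) (E : List Edge) : Bool :=
  Nat.ble 1 n && (E.all (fun e => decide (e.1 ∈ vertexList n m) && decide (e.2 ∈ vertexList n m) &&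
    decide (e.1 ≠ e.2)) && (List.range m).all fun k => decide (Vertex.int (k + 1) ∈ reach n E m))

theorem good_of_isGood {E : List Edge} (h : isGood n m E = true) : Good n m E := by
  simp only [isGood, Bool.and_eq_true, List.all_eq_true, decide_eq_true_eq, List.mem_range,
    Nat.ble_eq] at h
  refine ⟨h.1, fun e he => ⟨(h.2.1 e he).1.1, (h.2.1 e he).1.2, (h.2.1 e he).2⟩, fun k hk => ?_⟩
  have h1 := mem_vertices_int.1 hk
  have h2 := h.2.2 (k - 1) (by omega)
  rw [show k - 1 + 1 = k by omega] at h2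
  exact connected_of_mem_reach h2

/-- A decidable criterion for the violation of the valence conditions. -/
def isDead (m : ℕ) (E : List Edge) : Bool :=
  !decide E.Nodup || (List.range m).any fun k =>
    Nat.blt 1 (E.countP fun e => decide (e.2 = Vertex.int (k + 1))) ||
      Nat.blt 2 (E.countP fun e => decide (e.1 = Vertex.int (k + 1)))

theorem not_admissible_of_isDead {E : List Edge} (h : isDead m E = true) :
    ¬ Admissible n m E := by
  intro hE
  simp only [isDead, Bool.or_eq_true, Bool.not_eq_true', decide_eq_false_iff_not, List.any_eq_true,
    List.mem_range, Nat.blt_eq] at h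
  rcases h with h | ⟨k, hk, h⟩
  · exact h hE.nodup
  · have hk' : Vertex.int (k + 1) ∈ vertices n m := mem_vertices_int.2 (by omega)
    have h1 := hE.incoming _ hk'
    have h2 := hE.outgoing _ hk'
    omega

/-- A code for vertices. -/
def vertexCode : Vertex → ℕ
  | .ext i => 2 * i
  | .int k => 2 * k + 1

/-- A code for edges, used for sorting. -/
def edgeCode (e : Edge) : ℕ := 64 * vertexCode e.1 + vertexCode e.2

/-- A code for graphs. -/
def graphCode (E : List Edge) : ℕ := E.foldl (fun c e => 4096 * c + edgeCode e) 0

/-- Comparison of graphs. -/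
def sameGraph (E F : List Edge) : Bool := Nat.beq (graphCode E) (graphCode F) && decide (E = F)

theorem sameGraph_iff {E F : List Edge} : sameGraph E F = true ↔ E = F := by
  rw [sameGraph, Bool.and_eq_true, decide_eq_true_eq]
  refine ⟨And.right, fun h => ⟨?_, h⟩⟩
  rw [h, Nat.beq_eq]

/-- Insertion into a sorted list, with the parity of the number of transpositions. -/
def insertEdge (e : Edge) : List Edge → Bool × List Edge
  | [] => (false, [e])
  | f :: l => if Nat.ble (edgeCode e) (edgeCode f) then (false, e :: f :: l) else
      (!(insertEdge e l).1, f :: (insertEdge e l).2)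

/-- Sorting, with the parity of the permutation. -/
def sortEdges : List Edge → Bool × List Edge
  | [] => (false, [])
  | e :: l => (xor (sortEdges l).1 (insertEdge e (sortEdges l).2).1,
      (insertEdge e (sortEdges l).2).2)

/-- The sign with given parity. -/
def parity (b : Bool) : ℤ := if b then -1 else 1

theorem parity_not (b : Bool) : parity (!b) = -parity b := by cases b <;> rfl

theorem parity_xor (b c : Bool) : parity (xor b c) = parity b * parity c := by
  cases b <;> cases c <;> rfl

section

variable {M : Type*} [AddCommGroup M] {F : List Edge → M}

theorem insertEdge_sign
    (hF : ∀ l₁ l₂ e f, F (l₁ ++ e :: f :: l₂) + F (l₁ ++ f :: e :: l₂) = 0) (e : Edge)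
    (l₁ l : List Edge) :
    F (l₁ ++ e :: l) = parity (insertEdge e l).1 • F (l₁ ++ (insertEdge e l).2) := by
  induction l generalizing l₁ with
  | nil => simp [insertEdge, parity]
  | cons f l ih =>
    unfold insertEdge
    split_ifs
    · simp [parity]
    · have h := ih (l₁ ++ [f])
      simp only [List.append_assoc, List.cons_append, List.nil_append] at h
      rw [eq_neg_of_add_eq_zero_left (hF l₁ l e f), h, parity_not, neg_smul]

theorem sortEdges_sign
    (hF : ∀ l₁ l₂ e f, F (l₁ ++ e :: f :: l₂) + F (l₁ ++ f :: e :: l₂) = 0) (l₁ l : List Edge) :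
    F (l₁ ++ l) = parity (sortEdges l).1 • F (l₁ ++ (sortEdges l).2) := by
  induction l generalizing l₁ with
  | nil => simp [sortEdges, parity]
  | cons e l ih =>
    have h := ih (l₁ ++ [e])
    simp only [List.append_assoc, List.cons_append, List.nil_append] at h
    rw [h, insertEdge_sign hF, sortEdges, parity_xor, mul_smul]

end

/-- The permutations of `1, …, m`. -/
def internalPerms : ℕ → List (Equiv.Perm ℕ)
  | 0 => [1]
  | m + 1 => (internalPerms m).flatMap fun ρ =>
      (List.range (m + 1)).map fun i => Equiv.swap (i + 1) (m + 1) * ρ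

/-- Soundness of the normal form needs only that the listed permutations move nothing but internal
labels, not that the list is exhaustive. -/
theorem internalPerms_fix {ρ : Equiv.Perm ℕ} (hρ : ρ ∈ internalPerms m) {k : ℕ}
    (hk : k = 0 ∨ m < k) : ρ k = k := by
  induction m generalizing ρ with
  | zero => simp only [internalPerms, List.mem_singleton] at hρ; simp [hρ]
  | succ m ih =>
    simp only [internalPerms, List.mem_flatMap, List.mem_map, List.mem_range] at hρ
    obtain ⟨σ, hσ, i, hi, rfl⟩ := hρ
    rw [Equiv.Perm.mul_apply, ih hσ (by omega), Equiv.swap_apply_of_ne_of_ne (by omega) (by omega)]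

/-- The sorted relabellings of a graph. -/
def candidates (m : ℕ) (E : List Edge) : List (Bool × List Edge) :=
  (internalPerms m).map fun ρ => sortEdges (mapVertices (relabel ρ) E)

/-- Lexicographic comparison. -/
def codeLT : List Edge → List Edge → Bool
  | e :: l, f :: l' => Nat.blt (edgeCode e) (edgeCode f) ||
      (Nat.beq (edgeCode e) (edgeCode f) && codeLT l l')
  | _, _ => false

/-- The least of the given graphs. -/
def leastGraph (l : List (Bool × List Edge)) (b : Bool × List Edge) : Bool × List Edge :=
  l.foldl (fun b c => if codeLT c.2 b.2 then c else b) b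

/-- Only membership is used later on; minimality merely makes it likely that equal classes get the
same representative. -/
theorem leastGraph_mem (l : List (Bool × List Edge)) (b : Bool × List Edge) :
    leastGraph l b = b ∨ leastGraph l b ∈ l := by
  induction l generalizing b with
  | nil => exact .inl rfl
  | cons c l ih =>
    rw [leastGraph, List.foldl_cons]
    rcases ih (if codeLT c.2 b.2 then c else b) with h | h
    · rw [leastGraph] at h
      rw [h]
      split_ifs
      · exact .inr List.mem_cons_self
      · exact .inl rfl
    · exact .inr (List.mem_cons_of_mem _ h)

/-- The normal form of a graph; `none` if it is zero. -/
def normalForm (m : ℕ) (E : List Edge) : Option (Bool × List Edge) :=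
  if isDead m E then none else
    let b := leastGraph (candidates m E) (false, E)
    if (candidates m E).any fun c => decide (c.2 = b.2) && (c.1 != b.1) then none else some b

/-- Finite formal sums of graphs: coefficient, numbers of vertices, edges. -/
abbrev GraphSum : Type := List (ℤ × ℕ × ℕ × List Edge)

variable (K : Type*) [Field K]

/-- The value of a formal sum. -/
noncomputable def GraphSum.eval (F : GraphSum) : GraphSpace K :=
  (F.map fun t => (t.1 : K) • graph K t.2.1 t.2.2.1 t.2.2.2).sum

theorem GraphSum.eval_nil : GraphSum.eval K [] = 0 := rfl

theorem GraphSum.eval_cons (t : ℤ × ℕ × ℕ × List Edge) (F : GraphSum) :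
    GraphSum.eval K (t :: F) = (t.1 : K) • graph K t.2.1 t.2.2.1 t.2.2.2 + GraphSum.eval K F := by
  simp [GraphSum.eval]

theorem GraphSum.eval_append (F G : GraphSum) :
    GraphSum.eval K (F ++ G) = GraphSum.eval K F + GraphSum.eval K G := by
  simp [GraphSum.eval]

variable {K}

theorem graph_order (n m : ℕ) (l₁ l₂ : List Edge) (e f : Edge) :
    graph K n m (l₁ ++ e :: f :: l₂) + graph K n m (l₁ ++ f :: e :: l₂) = 0 := by
  refine GraphSpace.ext fun n' m' => ?_
  rw [map_add, component_graph, component_graph]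
  split_ifs
  · rw [cls_order, map_zero]
  · rw [add_zero, map_zero]

theorem graph_relabel {ρ : Equiv.Perm ℕ} (hρ : ∀ k, k = 0 ∨ m < k → ρ k = k) (E : List Edge) :
    graph K n m (mapVertices (relabel ρ) E) = graph K n m E := by
  refine GraphSpace.ext fun n' m' => ?_
  rw [component_graph, component_graph]
  split_ifs with h
  · obtain ⟨rfl, rfl⟩ := h
    rw [cls_relabel ρ fun k hk => hρ k ?_]
    rw [mem_vertices_int] at hk
    omega
  · rfl

theorem candidates_sign {M : Type*} [AddCommGroup M] {F : List Edge → M}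
    (hF : ∀ l₁ l₂ e f, F (l₁ ++ e :: f :: l₂) + F (l₁ ++ f :: e :: l₂) = 0)
    (hF' : ∀ ρ : Equiv.Perm ℕ, (∀ k, k = 0 ∨ m < k → ρ k = k) →
      ∀ E, F (mapVertices (relabel ρ) E) = F E)
    {E : List Edge} {c : Bool × List Edge} (hc : c ∈ candidates m E) :
    F E = parity c.1 • F c.2 := by
  obtain ⟨ρ, hρ, rfl⟩ := List.mem_map.1 hc
  rw [← List.nil_append (sortEdges _).2, ← sortEdges_sign hF [], List.nil_append,
    hF' ρ fun k hk => internalPerms_fix hρ hk]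

/-- A function on graphs that is compatible with orders and labellings is determined by normal
forms. -/
theorem normalForm_sign {M : Type*} [AddCommGroup M] [IsAddTorsionFree M] {F : List Edge → M}
    (hF : ∀ l₁ l₂ e f, F (l₁ ++ e :: f :: l₂) + F (l₁ ++ f :: e :: l₂) = 0)
    (hF' : ∀ ρ : Equiv.Perm ℕ, (∀ k, k = 0 ∨ m < k → ρ k = k) →
      ∀ E, F (mapVertices (relabel ρ) E) = F E)
    {E : List Edge} (h : isDead m E = false) :
    F E = (normalForm m E).elim 0 fun c => parity c.1 • F c.2 := by
  have hb : F E = parity (leastGraph (candidates m E) (false, E)).1 •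
      F (leastGraph (candidates m E) (false, E)).2 := by
    rcases leastGraph_mem (candidates m E) (false, E) with hb | hb
    · rw [hb]; simp [parity]
    · exact candidates_sign hF hF' hb
  rw [normalForm, h, if_neg Bool.false_ne_true]
  dsimp only
  split_ifs with h1
  · rw [List.any_eq_true] at h1
    obtain ⟨c, hc, hc'⟩ := h1
    simp only [Bool.and_eq_true, decide_eq_true_eq, bne_iff_ne, ne_eq] at hc'
    -- Two relabellings with the same sorted edges and opposite signs give `F E = -F E`, hence zero,
    -- as there is no torsion.
    have h2 := candidates_sign hF hF' hc
    have h3 : parity c.1 = - parity (leastGraph (candidates m E) (false, E)).1 := by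
      rw [← parity_not]
      congr 1
      have := hc'.2
      revert this
      cases c.1 <;> cases (leastGraph (candidates m E) (false, E)).1 <;> simp
    rw [hc'.1, h3, neg_smul, ← hb] at h2
    exact self_eq_neg.1 h2
  · exact hb

theorem graph_eq_zero_of_not_admissible {E : List Edge} (h : ¬ Admissible n m E) :
    graph K n m E = 0 := by
  refine GraphSpace.ext fun n' m' => ?_
  rw [component_graph, map_zero]
  split_ifs with hh
  · obtain ⟨rfl, rfl⟩ := hh
    exact cls_of_not_admissible h
  · rfl

/-- A graph recognized as dead is not admissible and has class zero; otherwise antisymmetry and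
unlabelling suffice, torsion being excluded by characteristic zero. IHX relations play no role in
the normal form. -/
theorem graph_normalForm [CharZero K] (n m : ℕ) (E : List Edge) :
    graph K n m E = (normalForm m E).elim 0 fun c => parity c.1 • graph K n m c.2 := by
  cases h : isDead m E with
  | true =>
    rw [normalForm, h, if_pos rfl]
    exact graph_eq_zero_of_not_admissible (not_admissible_of_isDead h)
  | false =>
    let _ : Module ℚ (GraphSpace K) := Module.compHom _ (algebraMap ℚ K)
    have := IsAddTorsionFree.of_module_rat (M := GraphSpace K)
    exact normalForm_sign (graph_order n m) (fun ρ hρ E => graph_relabel hρ E) h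

/-- Adding a term to a formal sum. -/
def addTerm (t : ℤ × ℕ × ℕ × List Edge) : GraphSum → GraphSum
  | [] => [t]
  | s :: F => if sameGraph t.2.2.2 s.2.2.2 && (Nat.beq t.2.1 s.2.1 && Nat.beq t.2.2.1 s.2.2.1) then
      (t.1 + s.1, s.2) :: F else s :: addTerm t F

theorem eval_addTerm (t : ℤ × ℕ × ℕ × List Edge) (F : GraphSum) :
    (addTerm t F).eval K = (t.1 : K) • graph K t.2.1 t.2.2.1 t.2.2.2 + F.eval K := by
  induction F with
  | nil => simp [addTerm, GraphSum.eval]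
  | cons s F ih =>
    unfold addTerm
    split_ifs with h
    · simp only [Bool.and_eq_true, sameGraph_iff, Nat.beq_eq] at h
      rw [GraphSum.eval_cons, GraphSum.eval_cons, h.1, h.2.1, h.2.2, Int.cast_add, add_smul,
        add_assoc]
    · rw [GraphSum.eval_cons, GraphSum.eval_cons, ih, add_left_comm]

/-- Collecting equal terms. -/
def GraphSum.collect : GraphSum → GraphSum
  | [] => []
  | t :: F => match normalForm t.2.2.1 t.2.2.2 with
    | none => GraphSum.collect F
    | some c => addTerm (parity c.1 * t.1, t.2.1, t.2.2.1, c.2) (GraphSum.collect F)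

theorem eval_collect [CharZero K] (F : GraphSum) : F.collect.eval K = F.eval K := by
  induction F with
  | nil => rfl
  | cons t F ih =>
    rw [GraphSum.eval_cons, graph_normalForm, GraphSum.collect]
    cases normalForm t.2.2.1 t.2.2.2 with
    | none => simp [ih]
    | some c =>
      rw [eval_addTerm, ih]
      simp only [Option.elim_some, Int.cast_mul, mul_comm (_ : K), mul_smul, Int.cast_smul_eq_zsmul]

/-- Reflection: an identity between combinations of graphs is reduced to the vanishing of finitely
many integers. -/
theorem eval_eq_zero [CharZero K] {F : GraphSum}
    (h : (F.collect.all fun t => decide (t.1 = 0)) = true) : F.eval K = 0 := by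
  rw [← eval_collect]
  generalize F.collect = G at h
  induction G with
  | nil => rfl
  | cons t G ih =>
    simp only [List.all_cons, Bool.and_eq_true, decide_eq_true_eq] at h
    rw [GraphSum.eval_cons, h.1, ih h.2]
    simp

/-- Multiplication by an integer. -/
def GraphSum.scale (c : ℤ) (F : GraphSum) : GraphSum := F.map fun t => (c * t.1, t.2)

theorem eval_scale (c : ℤ) (F : GraphSum) : (F.scale c).eval K = (c : K) • F.eval K := by
  simp [GraphSum.scale, GraphSum.eval, Function.comp_def, List.smul_sum, mul_smul]

/-- The product of two graphs. -/
def starTerm (t u : ℤ × ℕ × ℕ × List Edge) : GraphSum :=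
  (List.range t.2.1).flatMap fun i =>
    (substList (plugList (i + 1) t.2.2.1 u.2.1 u.2.2.1) t.2.2.2).map fun s =>
      (parity ((u.2.2.2.length * (t.2.1 + 1) + (i + 1 + 1) * (u.2.1 + 1)) % 2 == 1) * (t.1 * u.1),
        t.2.1 + u.2.1 - 1, t.2.2.1 + u.2.2.1,
          s ++ mapVertices (innerVertex (i + 1) t.2.2.1) u.2.2.2)

/-- Only the exponent modulo 2 matters; it is replaced by a natural number that can be evaluated. -/
theorem starSign_eq [CharZero K] (n₁ n₂ m₂ l₂ i : ℕ) : starSign K n₁ n₂ m₂ l₂ i =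
    (parity ((l₂ * (n₁ + 1) + (i + 1) * (n₂ + 1)) % 2 == 1) : ℤ) := by
  have h : starSign K n₁ n₂ m₂ l₂ i =
      (-1 : K) ^ ((l₂ * (n₁ + 1) + (i + 1) * (n₂ + 1) : ℕ) : ℤ) := by
    refine negOne_zpow_congr ⟨m₂ * (1 - n₁) - l₂ - (i + 1), ?_⟩
    push_cast
    ring
  rw [h, zpow_natCast]
  rcases Nat.mod_two_eq_zero_or_one (l₂ * (n₁ + 1) + (i + 1) * (n₂ + 1)) with h1 | h1
  · rw [(Nat.even_iff.2 h1).neg_one_pow, h1]; simp [parity]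
  · rw [(Nat.odd_iff.2 h1).neg_one_pow, h1]; simp [parity]

theorem eval_flatMap {ι : Type*} (l : List ι) (f : ι → GraphSum) :
    GraphSum.eval K (l.flatMap f) = (l.map fun i => (f i).eval K).sum := by
  induction l with
  | nil => rfl
  | cons i l ih => rw [List.flatMap_cons, GraphSum.eval_append, ih, List.map_cons, List.sum_cons]

theorem sum_Icc_one {M : Type*} [AddCommMonoid M] (f : ℕ → M) (n : ℕ) :
    ∑ i ∈ Finset.Icc 1 n, f i = ((List.range n).map fun i => f (i + 1)).sum := by
  induction n with
  | zero => simp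
  | succ n ih => rw [Finset.sum_Icc_succ_top (by omega), ih, List.range_succ]; simp

theorem coe_substList_plugList (j m₁ n₂ m₂ : ℕ) (E : List Edge) :
    (substList (plugList j m₁ n₂ m₂) E : Multiset (List Edge)) = subst (plug j m₁ n₂ m₂) E := by
  rw [coe_substList]
  simp only [coe_plugList]

theorem eval_starTerm [CharZero K] {t u : ℤ × ℕ × ℕ × List Edge} (ht : Good t.2.1 t.2.2.1 t.2.2.2)
    (hu : Good u.2.1 u.2.2.1 u.2.2.2) : (starTerm t u).eval K =
      star K ((t.1 : K) • graph K t.2.1 t.2.2.1 t.2.2.2)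
        ((u.1 : K) • graph K u.2.1 u.2.2.1 u.2.2.2) := by
  obtain ⟨c, n₁, m₁, E₁⟩ := t
  obtain ⟨d, n₂, m₂, E₂⟩ := u
  dsimp only at ht hu
  simp only [starTerm, map_smul, LinearMap.smul_apply, ht.star_graph hu, eval_flatMap,
    sum_Icc_one, List.smul_sum, List.map_map]
  congr 1
  refine List.map_congr_left fun i _ => ?_
  simp only [Function.comp_apply, smul_smul]
  rw [composites, ← coe_substList_plugList, Multiset.map_coe, Multiset.map_coe, Multiset.sum_coe,
    List.smul_sum, List.map_map, List.map_map, starSign_eq, GraphSum.eval, List.map_map]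
  congr 1
  refine List.map_congr_left fun s _ => ?_
  simp only [Function.comp_apply, Int.cast_mul]
  congr 1
  ring

/-- A check that `Good` holds for all terms. -/
def GraphSum.isGood (F : GraphSum) : Bool := F.all fun t => _root_.isGood t.2.1 t.2.2.1 t.2.2.2

/-- The product of formal sums, without the terms with more than `N` vertices. -/
def GraphSum.star (N : ℕ) (F G : GraphSum) : GraphSum := F.flatMap fun t => G.flatMap fun u =>
  if Nat.ble (t.2.1 + t.2.2.1 + (u.2.1 + u.2.2.1)) (N + 1) then starTerm t u else []

theorem hasWeight_graph [CharZero K] (n m : ℕ) (E : List Edge) :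
    HasWeight (n + m - 1) (graph K n m E) := by
  intro n' m' h
  by_cases h0 : n' = 0
  · subst h0
    exact component_zero_left _ _
  · rw [component_graph, if_neg (by omega)]

/-- A pair of graphs with more than `N + 1` vertices altogether composes to graphs with more than
`N` vertices, so leaving it out does not affect the components in question. -/
theorem component_eval_star [CharZero K] {F G : GraphSum} (hF : F.isGood = true)
    (hG : G.isGood = true) {N : ℕ} (h : n + m ≤ N) : component K n m ((F.star N G).eval K) =
      component K n m (_root_.star K (GraphSum.eval K F) (GraphSum.eval K G)) := by
  simp only [GraphSum.isGood, List.all_eq_true] at hF hG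
  have h1 : ∀ t ∈ F, ∀ u ∈ G, component K n m (GraphSum.eval K
      (if Nat.ble (t.2.1 + t.2.2.1 + (u.2.1 + u.2.2.1)) (N + 1) then starTerm t u else [])) =
      component K n m (_root_.star K ((t.1 : K) • graph K t.2.1 t.2.2.1 t.2.2.2)
        ((u.1 : K) • graph K u.2.1 u.2.2.1 u.2.2.2)) := by
    intro t ht u hu
    have ht' := good_of_isGood (hF t ht)
    have hu' := good_of_isGood (hG u hu)
    split_ifs with hw
    · rw [eval_starTerm ht' hu']
    · rw [Nat.ble_eq] at hw
      have := ht'.one_le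
      have := hu'.one_le
      rw [map_smul, map_smul, map_smul, LinearMap.smul_apply, map_smul,
        (hasWeight_graph _ _ _).star (hasWeight_graph _ _ _) n m (by omega)]
      simp [GraphSum.eval_nil]
  rw [GraphSum.star, eval_flatMap, map_list_sum, List.map_map]
  have h2 : ∀ t ∈ F, component K n m (GraphSum.eval K (G.flatMap fun u =>
      if Nat.ble (t.2.1 + t.2.2.1 + (u.2.1 + u.2.2.1)) (N + 1) then starTerm t u else [])) =
      component K n m (_root_.star K ((t.1 : K) • graph K t.2.1 t.2.2.1 t.2.2.2)
        (GraphSum.eval K G)) := by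
    intro t ht
    rw [eval_flatMap, map_list_sum, List.map_map, GraphSum.eval, map_list_sum, List.map_map,
      map_list_sum, List.map_map]
    congr 1
    exact List.map_congr_left fun u hu => h1 t ht u hu
  rw [show _root_.star K (GraphSum.eval K F) (GraphSum.eval K G) = (_root_.star K).flip
    (GraphSum.eval K G) (GraphSum.eval K F) from rfl]
  generalize GraphSum.eval K G = g at *
  rw [GraphSum.eval, map_list_sum, List.map_map, map_list_sum, List.map_map]
  congr 1
  exact List.map_congr_left h2

/-- `ad_ξ F`, up to terms with more than `N` vertices. -/
def GraphSum.ad (N : ℕ) (ξ F : GraphSum) : GraphSum :=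
  (ξ.star N F ++ (F.star N ξ).scale (-1)).collect

theorem component_ad [CharZero K] {ξ F : GraphSum} (hξ : ξ.isGood = true) (hF : F.isGood = true)
    {N : ℕ} (h : n + m ≤ N) :
    component K n m ((ξ.ad N F).eval K) =
      component K n m (adStar (ξ.eval K) (GraphSum.eval K F)) := by
  rw [GraphSum.ad, eval_collect, GraphSum.eval_append, eval_scale, map_add, map_smul,
    component_eval_star hF hξ h, component_eval_star hξ hF h, adStar_apply, map_sub,
    sub_eq_add_neg, Int.cast_neg, Int.cast_one, neg_one_smul]

/-- The generalized IHX relation obtained by splitting the vertex `v` of `E`. -/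
def ihxSum (n m : ℕ) (E : List Edge) (v : ℕ) : GraphSum :=
  (substList (splitList v (m + 1)) E).map fun s =>
    (1, n, m + 1, s ++ [(Vertex.int v, Vertex.int (m + 1))])

/-- The defining relation, with the multiset of reconnections enumerated as a list; terms that are
not admissible may remain in the list, their classes being zero. -/
theorem eval_ihxSum {E : List Edge} (hE : isGood n m E = true) {v : ℕ} (hv : 1 ≤ v ∧ v ≤ m) :
    (ihxSum n m E v).eval K = 0 := by
  have h := good_of_isGood hE
  refine GraphSpace.ext fun n' m' => ?_
  have h1 := cls_ihx (K := K) h.edges h.connected (mem_vertices_int.2 hv)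
  have h2 : subst (splitAt v (m + 1)) E = substList (splitList v (m + 1)) E := by
    rw [coe_substList]
    simp only [coe_splitList]
  have h3 : (ihxSum n m E v).eval K = (((subst (splitAt v (m + 1)) E).map fun s =>
      s ++ [(Vertex.int v, Vertex.int (m + 1))]).map (graph K n (m + 1))).sum := by
    rw [h2, Multiset.map_map, Multiset.map_coe, Multiset.sum_coe, ihxSum, GraphSum.eval,
      List.map_map]
    simp [Function.comp_def]
  rw [h3, component_sum_graph, Multiset.map_map]
  split_ifs with hh
  · obtain ⟨rfl, rfl⟩ := hh
    exact h1
  · rfl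

end

/-! ## The gauge transformation in low orders -/

section

open Vertex

/-- `24 α_Duf` in low orders. -/
def dufloSum : GraphSum :=
  [(24, 1, 1, [(int 1, ext 1)]), (24, 1, 1, [(ext 1, int 1)]), (24, 2, 0, []),
    (12, 2, 1, [(int 1, ext 1), (int 1, ext 2)]),
    (-2, 2, 2, [(int 2, ext 2), (int 2, int 1), (int 1, ext 1), (int 1, ext 2)]),
    (2, 2, 2, [(int 2, ext 1), (int 2, int 1), (int 1, ext 1), (int 1, ext 2)]),
    (3, 2, 2, [(int 1, ext 1), (int 1, ext 2), (int 2, ext 1), (int 2, ext 2)]),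
    (1, 2, 2, [(int 1, ext 1), (int 1, int 2), (int 2, int 1), (int 2, ext 2)])]

/-- `48 ξ`. -/
def gaugeSum : GraphSum :=
  [(-12, 2, 0, [(ext 1, ext 2)]), (12, 2, 0, [(ext 2, ext 1)]),
    (-3, 2, 1, [(int 1, ext 1), (int 1, ext 2), (ext 1, ext 2)]),
    (3, 2, 1, [(int 1, ext 1), (int 1, ext 2), (ext 2, ext 1)]),
    (1, 2, 1, [(ext 2, int 1), (int 1, ext 1), (int 1, ext 2)]),
    (-1, 2, 1, [(ext 1, int 1), (int 1, ext 1), (int 1, ext 2)])]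

/-- `24 α'_Duf` in low orders. -/
def dufloSum' : GraphSum :=
  [(24, 1, 1, [(int 1, ext 1)]), (24, 1, 1, [(ext 1, int 1)]), (24, 2, 0, []),
    (1, 3, 1, [(ext 1, int 1), (int 1, ext 2), (int 1, ext 3)]),
    (1, 3, 1, [(int 1, ext 1), (ext 2, int 1), (int 1, ext 3)]),
    (1, 3, 1, [(int 1, ext 1), (int 1, ext 2), (ext 3, int 1)])]

/-- The iterated application of `48 ad_ξ` to `24 α_Duf` in low orders. -/
def iteratedAd : ℕ → GraphSum
  | 0 => dufloSum
  | k + 1 => gaugeSum.ad 4 (iteratedAd k)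

/-- The IHX relations that are used in the gauge transformation. -/
def ihxCertificate : GraphSum :=
  (ihxSum 2 1 [(ext 2, int 1), (int 1, ext 1), (int 1, ext 2)] 1).scale 1 ++
  (ihxSum 2 1 [(ext 2, ext 1), (int 1, ext 1), (int 1, ext 2)] 1).scale 3 ++
  (ihxSum 2 1 [(ext 1, int 1), (int 1, ext 1), (int 1, ext 2)] 1).scale (-1) ++
  (ihxSum 2 1 [(ext 1, ext 2), (int 1, ext 1), (int 1, ext 2)] 1).scale (-3)

/-- `6 · 48³ · 24` times the difference of the two sides. -/
def gaugeDefect : GraphSum :=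
  (iteratedAd 0).scale 663552 ++ (iteratedAd 1).scale 13824 ++ (iteratedAd 2).scale 144 ++
    iteratedAd 3 ++ dufloSum'.scale (-663552) ++ ihxCertificate.scale (-331776)

set_option maxRecDepth 100000 in
-- Besides the goodness of all graphs that are composed, this asserts that after sorting and
-- relabelling every coefficient of the difference vanishes. Since normal forms know nothing of IHX
-- relations, the required multiple of `ihxCertificate` has been subtracted explicitly.
theorem gauge_computation : (gaugeSum.isGood && ((iteratedAd 0).isGood && ((iteratedAd 1).isGood &&
    ((iteratedAd 2).isGood && gaugeDefect.collect.all fun t => decide (t.1 = 0))))) = true := by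
  decide +kernel

end

section

variable {K : Type*} [Field K] [CharZero K] {n m : ℕ}

open Vertex

/-- The powers of `ad_ξ` are followed up to four vertices, with `ξ` scaled by `48` and `α` by `24`
in order to have integral coefficients. The exponential series ends at `ad_ξ³` because each
application adds a vertex. -/
theorem expAd_low {ξ α : GraphSpace K} (hξ : HasWeight 1 ξ)
    (hα : ∀ n m, n + m ≤ 4 → component K n m α = component K n m ((24 : K)⁻¹ • dufloSum.eval K))
    (hξ' : (48 : K) • ξ = gaugeSum.eval K) (h : n + m ≤ 4) :
    component K n m (expAd 4 ξ α) = component K n m ((24 : K)⁻¹ • dufloSum'.eval K) := by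
  have hg := gauge_computation
  simp only [Bool.and_eq_true] at hg
  obtain ⟨g, g0, g1, g2, hd⟩ := hg
  -- `iteratedAd k` represents `24 · 48^k · ad_ξ^k α` up to four vertices; the step multiplies the
  -- constant by `48`.
  have step : ∀ (β : GraphSpace K) (k : ℕ) (c : K), (iteratedAd k).isGood = true →
      (∀ n m, n + m ≤ 4 → component K n m (c • β) = component K n m ((iteratedAd k).eval K)) →
      ∀ n m, n + m ≤ 4 → component K n m ((48 * c) • adStar ξ β) =
        component K n m ((iteratedAd (k + 1)).eval K) := by
    intro β k c hk hβ n m h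
    rw [iteratedAd, component_ad g hk h, ← hξ']
    -- The unknown part of the argument has at least five vertices and cannot come back below that
    -- bound after an application of `ad_ξ`.
    have hw : HasWeight 4 (c • β - (iteratedAd k).eval K) := fun n m h => by
      rw [map_sub, hβ n m h, sub_self]
    have := hξ.adStar hw n m (by omega)
    rw [map_sub, map_sub, sub_eq_zero, map_smul, map_smul] at this
    simp only [adStar_apply, map_smul, map_sub, LinearMap.smul_apply] at this ⊢
    rw [mul_smul, this, smul_sub]
  have h0 : ∀ n m, n + m ≤ 4 → component K n m ((24 : K) • α) =
      component K n m ((iteratedAd 0).eval K) := fun n m h => by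
    rw [map_smul, hα n m h, map_smul, smul_smul, mul_inv_cancel₀ (by norm_num), one_smul]
    rfl
  have h1 := step _ 0 _ g0 h0
  have h2 := step _ 1 _ g1 h1
  have h3 := step _ 2 _ g2 h2
  have h4 : ihxCertificate.eval K = 0 := by
    simp only [ihxCertificate, GraphSum.eval_append, eval_scale]
    rw [eval_ihxSum (by decide) (by norm_num), eval_ihxSum (by decide) (by norm_num),
      eval_ihxSum (by decide) (by norm_num), eval_ihxSum (by decide) (by norm_num)]
    simp
  replace hd := congrArg (component K n m) (eval_eq_zero (K := K) hd)
  simp only [gaugeDefect, GraphSum.eval_append, eval_scale, h4, map_add, map_smul, map_zero,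
    smul_zero, add_zero] at hd
  rw [← h0 n m h, ← h1 n m h, ← h2 n m h, ← h3 n m h] at hd
  simp only [expAd, Finset.sum_range_succ, Finset.sum_range_zero, map_add, map_smul, zero_add,
    pow_succ', pow_zero, Module.End.mul_apply, Module.End.one_apply, Nat.factorial] at hd ⊢
  generalize component K n m α = x0 at *
  generalize component K n m (adStar ξ α) = x1 at *
  generalize component K n m (adStar ξ (adStar ξ α)) = x2 at *
  generalize component K n m (adStar ξ (adStar ξ (adStar ξ α))) = x3 at *
  generalize component K n m (dufloSum'.eval K) = y at *
  push_cast at hd ⊢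
  -- Here `15925248 = 24 · 6 · 48³` is the common denominator, so the coefficients of `ad_ξ²` and
  -- `ad_ξ³` are its half and its sixth.
  have hd' : (15925248 : K) • x0 + (15925248 : K) • x1 + (7962624 : K) • x2 + (2654208 : K) • x3 -
      (663552 : K) • y = 0 := by
    rw [← hd]
    module
  have : (15925248 : K) • (((1 : K)⁻¹ • x0 + (1 * 1 : K)⁻¹ • x1 + ((1 + 1) * (1 * 1) : K)⁻¹ • x2 +
      ((2 + 1) * ((1 + 1) * (1 * 1)) : K)⁻¹ • x3) - (24 : K)⁻¹ • y) = 0 := by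
    rw [← hd']
    module
  have := (smul_eq_zero.1 this).resolve_left (by norm_num)
  rw [sub_eq_zero] at this
  convert this using 4 <;> norm_num

theorem sum_eq_eval_dufloSum (K : Type*) [Field K] [CharZero K] : (a₁ K + a₂ K +
    (1 / 2 : K) • a₃ K - (1 / 12 : K) • a₄ K +
    (1 / 8 : K) • a₅ K + (1 / 24 : K) • a₆ K : GraphLie K) =
    ((24 : K)⁻¹ • dufloSum.eval K : GraphSpace K) := by
  change (graph K 1 1 [(int 1, ext 1)] + graph K 1 1 [(ext 1, int 1)] + graph K 2 0 [] +
    (1 / 2 : K) • graph K 2 1 [(int 1, ext 1), (int 1, ext 2)] - (1 / 12 : K) •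
    (graph K 2 2 [(int 2, ext 2), (int 2, int 1), (int 1, ext 1), (int 1, ext 2)] -
      graph K 2 2 [(int 2, ext 1), (int 2, int 1), (int 1, ext 1), (int 1, ext 2)]) +
    (1 / 8 : K) • graph K 2 2 [(int 1, ext 1), (int 1, ext 2), (int 2, ext 1), (int 2, ext 2)] +
    (1 / 24 : K) • graph K 2 2 [(int 1, ext 1), (int 1, int 2), (int 2, int 1), (int 2, ext 2)] :
      GraphSpace K) = _
  simp only [dufloSum, GraphSum.eval_cons, GraphSum.eval_nil]
  push_cast
  module

/-- The gauge parameter. -/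
theorem exists_gauge {α : GraphSpace K} (hα : IsMaurerCartan (K := K) α)
    (h : EqUpTo 4 (α : GraphLie K) (a₁ K + a₂ K + (1 / 2 : K) • a₃ K - (1 / 12 : K) • a₄ K +
      (1 / 8 : K) • a₅ K + (1 / 24 : K) • a₆ K)) :
    ∃ ξ α' : GraphLie K,
      HasDegree 0 ξ ∧
      EqUpTo 3 ξ (-(1 / 4 : K) • ξ₁ K - (1 / 16 : K) • ξ₂ K + (1 / 48 : K) • ξ₃ K) ∧
      IsMaurerCartan α' ∧
      EqUpTo 4 α' (a₁ K + a₂ K + (1 / 24 : K) • obstructionGraph K) ∧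
      α' = gaugeAction ξ α := by
  have e1 : (-(1 / 4 : K) • ξ₁ K - (1 / 16 : K) • ξ₂ K + (1 / 48 : K) • ξ₃ K : GraphLie K) =
      ((48 : K)⁻¹ • gaugeSum.eval K : GraphSpace K) := by
    change (-(1 / 4 : K) • (graph K 2 0 [(ext 1, ext 2)] - graph K 2 0 [(ext 2, ext 1)]) -
      (1 / 16 : K) • (graph K 2 1 [(int 1, ext 1), (int 1, ext 2), (ext 1, ext 2)] -
        graph K 2 1 [(int 1, ext 1), (int 1, ext 2), (ext 2, ext 1)]) +
      (1 / 48 : K) • (graph K 2 1 [(ext 2, int 1), (int 1, ext 1), (int 1, ext 2)] -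
        graph K 2 1 [(ext 1, int 1), (int 1, ext 1), (int 1, ext 2)]) : GraphSpace K) = _
    simp only [gaugeSum, GraphSum.eval_cons, GraphSum.eval_nil]
    push_cast
    module
  have e3 : (a₁ K + a₂ K + (1 / 24 : K) • obstructionGraph K : GraphLie K) =
      ((24 : K)⁻¹ • dufloSum'.eval K : GraphSpace K) := by
    change (graph K 1 1 [(int 1, ext 1)] + graph K 1 1 [(ext 1, int 1)] + graph K 2 0 [] +
      (1 / 24 : K) • (graph K 3 1 [(ext 1, int 1), (int 1, ext 2), (int 1, ext 3)] +
        graph K 3 1 [(int 1, ext 1), (ext 2, int 1), (int 1, ext 3)] +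
        graph K 3 1 [(int 1, ext 1), (int 1, ext 2), (ext 3, int 1)]) : GraphSpace K) = _
    simp only [dufloSum', GraphSum.eval_cons, GraphSum.eval_nil]
    push_cast
    module
  rw [e1, e3]
  have h' : ∀ n m, n + m ≤ 4 → component K n m α =
      component K n m ((24 : K)⁻¹ • dufloSum.eval K) :=
    fun n m hnm => (h n m hnm).trans (congrFun (congrFun (sum_eq_eval_dufloSum K) n) m)
  have hξ : ((48 : K)⁻¹ • gaugeSum.eval K : GraphSpace K) ∈ homogeneous K 0 := by
    refine Submodule.smul_mem _ _ ?_
    simp only [gaugeSum, GraphSum.eval_cons, GraphSum.eval_nil]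
    repeat' first
      | refine Submodule.add_mem _ (Submodule.smul_mem _ _ (graph_mem_homogeneous (by norm_num))) ?_
      | exact Submodule.zero_mem _
  have hw : HasWeight 1 ((48 : K)⁻¹ • gaugeSum.eval K : GraphSpace K) := by
    intro n m h
    simp only [gaugeSum, GraphSum.eval_cons, GraphSum.eval_nil, map_add, map_smul, map_zero,
      component_graph]
    have h1 : ¬ (n = 2 ∧ m = 0) := by omega
    have h2 : ¬ (n = 2 ∧ m = 1) := by omega
    simp [h1, h2]
  -- The gauge parameter has no terms beyond the displayed ones, and `α'` is by definition the
  -- transform of `α`; only its low-order part needs the computation.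
  refine ⟨_, _, mem_homogeneous.1 hξ, fun _ _ _ => rfl, hα.gaugeAction hξ hw, ?_, rfl⟩
  intro n m hnm
  refine (component_gaugeAction hw α hnm).trans (expAd_low hw h' ?_ hnm)
  rw [smul_smul, mul_inv_cancel₀ (by norm_num), one_smul]

end

/-! ## Words in the superalgebra -/

section

variable {K : Type*} [Field K] {σ τ : Type*}

/-- The product of the generators `x_s` and `p^t` for `s` in `X` and `t` in `P`. -/
noncomputable def word (K : Type*) [Field K] (X P : List σ) : SuperPoly K σ :=
  (X.map (MvPolynomial.X (R := K))).prod ⊗ₜ[K]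
    (P.map fun s => ExteriorAlgebra.ι K (Finsupp.single s (1 : K))).prod

theorem word_mul (X P X' P' : List σ) :
    word K X P * word K X' P' = word K (X ++ X') (P ++ P') := by
  simp [word, Algebra.TensorProduct.tmul_mul_tmul]

theorem superMap_word (g : σ → τ) (X P : List σ) :
    superMap (K := K) g (word K X P) = word K (X.map g) (P.map g) := by
  simp only [superMap, word, Algebra.TensorProduct.map_tmul, map_list_prod, List.map_map]
  congr 3
  · funext s
    simp
  · funext s
    simp [ExteriorAlgebra.map_apply_ι, Finsupp.lmapDomain_apply, Finsupp.mapDomain_single]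

/-- Formal linear combinations of words. -/
abbrev WordSum (σ : Type*) : Type _ := List (ℤ × List σ × List σ)

/-- The value of a formal linear combination. -/
noncomputable def WordSum.eval (K : Type*) [Field K] (F : WordSum σ) : SuperPoly K σ :=
  (F.map fun w => (w.1 : K) • word K w.2.1 w.2.2).sum

theorem WordSum.eval_cons (w : ℤ × List σ × List σ) (F : WordSum σ) :
    WordSum.eval K (w :: F) = (w.1 : K) • word K w.2.1 w.2.2 + WordSum.eval K F := by
  simp [WordSum.eval]

theorem WordSum.eval_append (F G : WordSum σ) :
    WordSum.eval K (F ++ G) = WordSum.eval K F + WordSum.eval K G := by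
  simp [WordSum.eval]

theorem WordSum.eval_flatMap {ι : Type*} (l : List ι) (f : ι → WordSum σ) :
    WordSum.eval K (l.flatMap f) = (l.map fun i => WordSum.eval K (f i)).sum := by
  induction l with
  | nil => rfl
  | cons i l ih => rw [List.flatMap_cons, WordSum.eval_append, ih, List.map_cons, List.sum_cons]

/-- The product of formal sums of words. -/
def WordSum.mul (F G : WordSum σ) : WordSum σ :=
  F.flatMap fun v => G.map fun w => (v.1 * w.1, v.2.1 ++ w.2.1, v.2.2 ++ w.2.2)

theorem WordSum.eval_mul (F G : WordSum σ) :
    WordSum.eval K (F.mul G) = WordSum.eval K F * WordSum.eval K G := by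
  rw [WordSum.mul, WordSum.eval_flatMap, WordSum.eval, ← List.sum_map_mul_right]
  congr 1
  refine List.map_congr_left fun v _ => ?_
  rw [WordSum.eval, WordSum.eval, List.map_map, ← List.sum_map_mul_left]
  congr 1
  refine List.map_congr_left fun w _ => ?_
  simp only [Function.comp_apply, Int.cast_mul, smul_mul_smul_comm, word_mul]

/-- Substitution of variables in formal sums. -/
def WordSum.map (g : σ → τ) (F : WordSum σ) : WordSum τ :=
  List.map (fun w => (w.1, w.2.1.map g, w.2.2.map g)) F

theorem WordSum.eval_map (g : σ → τ) (F : WordSum σ) :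
    WordSum.eval K (F.map g) = superMap (K := K) g (WordSum.eval K F) := by
  simp [WordSum.map, WordSum.eval, Function.comp_def, map_list_sum, superMap_word]

section

variable [DecidableEq σ]

/-- The lists that arise by removing one occurrence of `s`. -/
def deletions (s : σ) : List σ → List (List σ)
  | [] => []
  | x :: X => if x = s then X :: (deletions s X).map (x :: ·) else (deletions s X).map (x :: ·)

theorem partialX_word (s : σ) (X P : List σ) :
    partialX s (word K X P) = ((deletions s X).map fun Y => word K Y P).sum := by
  have h : MvPolynomial.pderiv s (X.map (MvPolynomial.X (R := K))).prod =
      ((deletions s X).map fun Y => (Y.map (MvPolynomial.X (R := K))).prod).sum := by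
    induction X with
    | nil => simp [deletions]
    | cons x X ih =>
      rw [List.map_cons, List.prod_cons, Derivation.leibniz, ih, deletions, MvPolynomial.pderiv_X]
      have h2 : (((deletions s X).map (x :: ·)).map fun Y =>
          (Y.map (MvPolynomial.X (R := K))).prod).sum = MvPolynomial.X x *
          ((deletions s X).map fun Y => (Y.map (MvPolynomial.X (R := K))).prod).sum := by
        rw [List.map_map, ← List.sum_map_mul_left]
        simp [Function.comp_def]
      by_cases hx : x = s
      · subst hx
        rw [if_pos rfl, List.map_cons, List.sum_cons, h2]
        simp [add_comm]
      · rw [if_neg hx, h2]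
        simp [hx]
  rw [partialX, word, LinearMap.rTensor_tmul,
    show (MvPolynomial.pderiv s).toLinearMap _ = _ from h, ← TensorProduct.mk_apply,
    ← LinearMap.flip_apply, map_list_sum, List.map_map]
  rfl

/-- `deletions` with the sign of the move to the front. -/
def signedDeletions (s : σ) : List σ → List (ℤ × List σ)
  | [] => []
  | x :: X => if x = s then (1, X) :: (signedDeletions s X).map (fun t => (-t.1, x :: t.2))
      else (signedDeletions s X).map fun t => (-t.1, x :: t.2)

theorem contractLeft_prod (s : σ) (P : List σ) :
    CliffordAlgebra.contractLeft (Q := 0) (Finsupp.lapply s)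
      (P.map fun s => ExteriorAlgebra.ι K (Finsupp.single s (1 : K))).prod =
    ((signedDeletions s P).map fun t => (t.1 : K) •
      (t.2.map fun s => ExteriorAlgebra.ι K (Finsupp.single s (1 : K))).prod).sum := by
  induction P with
  | nil => simp [signedDeletions, CliffordAlgebra.contractLeft_one]
  | cons x P ih =>
    rw [List.map_cons, List.prod_cons, signedDeletions]
    refine (CliffordAlgebra.contractLeft_ι_mul _ _ _).trans ?_
    rw [ih]
    have h2 : (((signedDeletions s P).map (fun t => (-t.1, x :: t.2))).map fun t => (t.1 : K) •
        (t.2.map fun s => ExteriorAlgebra.ι K (Finsupp.single s (1 : K))).prod).sum =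
        - (ExteriorAlgebra.ι K (Finsupp.single x (1 : K)) *
        ((signedDeletions s P).map fun t => (t.1 : K) •
          (t.2.map fun s => ExteriorAlgebra.ι K (Finsupp.single s (1 : K))).prod).sum) := by
      rw [List.map_map, ← List.sum_map_mul_left, ← neg_one_smul K, List.smul_sum, List.map_map]
      simp [Function.comp_def]
    have h3 : (Finsupp.lapply s : (σ →₀ K) →ₗ[K] K) (Finsupp.single x 1) =
        if x = s then 1 else 0 := by
      simp [Finsupp.single_apply]
    rw [h3]
    by_cases hx : x = s
    · rw [if_pos hx, if_pos hx, List.map_cons, List.sum_cons, h2, sub_eq_add_neg]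
      simp
    · rw [if_neg hx, if_neg hx, h2, zero_smul, zero_sub]

theorem partialP_word (s : σ) (X P : List σ) :
    partialP s (word K X P) =
      ((signedDeletions s P).map fun t => (t.1 : K) • word K X t.2).sum := by
  rw [partialP, word, LinearMap.lTensor_tmul, contractLeft_prod, ← TensorProduct.mk_apply,
    map_list_sum, List.map_map]
  simp [Function.comp_def, word]

end

theorem partialX_partialX (s t : σ) (u : SuperPoly K σ) :
    partialX s (partialX t u) = partialX t (partialX s u) := by
  induction u using TensorProduct.induction_on with
  | zero => simp
  | tmul a b =>
    simp only [partialX, LinearMap.rTensor_tmul]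
    congr 1
    have h : ⁅MvPolynomial.pderiv (R := K) s, MvPolynomial.pderiv (R := K) t⁆ = 0 := by
      classical
      refine MvPolynomial.derivation_ext fun i => ?_
      simp only [Derivation.commutator_apply, MvPolynomial.pderiv_X, Pi.single_apply]
      split_ifs <;> simp
    exact sub_eq_zero.1 (Derivation.congr_fun h a)
  | add u v hu hv => simp only [map_add, hu, hv]

theorem partialP_partialP (s t : σ) (u : SuperPoly K σ) :
    partialP s (partialP t u) = - partialP t (partialP s u) := by
  induction u using TensorProduct.induction_on with
  | zero => simp
  | tmul a b =>
    simp only [partialP, LinearMap.lTensor_tmul]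
    rw [← TensorProduct.tmul_neg]
    congr 1
    exact CliffordAlgebra.contractLeft_comm _ _ _
  | add u v hu hv => simp only [map_add, hu, hv, neg_add]

theorem partialP_partialX (s t : σ) (u : SuperPoly K σ) :
    partialP s (partialX t u) = partialX t (partialP s u) := by
  induction u using TensorProduct.induction_on with
  | zero => simp
  | tmul a b => rfl
  | add u v hu hv => simp only [map_add, hu, hv]

/-- Derivatives with respect to `x` commute with everything, those with respect to `p` anticommute
with each other; so an edge is an odd operator. -/
theorem edgeOperator_anticomm (d : ℕ) (e f : Edge) (u : SuperPoly K (Vertex × Fin d)) :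
    edgeOperator K d e (edgeOperator K d f u) = - edgeOperator K d f (edgeOperator K d e u) := by
  simp only [edgeOperator, LinearMap.sum_apply, LinearMap.comp_apply, map_sum]
  rw [Finset.sum_comm, ← Finset.sum_neg_distrib]
  refine Finset.sum_congr rfl fun k _ => ?_
  rw [← Finset.sum_neg_distrib]
  refine Finset.sum_congr rfl fun l _ => ?_
  rw [← partialP_partialX, partialX_partialX, partialP_partialP, partialP_partialX]

section

variable {d : ℕ}

/-- The ways of removing a letter at the vertex `a`, with sign. -/
def picks (a : Vertex) : List (Vertex × Fin d) → List (ℤ × Fin d × List (Vertex × Fin d))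
  | [] => []
  | p :: P => if p.1 = a then (1, p.2, P) :: (picks a P).map (fun t => (-t.1, t.2.1, p :: t.2.2))
      else (picks a P).map fun t => (-t.1, t.2.1, p :: t.2.2)

/-- The operator of the edge `e` on formal sums of words. -/
def WordSum.contract (e : Edge) (F : WordSum (Vertex × Fin d)) : WordSum (Vertex × Fin d) :=
  F.flatMap fun w => (picks e.1 w.2.2).flatMap fun t =>
    (deletions (e.2, t.2.1) w.2.1).map fun Y => (w.1 * t.1, Y, t.2.2)

/-- In `∑_l ∂/∂p^l ⊗ ∂/∂x_l` only those indices `l` matter that occur at the source vertex. The sum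
over `l` becomes a single pass through the letters of the word. -/
theorem sum_picks {M : Type*} [AddCommGroup M] (a : Vertex) (P : List (Vertex × Fin d))
    (g : ℤ → Fin d → List (Vertex × Fin d) → M) :
    ((picks a P).map fun t => g t.1 t.2.1 t.2.2).sum =
      ∑ l, ((signedDeletions (a, l) P).map fun t => g t.1 l t.2).sum := by
  induction P generalizing g with
  | nil => simp [picks, signedDeletions]
  | cons p P ih =>
    have h := ih fun c l Q => g (-c) l (p :: Q)
    have h2 : ∀ l, ((signedDeletions (a, l) (p :: P)).map fun t => g t.1 l t.2).sum =
        (if l = p.2 then (if p.1 = a then g 1 l P else 0) else 0) +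
          ((signedDeletions (a, l) P).map fun t => g (-t.1) l (p :: t.2)).sum := by
      intro l
      rw [signedDeletions]
      by_cases h1 : p = (a, l)
      · subst h1
        simp [Function.comp_def]
      · rw [if_neg h1, List.map_map]
        have : (if l = p.2 then (if p.1 = a then g 1 l P else 0) else 0) = 0 := by
          split_ifs with h3 h4
          · exact absurd (Prod.ext h4 h3.symm) h1
          · rfl
          · rfl
        rw [this, zero_add]
        rfl
    simp only [h2]
    rw [Finset.sum_add_distrib, ← h, Finset.sum_ite_eq' , if_pos (Finset.mem_univ _), picks]
    split_ifs with h3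
    · simp [Function.comp_def]
    · simp [Function.comp_def]

theorem list_sum_comm {M α β : Type*} [AddCommMonoid M] (l : List α) (l' : List β) (f : α → β → M) :
    (l.map fun a => (l'.map fun b => f a b).sum).sum =
      (l'.map fun b => (l.map fun a => f a b).sum).sum := by
  induction l with
  | nil => simp
  | cons a l ih => simp [ih, List.sum_map_add]

theorem WordSum.eval_contract (e : Edge) (F : WordSum (Vertex × Fin d)) :
    WordSum.eval K (F.contract e) = edgeOperator K d e (WordSum.eval K F) := by
  rw [WordSum.contract, WordSum.eval_flatMap]
  conv_rhs => rw [WordSum.eval, map_list_sum, List.map_map]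
  congr 1
  refine List.map_congr_left fun w _ => ?_
  rw [Function.comp_apply, map_smul, WordSum.eval_flatMap]
  simp only [WordSum.eval, List.map_map, Function.comp_def]
  have h := sum_picks e.1 w.2.2 fun c l Q => (List.map (fun Y => ((w.1 * c : ℤ) : K) • word K Y Q)
    (deletions (e.2, l) w.2.1)).sum
  rw [h, edgeOperator, LinearMap.sum_apply, Finset.smul_sum]
  refine Finset.sum_congr rfl fun l _ => ?_
  rw [LinearMap.comp_apply, partialX_word, map_list_sum, List.map_map]
  simp only [Function.comp_def, partialP_word]
  rw [list_sum_comm, List.smul_sum, List.map_map]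
  simp [Function.comp_def, List.smul_sum, mul_smul]

/-- The argument of the product of the operators of the edges: `m` bivectors `F` and the words
`fs 0, fs 1, …`. -/
def initialWords (F : WordSum (Fin d)) (fs : ℕ → List (Fin d) × List (Fin d)) (n m : ℕ) :
    WordSum (Vertex × Fin d) :=
  WordSum.mul
    (((List.range m).map fun k => WordSum.map (fun l : Fin d => (Vertex.int (k + 1), l)) F).foldr
      WordSum.mul [(1, [], [])])
    [(1, (List.range n).flatMap fun i => (fs i).1.map fun l => (Vertex.ext (i + 1), l),
      (List.range n).flatMap fun i => (fs i).2.map fun l => (Vertex.ext (i + 1), l))]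

/-- `graphOperator` on words. -/
def graphWords (F : WordSum (Fin d)) (fs : ℕ → List (Fin d) × List (Fin d)) (n m : ℕ)
    (E : List Edge) : WordSum (Fin d) :=
  WordSum.map Prod.snd (E.foldl (fun t e => t.contract e) (initialWords F fs n m))

theorem WordSum.eval_foldr_mul (L : List (WordSum σ)) :
    WordSum.eval K (L.foldr WordSum.mul [(1, [], [])]) = (L.map (WordSum.eval K)).prod := by
  induction L with
  | nil => simp [WordSum.eval, word]; rfl
  | cons F L ih => rw [List.foldr_cons, WordSum.eval_mul, ih, List.map_cons, List.prod_cons]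

theorem prod_words (L : List (List σ × List σ)) :
    (L.map fun w => word K w.1 w.2).prod = word K (L.flatMap Prod.fst) (L.flatMap Prod.snd) := by
  induction L with
  | nil => simp [word]; rfl
  | cons w L ih => rw [List.map_cons, List.prod_cons, ih, word_mul]; rfl

theorem ofFn_eq_map_range {α : Type*} (n : ℕ) (g : ℕ → α) :
    (List.ofFn fun i : Fin n => g i) = (List.range n).map g := by
  refine List.ext_getElem (by simp) fun i h1 h2 => by simp

theorem eval_initialWords (F : WordSum (Fin d)) (fs : ℕ → List (Fin d) × List (Fin d)) (n m : ℕ) :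
    WordSum.eval K (initialWords F fs n m) =
      ((List.range m).map fun k =>
        superMap (K := K) (fun l : Fin d => (Vertex.int (k + 1), l)) (WordSum.eval K F)).prod *
      (List.ofFn fun i : Fin n => superMap (K := K) (fun l : Fin d => (Vertex.ext (i + 1), l))
        (word K (fs i).1 (fs i).2)).prod := by
  rw [initialWords, WordSum.eval_mul, WordSum.eval_foldr_mul, List.map_map]
  congr 1
  · simp only [Function.comp_def, WordSum.eval_map]
  · rw [ofFn_eq_map_range n fun i => superMap (K := K) (fun l : Fin d => (Vertex.ext (i + 1), l))
        (word K (fs i).1 (fs i).2)]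
    simp only [superMap_word]
    have h := prod_words (K := K) ((List.range n).map fun i =>
      ((fs i).1.map fun l => (Vertex.ext (i + 1), l),
        (fs i).2.map fun l => (Vertex.ext (i + 1), l)))
    rw [List.map_map, List.flatMap_map, List.flatMap_map] at h
    simp only [Function.comp_def] at h
    rw [h]
    simp [WordSum.eval]

variable {L : Type*} [LieRing L] [LieAlgebra K L]

/-- If `π` is an integral combination of words, the action of a graph on words is a computation with
lists of integers and letters, independent of the field. -/
theorem graphOperator_eq_eval (x : Module.Basis (Fin d) K L) {F : WordSum (Fin d)}
    (hF : bivector x = WordSum.eval K F) (fs : ℕ → List (Fin d) × List (Fin d)) (n m : ℕ)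
    (E : List Edge) :
    graphOperator x n m E (fun i => word K (fs i).1 (fs i).2) =
      WordSum.eval K (graphWords F fs n m E) := by
  have h : ∀ (E : List Edge) (G : WordSum (Vertex × Fin d)),
      E.foldl (fun t e => edgeOperator K d e t) (WordSum.eval K G) =
        WordSum.eval K (E.foldl (fun t e => t.contract e) G) := by
    intro E
    induction E with
    | nil => exact fun _ => rfl
    | cons e E ih => intro G; rw [List.foldl_cons, List.foldl_cons, ← WordSum.eval_contract, ih]
  rw [graphOperator, hF, ← eval_initialWords, h, ← WordSum.eval_map]
  rfl

/-- Transposing neighbouring edges changes the sign because their operators anticommute and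
everything applied afterwards is linear. -/
theorem graphOperator_order (x : Module.Basis (Fin d) K L) (n m : ℕ)
    (f : Fin n → SuperPoly K (Fin d)) (l₁ l₂ : List Edge) (e e' : Edge) :
    graphOperator x n m (l₁ ++ e :: e' :: l₂) f +
      graphOperator x n m (l₁ ++ e' :: e :: l₂) f = 0 := by
  have h : ∀ (E : List Edge) (u : SuperPoly K (Vertex × Fin d)),
      E.foldl (fun t e => edgeOperator K d e t) (-u) =
        - E.foldl (fun t e => edgeOperator K d e t) u := by
    intro E
    induction E with
    | nil => exact fun _ => rfl
    | cons e E ih => intro u; rw [List.foldl_cons, List.foldl_cons, map_neg, ih]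
  rw [graphOperator, graphOperator, List.foldl_append, List.foldl_append, List.foldl_cons,
    List.foldl_cons, List.foldl_cons, List.foldl_cons, edgeOperator_anticomm, h, map_neg,
    neg_add_cancel]

end

end

/-! ## Functionals on the superalgebra -/

section

variable {K : Type*} [Field K] {σ : Type*}

/-- The iterated contraction with the letters of `Q`, followed by the augmentation. -/
noncomputable def contraction (K : Type*) [Field K] :
    List σ → (ExteriorAlgebra K (σ →₀ K) →ₗ[K] K)
  | [] => (ExteriorAlgebra.algebraMapInv (R := K) (M := σ →₀ K)).toLinearMap
  | q :: Q => contraction K Q ∘ₗ CliffordAlgebra.contractLeft (Q := 0) (Finsupp.lapply q)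

variable [DecidableEq σ]

/-- The coefficient of the monomial `X`, followed by the iterated contraction with `Q`. -/
noncomputable def wordFunctional (K : Type*) [Field K] (X Q : List σ) : SuperPoly K σ →ₗ[K] K :=
  LinearMap.mul' K K ∘ₗ TensorProduct.map
    (MvPolynomial.lcoeff K (Multiset.toFinsupp (X : Multiset σ))) (contraction K Q)

/-- `contraction` on words. -/
def contractWord : List σ → List σ → ℤ
  | [], P => if P.isEmpty then 1 else 0
  | q :: Q, P => ((signedDeletions q P).map fun t => t.1 * contractWord Q t.2).sum

theorem contraction_word (Q P : List σ) :
    contraction K Q (P.map fun s => ExteriorAlgebra.ι K (Finsupp.single s (1 : K))).prod =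
      contractWord Q P := by
  induction Q generalizing P with
  | nil =>
    cases P with
    | nil => simp [contraction, contractWord]
    | cons p P => simp [contraction, contractWord, ExteriorAlgebra.algebraMapInv]
  | cons q Q ih =>
    rw [contraction, LinearMap.comp_apply, contractLeft_prod, map_list_sum, List.map_map,
      contractWord]
    simp [Function.comp_def, ih, Int.cast_list_sum]

theorem wordFunctional_tmul (X Q P : List σ) (z : MvPolynomial σ K) :
    wordFunctional K X Q (z ⊗ₜ (P.map fun s =>
      ExteriorAlgebra.ι K (Finsupp.single s (1 : K))).prod) =
      MvPolynomial.coeff (Multiset.toFinsupp (X : Multiset σ)) z * contractWord Q P := by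
  simp [wordFunctional, contraction_word, MvPolynomial.lcoeff]

/-- `wordFunctional` on words. -/
def pairing (X Q : List σ) (F : WordSum σ) : ℤ :=
  (List.map (fun w : ℤ × List σ × List σ =>
    if w.2.1.isPerm X then w.1 * contractWord Q w.2.2 else 0) F).sum

theorem prod_X (X : List σ) : (X.map (MvPolynomial.X (R := K))).prod =
    MvPolynomial.monomial (Multiset.toFinsupp (X : Multiset σ)) 1 := by
  induction X with
  | nil => simp
  | cons x X ih =>
    rw [List.map_cons, List.prod_cons, ih, ← Multiset.cons_coe, ← Multiset.singleton_add, map_add,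
      Multiset.toFinsupp_singleton, MvPolynomial.X, MvPolynomial.monomial_mul, one_mul]

theorem wordFunctional_eval (X Q : List σ) (F : WordSum σ) :
    wordFunctional K X Q (F.eval K) = pairing X Q F := by
  rw [WordSum.eval, map_list_sum, List.map_map, pairing, Int.cast_list_sum, List.map_map]
  congr 1
  refine List.map_congr_left fun w _ => ?_
  simp only [Function.comp_apply, map_smul, word, wordFunctional_tmul, prod_X,
    MvPolynomial.coeff_monomial, EmbeddingLike.apply_eq_iff_eq, Multiset.coe_eq_coe,
    ← List.isPerm_iff]
  split_ifs <;> simp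

theorem length_of_mem_deletions {s : σ} {X Y : List σ} (h : Y ∈ deletions s X) :
    Y.length + 1 = X.length := by
  induction X generalizing Y with
  | nil => simp [deletions] at h
  | cons x X ih =>
    have h2 : ∀ Y ∈ (deletions s X).map (x :: ·), Y.length + 1 = (x :: X).length := by
      intro Y hY
      obtain ⟨Z, hZ, rfl⟩ := List.mem_map.1 hY
      simp [ih hZ]
    rw [deletions] at h
    split_ifs at h
    · rcases List.mem_cons.1 h with rfl | h
      · simp
      · exact h2 _ h
    · exact h2 _ h

theorem length_of_mem_signedDeletions {s : σ} {P : List σ} {t : ℤ × List σ}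
    (h : t ∈ signedDeletions s P) : t.2.length + 1 = P.length := by
  induction P generalizing t with
  | nil => simp [signedDeletions] at h
  | cons x X ih =>
    have h2 : ∀ t ∈ (signedDeletions s X).map (fun t => (-t.1, x :: t.2)),
        t.2.length + 1 = (x :: X).length := by
      intro t ht
      obtain ⟨Z, hZ, rfl⟩ := List.mem_map.1 ht
      simp [ih hZ]
    rw [signedDeletions] at h
    split_ifs at h
    · rcases List.mem_cons.1 h with rfl | h
      · simp
      · exact h2 _ h
    · exact h2 _ h

theorem contractWord_eq_zero {Q P : List σ} (h : Q.length ≠ P.length) : contractWord Q P = 0 := by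
  induction Q generalizing P with
  | nil =>
    cases P with
    | nil => exact absurd rfl h
    | cons => rfl
  | cons q Q ih =>
    rw [contractWord]
    refine List.sum_eq_zero fun x hx => ?_
    obtain ⟨t, ht, rfl⟩ := List.mem_map.1 hx
    have := length_of_mem_signedDeletions ht
    rw [ih (by simp at h; omega), mul_zero]

theorem pairing_eq_zero {X Q : List σ} {F : WordSum σ}
    (h : ∀ w ∈ F, w.2.1.length ≠ X.length ∨ w.2.2.length ≠ Q.length) : pairing X Q F = 0 := by
  refine List.sum_eq_zero fun x hx => ?_
  obtain ⟨w, hw, rfl⟩ := List.mem_map.1 hx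
  split_ifs with hp
  · rcases h w hw with h | h
    · exact absurd (List.isPerm_iff.1 hp).length_eq h
    · rw [contractWord_eq_zero (Ne.symm h), mul_zero]
  · rfl

end

/-! ### Counting letters: which graphs and which words can contribute to a pairing. -/

section

variable {K : Type*} [Field K] {d : ℕ}

theorem length_of_mem_picks {a : Vertex} {P : List (Vertex × Fin d)}
    {t : ℤ × Fin d × List (Vertex × Fin d)} (h : t ∈ picks a P) : t.2.2.length + 1 = P.length := by
  induction P generalizing t with
  | nil => simp [picks] at h
  | cons x X ih =>
    have h2 : ∀ t ∈ (picks a X).map (fun t => (-t.1, t.2.1, x :: t.2.2)),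
        t.2.2.length + 1 = (x :: X).length := by
      intro t ht
      obtain ⟨Z, hZ, rfl⟩ := List.mem_map.1 ht
      simp [ih hZ]
    rw [picks] at h
    split_ifs at h
    · rcases List.mem_cons.1 h with rfl | h
      · simp
      · exact h2 _ h
    · exact h2 _ h

/-- The words of `F` have `a` letters `x` and `b` letters `p`. -/
def WordSum.HasLength {σ : Type*} (F : WordSum σ) (a b : ℕ) : Prop :=
  ∀ w ∈ F, w.2.1.length = a ∧ w.2.2.length = b

theorem WordSum.HasLength.mul {σ : Type*} {F G : WordSum σ} {a b a' b' : ℕ} (hF : F.HasLength a b)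
    (hG : G.HasLength a' b') : (F.mul G).HasLength (a + a') (b + b') := by
  intro w hw
  simp only [WordSum.mul, List.mem_flatMap, List.mem_map] at hw
  obtain ⟨v, hv, u, hu, rfl⟩ := hw
  simp [hF v hv, hG u hu]

theorem WordSum.HasLength.map {σ τ : Type*} {F : WordSum σ} {a b : ℕ} (hF : F.HasLength a b)
    (g : σ → τ) : (WordSum.map g F).HasLength a b := by
  intro w hw
  obtain ⟨v, hv, rfl⟩ := List.mem_map.1 hw
  simp [hF v hv]

theorem foldl_contract_nil (E : List Edge) :
    E.foldl (fun (t : WordSum (Vertex × Fin d)) e => t.contract e) [] = [] := by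
  induction E with
  | nil => rfl
  | cons e E ih => exact ih

theorem length_foldl_contract {E : List Edge} {F : WordSum (Vertex × Fin d)} {a b : ℕ}
    (hF : ∀ w ∈ F, w.2.1.length = a ∧ w.2.2.length = b) :
    ∀ w ∈ E.foldl (fun t e => t.contract e) F,
      w.2.1.length + E.length = a ∧ w.2.2.length + E.length = b := by
  induction E generalizing F a b with
  | nil => exact hF
  | cons e E ih =>
    rw [List.foldl_cons]
    intro w hw
    -- If no letter `x`, or below no letter `p`, is left, no contraction is possible and the sum is
    -- empty; these cases are split off because lengths are natural numbers.
    rcases a with _ | a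
    · exfalso
      have : F.contract e = [] := by
        refine List.eq_nil_iff_forall_not_mem.2 fun v hv => ?_
        simp only [WordSum.contract, List.mem_flatMap, List.mem_map] at hv
        obtain ⟨u, hu, t, ht, Y, hY, rfl⟩ := hv
        have := length_of_mem_deletions hY
        have := (hF u hu).1
        omega
      rw [this, foldl_contract_nil] at hw
      simp at hw
    rcases b with _ | b
    · exfalso
      have : F.contract e = [] := by
        refine List.eq_nil_iff_forall_not_mem.2 fun v hv => ?_
        simp only [WordSum.contract, List.mem_flatMap, List.mem_map] at hv
        obtain ⟨u, hu, t, ht, Y, hY, rfl⟩ := hv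
        have := length_of_mem_picks ht
        have := (hF u hu).2
        omega
      rw [this, foldl_contract_nil] at hw
      simp at hw
    have h1 : ∀ v ∈ F.contract e, v.2.1.length = a ∧ v.2.2.length = b := by
      intro v hv
      simp only [WordSum.contract, List.mem_flatMap, List.mem_map] at hv
      obtain ⟨u, hu, t, ht, Y, hY, rfl⟩ := hv
      have h2 := length_of_mem_deletions hY
      have h3 := length_of_mem_picks ht
      have h4 := hF u hu
      dsimp only
      omega
    have h2 := ih h1 w hw
    rw [List.length_cons]
    omega

/-- The number of letters `x` in the arguments. -/
def argLength (n : ℕ) (fs : ℕ → List (Fin d) × List (Fin d)) : ℕ :=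
  ((List.range n).map fun i => (fs i).1.length).sum

/-- The number of letters `p` in the arguments. -/
def argLength' (n : ℕ) (fs : ℕ → List (Fin d) × List (Fin d)) : ℕ :=
  ((List.range n).map fun i => (fs i).2.length).sum

theorem initialWords_hasLength {F : WordSum (Fin d)} (hF : F.HasLength 1 2)
    (fs : ℕ → List (Fin d) × List (Fin d)) (n m : ℕ) :
    (initialWords F fs n m).HasLength (m + argLength n fs) (2 * m + argLength' n fs) := by
  refine WordSum.HasLength.mul ?_ ?_
  · generalize hr : List.range m = r
    have : m = r.length := by rw [← hr, List.length_range]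
    rw [this]
    clear hr this
    induction r with
    | nil =>
      intro w hw
      rw [List.map_nil, List.foldr_nil, List.mem_singleton] at hw
      simp [hw]
    | cons k r ih =>
      have h := (hF.map fun l : Fin d => (Vertex.int (k + 1), l)).mul ih
      rw [List.map_cons, List.foldr_cons, List.length_cons]
      convert h using 1 <;> ring
  · intro w hw
    rw [List.mem_singleton] at hw
    simp [hw, argLength, argLength', List.length_flatMap]

/-- The pairing of `graphWords` with a word. -/
def graphPairing (F : WordSum (Fin d)) (fs : ℕ → List (Fin d) × List (Fin d))
    (X Q : List (Fin d)) (n m : ℕ) (E : List Edge) : ℤ :=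
  pairing X Q (graphWords F fs n m E)

/-- Each bivector contributes one letter `x` and two letters `p`, and each edge removes one of
either kind. -/
theorem graphPairing_eq_zero {F : WordSum (Fin d)} (hF : F.HasLength 1 2)
    {fs : ℕ → List (Fin d) × List (Fin d)} {X Q : List (Fin d)} {n m : ℕ} {E : List Edge}
    (h : m + argLength n fs ≠ X.length + E.length ∨ 2 * m + argLength' n fs ≠ Q.length + E.length) :
    graphPairing F fs X Q n m E = 0 := by
  refine pairing_eq_zero fun w hw => ?_
  obtain ⟨v, hv, rfl⟩ := List.mem_map.1 hw
  have := length_foldl_contract (initialWords_hasLength hF fs n m) v hv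
  simp only [List.length_map]
  omega

theorem sum_of_mem_deletions {σ : Type*} [DecidableEq σ] (f : σ → ℕ) {s : σ} {X Y : List σ}
    (h : Y ∈ deletions s X) : (X.map f).sum = f s + (Y.map f).sum := by
  induction X generalizing Y with
  | nil => simp [deletions] at h
  | cons x X ih =>
    have h2 : ∀ Y ∈ (deletions s X).map (x :: ·), ((x :: X).map f).sum = f s + (Y.map f).sum := by
      intro Y hY
      obtain ⟨Z, hZ, rfl⟩ := List.mem_map.1 hY
      simp [ih hZ, add_left_comm]
    rw [deletions] at h
    split_ifs at h with hx
    · rcases List.mem_cons.1 h with rfl | h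
      · simp [hx]
      · exact h2 _ h
    · exact h2 _ h

theorem sum_of_mem_signedDeletions {σ : Type*} [DecidableEq σ] (f : σ → ℕ) {s : σ} {P : List σ}
    {t : ℤ × List σ} (h : t ∈ signedDeletions s P) : (P.map f).sum = f s + (t.2.map f).sum := by
  induction P generalizing t with
  | nil => simp [signedDeletions] at h
  | cons x X ih =>
    have h2 : ∀ t ∈ (signedDeletions s X).map (fun t => (-t.1, x :: t.2)),
        ((x :: X).map f).sum = f s + (t.2.map f).sum := by
      intro t ht
      obtain ⟨Z, hZ, rfl⟩ := List.mem_map.1 ht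
      simp [ih hZ, add_left_comm]
    rw [signedDeletions] at h
    split_ifs at h with hx
    · rcases List.mem_cons.1 h with rfl | h
      · simp [hx]
      · exact h2 _ h
    · exact h2 _ h

theorem sum_of_mem_picks (f : Fin d → ℕ) {a : Vertex} {P : List (Vertex × Fin d)}
    {t : ℤ × Fin d × List (Vertex × Fin d)} (h : t ∈ picks a P) :
    (P.map fun p => f p.2).sum = f t.2.1 + (t.2.2.map fun p => f p.2).sum := by
  induction P generalizing t with
  | nil => simp [picks] at h
  | cons x X ih =>
    have h2 : ∀ t ∈ (picks a X).map (fun t => (-t.1, t.2.1, x :: t.2.2)),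
        ((x :: X).map fun p => f p.2).sum = f t.2.1 + (t.2.2.map fun p => f p.2).sum := by
      intro t ht
      obtain ⟨Z, hZ, rfl⟩ := List.mem_map.1 ht
      simp [ih hZ, add_left_comm]
    rw [picks] at h
    split_ifs at h with hx
    · rcases List.mem_cons.1 h with rfl | h
      · simp
      · exact h2 _ h
    · exact h2 _ h

/-- A contraction that does not vanish matches the letters of the two lists one by one, so every
additive weight agrees on them. -/
theorem sum_eq_of_contractWord_ne_zero {σ : Type*} [DecidableEq σ] (f : σ → ℕ) {Q P : List σ}
    (h : contractWord Q P ≠ 0) : (Q.map f).sum = (P.map f).sum := by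
  induction Q generalizing P with
  | nil =>
    cases P with
    | nil => rfl
    | cons => exact absurd rfl h
  | cons q Q ih =>
    rw [contractWord] at h
    obtain ⟨x, hx, hx0⟩ : ∃ x ∈ (signedDeletions q P).map (fun t => t.1 * contractWord Q t.2),
        x ≠ 0 := by
      by_contra! h'
      exact h (List.sum_eq_zero h')
    obtain ⟨t, ht, rfl⟩ := List.mem_map.1 hx
    rw [sum_of_mem_signedDeletions f ht, ← ih (right_ne_zero_of_mul hx0), List.map_cons,
      List.sum_cons]

/-- A necessary condition for a word to contribute to the pairing with `X` and `Q`: every letter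
occurs equally often on both sides. -/
def isBalanced (X Q : List (Fin d)) (w : ℤ × List (Vertex × Fin d) × List (Vertex × Fin d))  :
    Bool :=
  Nat.beq ((w.2.1.map fun p => 32 ^ p.2.val).sum + (Q.map fun l => 32 ^ l.val).sum)
    ((w.2.2.map fun p => 32 ^ p.2.val).sum + (X.map fun l => 32 ^ l.val).sum)

/-- An edge removes a letter `x` and a letter `p` with the same index, which lowers both sides of
the balance by the same amount. Coincidences between different multisets of letters are harmless,
since balance is only used as a necessary condition. -/
theorem isBalanced_of_mem_contract {X Q : List (Fin d)} {e : Edge}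
    {w v : ℤ × List (Vertex × Fin d) × List (Vertex × Fin d)} (hv : v ∈ WordSum.contract e [w])
    (h : isBalanced X Q v = true) : isBalanced X Q w = true := by
  simp only [WordSum.contract, List.mem_flatMap, List.mem_map, List.mem_singleton] at hv
  obtain ⟨u, rfl, t, ht, Y, hY, rfl⟩ := hv
  rw [isBalanced, Nat.beq_eq] at h ⊢
  rw [sum_of_mem_deletions (fun p : Vertex × Fin d => 32 ^ p.2.val) hY,
    sum_of_mem_picks (fun l => 32 ^ l.val) ht]
  dsimp only at h ⊢
  omega

theorem foldl_contract_flatMap (E : List Edge) (F : WordSum (Vertex × Fin d)) :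
    E.foldl (fun t e => t.contract e) F =
      F.flatMap fun w => E.foldl (fun t e => WordSum.contract e t) [w] := by
  induction E generalizing F with
  | nil => simp
  | cons e E ih =>
    simp only [List.foldl_cons]
    rw [ih]
    simp only [ih (WordSum.contract e [_])]
    rw [← List.flatMap_assoc]
    congr 1
    rw [WordSum.contract]
    refine List.flatMap_congr fun w _ => ?_
    rw [WordSum.contract, List.flatMap_singleton]

theorem pairing_flatMap {ι : Type*} (X Q : List (Fin d)) (l : List ι)
    (f : ι → WordSum (Vertex × Fin d)) : pairing X Q (WordSum.map Prod.snd (l.flatMap f)) =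
      (l.map fun i => pairing X Q (WordSum.map Prod.snd (f i))).sum := by
  induction l with
  | nil => rfl
  | cons i l ih =>
    rw [List.map_cons, List.sum_cons, ← ih, List.flatMap_cons]
    simp [pairing, WordSum.map]

/-- Imbalance persists along the edges; at the end, a non-zero pairing would require the `x` letters
to match `X` and the `p` letters to match `Q`, that is, balance. -/
theorem pairing_eq_zero_of_not_isBalanced {X Q : List (Fin d)} (E : List Edge)
    {w : ℤ × List (Vertex × Fin d) × List (Vertex × Fin d)} (h : isBalanced X Q w = false) :
    pairing X Q (WordSum.map Prod.snd (E.foldl (fun t e => WordSum.contract e t) [w])) = 0 := by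
  induction E generalizing w with
  | nil =>
    simp only [List.foldl_nil, WordSum.map, pairing, List.map_cons, List.map_nil, List.sum_cons,
      List.sum_nil, add_zero]
    split_ifs with hp
    · by_contra hne
      rw [← Bool.not_eq_true] at h
      refine h ?_
      have h1 := ((List.isPerm_iff.1 hp).map fun l => 32 ^ l.val).sum_eq
      have h2 := sum_eq_of_contractWord_ne_zero (fun l : Fin d => 32 ^ l.val)
        (right_ne_zero_of_mul hne)
      rw [List.map_map] at h1 h2
      rw [isBalanced, Nat.beq_eq]
      rw [show (fun p : Vertex × Fin d => 32 ^ p.2.val) = (fun l : Fin d => 32 ^ l.val) ∘ Prod.snd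
        from rfl, h1, h2, add_comm]
    · rfl
  | cons e E ih =>
    rw [List.foldl_cons, foldl_contract_flatMap, pairing_flatMap]
    refine List.sum_eq_zero fun x hx => ?_
    obtain ⟨v, hv, rfl⟩ := List.mem_map.1 hx
    refine ih ?_
    rw [← Bool.not_eq_true] at h ⊢
    exact fun h' => h (isBalanced_of_mem_contract hv h')

/-- `graphPairing`, without the words that cannot contribute. -/
def balancedPairing (F : WordSum (Fin d)) (fs : ℕ → List (Fin d) × List (Fin d))
    (X Q : List (Fin d)) (n m : ℕ) (E : List Edge) : ℤ :=
  pairing X Q (WordSum.map Prod.snd (E.foldl (fun t e => t.contract e)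
    ((initialWords F fs n m).filter (isBalanced X Q))))

/-- Contraction is linear, so unbalanced words may be discarded before any edge is applied. This
keeps the evaluation of the tests small. -/
theorem balancedPairing_eq (F : WordSum (Fin d)) (fs : ℕ → List (Fin d) × List (Fin d))
    (X Q : List (Fin d)) (n m : ℕ) (E : List Edge) :
    balancedPairing F fs X Q n m E = graphPairing F fs X Q n m E := by
  rw [balancedPairing, graphPairing, graphWords, foldl_contract_flatMap, pairing_flatMap,
    foldl_contract_flatMap E (initialWords F fs n m), pairing_flatMap]
  induction initialWords F fs n m with
  | nil => rfl
  | cons w F ih =>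
    rw [List.filter_cons]
    split_ifs with h
    · rw [List.map_cons, List.sum_cons, ih, List.map_cons, List.sum_cons]
    · rw [ih, List.map_cons, List.sum_cons,
        pairing_eq_zero_of_not_isBalanced E (Bool.not_eq_true _ ▸ h), zero_add]

theorem picks_map {g : Vertex → Vertex} (hg : Function.Injective g) (a : Vertex)
    (P : List (Vertex × Fin d)) : picks (g a) (P.map (Prod.map g id)) =
      (picks a P).map fun t => (t.1, t.2.1, t.2.2.map (Prod.map g id)) := by
  induction P with
  | nil => rfl
  | cons p P ih =>
    rw [List.map_cons, picks, picks, ih]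
    simp only [Prod.map_fst, hg.eq_iff]
    split_ifs <;> simp [Function.comp_def, Prod.map]

theorem deletions_map {σ τ : Type*} [DecidableEq σ] [DecidableEq τ] {g : σ → τ}
    (hg : Function.Injective g) (s : σ) (X : List σ) :
    deletions (g s) (X.map g) = (deletions s X).map (List.map g) := by
  induction X with
  | nil => rfl
  | cons x X ih =>
    rw [List.map_cons, deletions, deletions, ih]
    simp only [hg.eq_iff]
    split_ifs <;> simp [Function.comp_def]

theorem contract_map {g : Vertex → Vertex} (hg : Function.Injective g) (e : Edge)
    (F : WordSum (Vertex × Fin d)) :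
    (WordSum.map (Prod.map g id) F).contract (Prod.map g g e) =
      WordSum.map (Prod.map g id) (F.contract e) := by
  have hg' : Function.Injective (Prod.map g (id : Fin d → Fin d)) :=
    hg.prodMap Function.injective_id
  simp only [WordSum.contract, WordSum.map, List.flatMap_map, List.map_flatMap, List.map_map,
    Prod.map_fst, Prod.map_snd, picks_map hg]
  refine List.flatMap_congr fun w _ => List.flatMap_congr fun t _ => ?_
  rw [show (g e.2, t.2.1) = Prod.map g id (e.2, t.2.1) from rfl, deletions_map hg', List.map_map]
  rfl

variable {L : Type*} [LieRing L] [LieAlgebra K L]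

/-- `π` is quadratic in the odd variables, hence central. -/
theorem commute_bivector {σ : Type*} (x : Module.Basis (Fin d) K L) (g : Fin d → σ)
    (u : SuperPoly K σ) : Commute (superMap (K := K) g (bivector x)) u := by
  have h : ∀ a b : σ →₀ K, ∀ v : ExteriorAlgebra K (σ →₀ K),
      Commute (ExteriorAlgebra.ι K a * ExteriorAlgebra.ι K b) v := by
    intro a b v
    induction v using ExteriorAlgebra.induction with
    | algebraMap r => exact Algebra.commutes' r _ |>.symm
    | ι c =>
      have hs : ∀ a b : σ →₀ K, ExteriorAlgebra.ι K a * ExteriorAlgebra.ι K b =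
          - (ExteriorAlgebra.ι K b * ExteriorAlgebra.ι K a) :=
        fun a b => eq_neg_of_add_eq_zero_left (ExteriorAlgebra.ι_add_mul_swap a b)
      rw [Commute, SemiconjBy, mul_assoc, hs b c, mul_neg, ← mul_assoc, hs a c, neg_mul, neg_neg,
        mul_assoc]
    | mul v w hv hw => exact hv.mul_right hw
    | add v w hv hw => exact hv.add_right hw
  simp only [bivector, map_sum, map_smul]
  refine Commute.sum_left _ _ _ fun i _ => Commute.sum_left _ _ _ fun j _ =>
    Commute.sum_left _ _ _ fun k _ => Commute.smul_left ?_ _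
  induction u using TensorProduct.induction_on with
  | zero => exact Commute.zero_right _
  | tmul z v =>
    rw [Commute, SemiconjBy]
    simp only [superMap, Algebra.TensorProduct.map_tmul, Algebra.TensorProduct.tmul_mul_tmul,
      map_mul, ExteriorAlgebra.map_apply_ι]
    rw [mul_comm z, (h _ _ v).eq]
  | add u v hu hv => exact hu.add_right hv

theorem superMap_superMap {σ τ υ : Type*} (g : τ → υ) (f : σ → τ) (u : SuperPoly K σ) :
    superMap (K := K) g (superMap (K := K) f u) = superMap (K := K) (g ∘ f) u := by
  induction u using TensorProduct.induction_on with
  | zero => simp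
  | tmul z v =>
    simp only [superMap, Algebra.TensorProduct.map_tmul, MvPolynomial.rename_rename]
    congr 1
    rw [← AlgHom.comp_apply, ExteriorAlgebra.map_comp_map]
    congr 2
    ext
    simp [Finsupp.lmapDomain_apply, Finsupp.mapDomain_single]
  | add u v hu hv => simp only [map_add, hu, hv]

/-- Renaming internal vertices permutes the factors `π` of the initial tensor, which commute; the
final multiplication forgets the names of the vertices. -/
theorem graphOperator_relabel (x : Module.Basis (Fin d) K L) {F : WordSum (Fin d)}
    (hF : bivector x = WordSum.eval K F) (fs : ℕ → List (Fin d) × List (Fin d)) {n m : ℕ}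
    {ρ : Equiv.Perm ℕ} (hρ : ∀ k, k = 0 ∨ m < k → ρ k = k) (E : List Edge) :
    graphOperator x n m (mapVertices (relabel ρ) E) (fun i => word K (fs i).1 (fs i).2) =
      graphOperator x n m E (fun i => word K (fs i).1 (fs i).2) := by
  set R := superMap (K := K) (Prod.map (relabel ρ) (id : Fin d → Fin d)) with hR
  have h1 : ∀ (E : List Edge) (G : WordSum (Vertex × Fin d)),
      (mapVertices (relabel ρ) E).foldl (fun t e => edgeOperator K d e t) (R (WordSum.eval K G)) =
        R (E.foldl (fun t e => edgeOperator K d e t) (WordSum.eval K G)) := by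
    intro E
    induction E with
    | nil => exact fun _ => rfl
    | cons e E ih =>
      intro G
      rw [mapVertices, List.map_cons, List.foldl_cons, List.foldl_cons, ← WordSum.eval_contract,
        ← ih, hR, ← WordSum.eval_map, ← WordSum.eval_contract, contract_map (relabel_injective ρ),
        WordSum.eval_map]
      rfl
  have h2 : R (WordSum.eval K (initialWords F fs n m)) =
      WordSum.eval K (initialWords F fs n m) := by
    rw [eval_initialWords, map_mul, map_list_prod, map_list_prod, List.map_map, List.map_ofFn]
    congr 1
    · simp only [Function.comp_def, hR, superMap_superMap, ← hF]
      have h3 : ∀ k, superMap (K := K) (fun l : Fin d => Prod.map (relabel ρ) id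
        (Vertex.int (k + 1), l))
          (bivector x) = superMap (K := K) (fun l : Fin d => (Vertex.int (ρ (k + 1)), l))
            (bivector x) :=
        fun k => rfl
      simp only [h3]
      -- A permutation that fixes `0` and all numbers above `m` permutes `1, …, m`.
      have h4 : ((List.range m).map fun k => ρ (k + 1)).Perm
        ((List.range m).map fun k => k + 1) := by
        refine (List.perm_ext_iff_of_nodup ?_ ?_).2 fun a => ?_
        · exact List.nodup_range.map fun a b h => by simpa using ρ.injective h
        · exact List.nodup_range.map fun a b h => by simpa using h
        · simp only [List.mem_map, List.mem_range]
          constructor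
          · rintro ⟨k, hk, rfl⟩
            have h5 : ¬ (ρ (k + 1) = 0 ∨ m < ρ (k + 1)) := by
              intro h
              have h6 := ρ.injective (hρ _ h)
              omega
            exact ⟨ρ (k + 1) - 1, by omega, by omega⟩
          · rintro ⟨k, hk, rfl⟩
            have h5 : ¬ (ρ.symm (k + 1) = 0 ∨ m < ρ.symm (k + 1)) := by
              intro h
              have h6 := hρ _ h
              rw [Equiv.apply_symm_apply] at h6
              omega
            exact ⟨ρ.symm (k + 1) - 1, by omega,
              by rw [show ρ.symm (k + 1) - 1 + 1 = ρ.symm (k + 1) by omega]; simp⟩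
      have h5 := h4.map fun k => superMap (K := K) (fun l : Fin d => (Vertex.int k, l)) (bivector x)
      rw [List.map_map, List.map_map] at h5
      refine h5.prod_eq' ?_
      refine List.pairwise_of_forall_mem_list fun a ha b _ => ?_
      obtain ⟨k, _, rfl⟩ := List.mem_map.1 ha
      exact commute_bivector x _ _
    · congr 1
      refine congrArg _ (funext fun i => ?_)
      simp only [Function.comp_apply, hR, superMap_superMap]
      rfl
  have h3 := h1 E (initialWords F fs n m)
  rw [h2, eval_initialWords, ← hF] at h3
  rw [graphOperator, graphOperator, h3, hR, superMap_superMap]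
  rfl

end

/-! ## Lie algebras given by tables of structure constants -/

section

variable {d : ℕ}

/-- The bracket of two basis vectors, as a list of coefficients and indices; the entry
`(c, a, b, k)` of the table stands for the term `c x_k` of `[x_a, x_b]`. -/
def basisBracket (T : List (ℤ × Fin d × Fin d × Fin d)) (i j : Fin d) : List (ℤ × Fin d) :=
  T.flatMap fun t => (if t.2.1 = i ∧ t.2.2.1 = j then [(t.1, t.2.2.2)] else []) ++
    (if t.2.1 = j ∧ t.2.2.1 = i then [(-t.1, t.2.2.2)] else [])

/-- The Jacobi identity for three basis vectors. -/
def jacobiator (T : List (ℤ × Fin d × Fin d × Fin d)) (i j k : Fin d) : List (ℤ × Fin d) :=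
  ((basisBracket T j k).flatMap fun s => (basisBracket T i s.2).map fun t => (s.1 * t.1, t.2)) ++
  (((basisBracket T i j).flatMap fun s =>
    (basisBracket T s.2 k).map fun t => (-(s.1 * t.1), t.2)) ++
  (basisBracket T i k).flatMap fun s => (basisBracket T j s.2).map fun t => (-(s.1 * t.1), t.2))

/-- The coefficients add up to zero for every index. -/
def sumsToZero (L : List (ℤ × Fin d)) : Bool :=
  L.all fun t => decide (((L.filter fun s => decide (s.2 = t.2)).map Prod.fst).sum = 0)

/-- Tables of structure constants. -/
structure BracketTable (d : ℕ) where
  /-- The non-zero brackets. -/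
  terms : List (ℤ × Fin d × Fin d × Fin d)
  jacobi : ((List.finRange d).all fun i => (List.finRange d).all fun j =>
    (List.finRange d).all fun k => sumsToZero (jacobiator terms i j k)) = true

variable (K : Type*) [Field K]

/-- The Lie algebra with given structure constants. -/
def TableLie (_ : BracketTable d) : Type _ := Fin d → K

/-- The vector with given coefficients. -/
def sparseVector (L : List (ℤ × Fin d)) : Fin d → K :=
  (L.map fun t => (t.1 : K) • Pi.single t.2 1).sum

theorem sparseVector_append (L M : List (ℤ × Fin d)) :
    sparseVector K (L ++ M) = sparseVector K L + sparseVector K M := by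
  simp [sparseVector]

theorem sparseVector_flatMap {ι : Type*} (l : List ι) (f : ι → List (ℤ × Fin d)) :
    sparseVector K (l.flatMap f) = (l.map fun i => sparseVector K (f i)).sum := by
  induction l with
  | nil => rfl
  | cons i l ih => rw [List.flatMap_cons, sparseVector_append, ih, List.map_cons, List.sum_cons]

theorem sparseVector_eq_zero {L : List (ℤ × Fin d)} (h : sumsToZero L = true) :
    sparseVector K L = 0 := by
  funext l
  have h1 : ∀ M : List (ℤ × Fin d), sparseVector K M l =
      (((M.filter fun s => decide (s.2 = l)).map Prod.fst).sum : ℤ) := by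
    intro M
    induction M with
    | nil => simp [sparseVector]
    | cons t M ih =>
      rw [← List.singleton_append, sparseVector_append, Pi.add_apply, ih, List.singleton_append,
        List.filter_cons]
      by_cases ht : t.2 = l
      · simp [ht, sparseVector]
      · simp [ht, sparseVector, Ne.symm ht]
  rw [h1, Pi.zero_apply]
  simp only [sumsToZero, List.all_eq_true, decide_eq_true_eq] at h
  by_cases hl : ∃ t ∈ L, t.2 = l
  · obtain ⟨t, ht, rfl⟩ := hl
    rw [h t ht, Int.cast_zero]
  · rw [List.filter_eq_nil_iff.2]
    · simp
    · intro t ht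
      simpa using fun h => hl ⟨t, ht, h⟩

/-- The bracket given by a table. -/
def tableBracket (T : List (ℤ × Fin d × Fin d × Fin d)) :
    (Fin d → K) →ₗ[K] (Fin d → K) →ₗ[K] (Fin d → K) :=
  (T.map fun t => (t.1 : K) • LinearMap.mk₂ K
    (fun u v : Fin d → K => (u t.2.1 * v t.2.2.1 - u t.2.2.1 * v t.2.1) •
      (Pi.single t.2.2.2 1 : Fin d → K))
    (fun _ _ _ => by simp only [Pi.add_apply]; module)
    (fun _ _ _ => by simp only [Pi.smul_apply, smul_eq_mul]; module)
    (fun _ _ _ => by simp only [Pi.add_apply]; module)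
    (fun _ _ _ => by simp only [Pi.smul_apply, smul_eq_mul]; module)).sum

theorem tableBracket_apply (T : List (ℤ × Fin d × Fin d × Fin d)) (u v : Fin d → K) :
    tableBracket K T u v = (T.map fun t => (t.1 : K) • (u t.2.1 * v t.2.2.1 - u t.2.2.1 * v t.2.1) •
      (Pi.single t.2.2.2 1 : Fin d → K)).sum := by
  induction T with
  | nil => simp [tableBracket]
  | cons t T ih =>
    rw [tableBracket, List.map_cons, List.sum_cons, LinearMap.add_apply, LinearMap.add_apply,
      ← tableBracket, ih, List.map_cons, List.sum_cons]
    rfl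

theorem tableBracket_self (T : List (ℤ × Fin d × Fin d × Fin d)) (u : Fin d → K) :
    tableBracket K T u u = 0 := by
  rw [tableBracket_apply]
  refine List.sum_eq_zero fun x hx => ?_
  obtain ⟨t, _, rfl⟩ := List.mem_map.1 hx
  rw [mul_comm, sub_self, zero_smul, smul_zero]

theorem tableBracket_single (T : List (ℤ × Fin d × Fin d × Fin d)) (i j : Fin d) :
    tableBracket K T (Pi.single i 1) (Pi.single j 1) = sparseVector K (basisBracket T i j) := by
  rw [tableBracket_apply, basisBracket, sparseVector_flatMap]
  congr 1
  refine List.map_congr_left fun t _ => ?_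
  rw [sparseVector_append, sub_smul, smul_sub, sub_eq_add_neg]
  simp only [Pi.single_apply, sparseVector]
  congr 1
  · by_cases h1 : t.2.1 = i <;> by_cases h2 : t.2.2.1 = j <;> simp [h1, h2]
  · by_cases h1 : t.2.1 = j <;> by_cases h2 : t.2.2.1 = i <;> simp [h1, h2]

theorem tableBracket_sparse_right (T : List (ℤ × Fin d × Fin d × Fin d)) (i : Fin d)
    (L : List (ℤ × Fin d)) : tableBracket K T (Pi.single i 1) (sparseVector K L) =
      sparseVector K (L.flatMap fun s => (basisBracket T i s.2).map fun t => (s.1 * t.1, t.2)) := by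
  rw [sparseVector_flatMap, sparseVector, map_list_sum, List.map_map]
  congr 1
  refine List.map_congr_left fun s _ => ?_
  rw [Function.comp_apply, map_smul, tableBracket_single, sparseVector, sparseVector,
    List.smul_sum, List.map_map, List.map_map]
  simp [Function.comp_def, mul_smul]

theorem tableBracket_sparse_left (T : List (ℤ × Fin d × Fin d × Fin d)) (k : Fin d)
    (L : List (ℤ × Fin d)) : tableBracket K T (sparseVector K L) (Pi.single k 1) =
      sparseVector K (L.flatMap fun s => (basisBracket T s.2 k).map fun t => (s.1 * t.1, t.2)) := by
  rw [sparseVector_flatMap, sparseVector, ← LinearMap.flip_apply, map_list_sum, List.map_map]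
  congr 1
  refine List.map_congr_left fun s _ => ?_
  rw [Function.comp_apply, map_smul, LinearMap.flip_apply, tableBracket_single, sparseVector,
    sparseVector, List.smul_sum, List.map_map, List.map_map]
  simp [Function.comp_def, mul_smul]

/-- The identity is checked on basis vectors, as part of the table, and then extended linearly in
the third, the second and the first argument. -/
theorem tableBracket_jacobi (T : BracketTable d) (u v w : Fin d → K) :
    tableBracket K T.terms u (tableBracket K T.terms v w) =
      tableBracket K T.terms (tableBracket K T.terms u v) w +
        tableBracket K T.terms v (tableBracket K T.terms u w) := by
  set B := tableBracket K T.terms with hB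
  have hb : ∀ i, (Pi.basisFun K (Fin d)) i = Pi.single i 1 := Pi.basisFun_apply K (Fin d)
  have neg : ∀ (L : List (ℤ × Fin d)) (f : ℤ × Fin d → List (ℤ × Fin d)),
      sparseVector K (L.flatMap fun s => (f s).map fun t => (-(s.1 * t.1), t.2)) =
        - sparseVector K (L.flatMap fun s => (f s).map fun t => (s.1 * t.1, t.2)) := by
    intro L f
    rw [sparseVector_flatMap, sparseVector_flatMap, ← neg_one_smul K, List.smul_sum, List.map_map]
    congr 1
    refine List.map_congr_left fun s _ => ?_
    rw [Function.comp_apply, sparseVector, sparseVector, List.smul_sum, List.map_map, List.map_map,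
      List.map_map]
    simp [Function.comp_def]
  have h0 : ∀ i j k, B (Pi.single i 1) (B (Pi.single j 1) (Pi.single k 1)) =
      B (B (Pi.single i 1) (Pi.single j 1)) (Pi.single k 1) +
        B (Pi.single j 1) (B (Pi.single i 1) (Pi.single k 1)) := by
    intro i j k
    have h := T.jacobi
    simp only [List.all_eq_true, List.mem_finRange, forall_true_left] at h
    have h := sparseVector_eq_zero K (h i j k)
    rw [jacobiator, sparseVector_append, sparseVector_append, neg, neg] at h
    rw [hB, tableBracket_single, tableBracket_single, tableBracket_single,
      tableBracket_sparse_right, tableBracket_sparse_right, tableBracket_sparse_left]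
    rw [← sub_eq_zero, ← h]
    abel
  have h1 : ∀ i j, B (Pi.single i 1) ∘ₗ B (Pi.single j 1) =
      B (B (Pi.single i 1) (Pi.single j 1)) + B (Pi.single j 1) ∘ₗ B (Pi.single i 1) := by
    intro i j
    refine (Pi.basisFun K (Fin d)).ext fun k => ?_
    rw [hb]
    exact h0 i j k
  have h2 : ∀ i, B (Pi.single i 1) ∘ₗ B.flip w =
      B.flip w ∘ₗ B (Pi.single i 1) + B.flip (B (Pi.single i 1) w) := by
    intro i
    refine (Pi.basisFun K (Fin d)).ext fun j => ?_
    rw [hb]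
    exact LinearMap.congr_fun (h1 i j) w
  have h3 : B.flip (B v w) = B.flip w ∘ₗ B.flip v + B v ∘ₗ B.flip w := by
    refine (Pi.basisFun K (Fin d)).ext fun i => ?_
    rw [hb]
    exact LinearMap.congr_fun (h2 i) v
  exact LinearMap.congr_fun h3 u

variable {K}

instance (T : BracketTable d) : AddCommGroup (TableLie K T) :=
  inferInstanceAs (AddCommGroup (Fin d → K))

instance (T : BracketTable d) : Module K (TableLie K T) := inferInstanceAs (Module K (Fin d → K))

instance (T : BracketTable d) : LieRing (TableLie K T) where
  bracket u v := tableBracket K T.terms u v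
  add_lie u v w := LinearMap.map_add₂ (tableBracket K T.terms) u v w
  lie_add u v w := map_add (tableBracket K T.terms u) v w
  lie_self u := tableBracket_self K T.terms u
  leibniz_lie := tableBracket_jacobi K T

instance (T : BracketTable d) : LieAlgebra K (TableLie K T) where
  lie_smul c u v := map_smul (tableBracket K T.terms u) c v

variable (K) in
/-- The standard basis. -/
noncomputable def tableBasis (T : BracketTable d) : Module.Basis (Fin d) K (TableLie K T) :=
  Pi.basisFun K (Fin d)

/-- The bivector field of a table, as a formal sum of words. -/
def BracketTable.words (T : BracketTable d) : WordSum (Fin d) :=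
  T.terms.map fun t => (t.1, [t.2.2.2], [t.2.1, t.2.2.1])

theorem BracketTable.words_hasLength (T : BracketTable d) : T.words.HasLength 1 2 := by
  intro w hw
  obtain ⟨t, _, rfl⟩ := List.mem_map.1 hw
  exact ⟨rfl, rfl⟩

theorem structureConstant_table (T : BracketTable d) (i j k : Fin d) :
    structureConstant (tableBasis K T) i j k = (T.terms.map fun t => (t.1 : K) *
      ((if i = t.2.1 then 1 else 0) * (if j = t.2.2.1 then 1 else 0) -
        (if i = t.2.2.1 then 1 else 0) * (if j = t.2.1 then 1 else 0)) *
        if k = t.2.2.2 then 1 else 0).sum := by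
  have h : structureConstant (tableBasis K T) i j k =
      tableBracket K T.terms (Pi.basisFun K (Fin d) i) (Pi.basisFun K (Fin d) j) k := rfl
  rw [h, tableBracket_apply, Pi.basisFun_apply, Pi.basisFun_apply]
  induction T.terms with
  | nil => rfl
  | cons t L ih =>
    rw [List.map_cons, List.sum_cons, List.map_cons, List.sum_cons, Pi.add_apply, ih]
    simp [Pi.single_apply, eq_comm]

/-- An entry of the table produces a bracket and its negative with exchanged arguments; as `p^i p^j`
is antisymmetric as well, the two contributions agree and cancel the factor `½`. So `π` is integral.
-/
theorem bivector_table [CharZero K] (T : BracketTable d) :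
    bivector (tableBasis K T) = WordSum.eval K T.words := by
  have hw : ∀ i j k : Fin d, MvPolynomial.X k ⊗ₜ[K] (ExteriorAlgebra.ι K (Finsupp.single i 1) *
      ExteriorAlgebra.ι K (Finsupp.single j 1)) = word K [k] [i, j] := by
    intro i j k
    simp [word]
  have hs : ∀ i j k : Fin d, word K [k] [j, i] = - word K [k] [i, j] := by
    intro i j k
    rw [← hw, ← hw, ← TensorProduct.tmul_neg]
    congr 1
    exact eq_neg_of_add_eq_zero_left (ExteriorAlgebra.ι_add_mul_swap _ _)
  simp only [bivector, structureConstant_table, hw, BracketTable.words]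
  induction T.terms with
  | nil => simp [WordSum.eval]
  | cons t L ih =>
    rw [List.map_cons, WordSum.eval_cons, ← ih]
    simp only [List.map_cons, List.sum_cons, add_div, add_smul, Finset.sum_add_distrib]
    congr 1
    have h : ∀ i j k : Fin d, ((t.1 : K) *
      ((if i = t.2.1 then 1 else 0) * (if j = t.2.2.1 then 1 else 0) -
        (if i = t.2.2.1 then 1 else 0) * (if j = t.2.1 then 1 else 0)) *
        (if k = t.2.2.2 then 1 else 0) / 2) • word K [k] [i, j] =
        (if i = t.2.1 then if j = t.2.2.1 then if k = t.2.2.2 then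
          ((t.1 : K) / 2) • word K [k] [i, j] else 0 else 0 else 0) -
        (if i = t.2.2.1 then if j = t.2.1 then if k = t.2.2.2 then
          ((t.1 : K) / 2) • word K [k] [i, j] else 0 else 0 else 0) := by
      intro i j k
      split_ifs <;> module
    simp only [h, Finset.sum_sub_distrib, Finset.sum_ite_irrel, Finset.sum_const_zero,
      Finset.sum_ite_eq', Finset.mem_univ, if_true]
    rw [hs t.2.1 t.2.2.1, smul_neg, sub_neg_eq_add, ← add_smul, add_halves]

end

/-! ## Recovering a combination of graphs from its action -/

section

variable {K : Type*} [Field K] {n m : ℕ}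

/-- Functions on graphs that are compatible with orders and labels. -/
structure IsGraphFunction {M : Type*} [AddCommGroup M] (m : ℕ) (F : List Edge → M) : Prop where
  order : ∀ l₁ l₂ e f, F (l₁ ++ e :: f :: l₂) + F (l₁ ++ f :: e :: l₂) = 0
  relabel : ∀ ρ : Equiv.Perm ℕ, (∀ k, k = 0 ∨ m < k → ρ k = k) →
    ∀ E, F (mapVertices (_root_.relabel ρ) E) = F E

theorem isGraphFunction_cls : IsGraphFunction m (cls K n m) :=
  ⟨cls_order n m, fun ρ hρ E => cls_relabel ρ (fun k hk => hρ k (by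
    rw [mem_vertices_int] at hk
    omega)) E⟩

/-- Only vanishing is transported, so the sign of the permutation need not be tracked. The prefix
`l` makes the induction work. -/
theorem IsGraphFunction.eq_zero_of_perm {M : Type*} [AddCommGroup M] {F : List Edge → M}
    (hF : IsGraphFunction m F) {E E' : List Edge} (h : E.Perm E') (l : List Edge)
    (h0 : F (l ++ E) = 0) : F (l ++ E') = 0 := by
  induction h generalizing l with
  | nil => exact h0
  | cons e _ ih =>
    have := ih (l ++ [e]) (by simpa using h0)
    simpa using this
  | swap e f E =>
    rw [← hF.order l E f e, h0, zero_add]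
  | trans _ _ ih1 ih2 => exact ih2 l (ih1 l h0)

/-- The linear form on chains given by a function on graphs. -/
noncomputable def chainSum (a : Chains K n m) (F : List Edge → ℤ) : K :=
  a.sum fun E c => c * F E.1

/-- `F` is a linear form on graphs, with known value on the given chain. -/
structure IsTest (a : Chains K n m) (F : List Edge → ℤ) (y : K) : Prop where
  invariant : IsGraphFunction m F
  length : ∀ E, F E ≠ 0 → E.length + 2 = 2 * m + n
  value : chainSum a F = y

theorem IsTest.add {a : Chains K n m} {F G : List Edge → ℤ} {y z : K} (hF : IsTest a F y)
    (hG : IsTest a G z) : IsTest a (fun E => F E + G E) (y + z) where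
  invariant := ⟨fun l₁ l₂ e f => by
      rw [add_add_add_comm, hF.invariant.order, hG.invariant.order, add_zero],
    fun ρ hρ E => by rw [hF.invariant.relabel ρ hρ, hG.invariant.relabel ρ hρ]⟩
  length E h := by
    by_cases h1 : F E = 0
    · exact hG.length E fun h2 => h (by rw [h1, h2, add_zero])
    · exact hF.length E h1
  value := by
    rw [← hF.value, ← hG.value, chainSum, chainSum, chainSum, ← Finsupp.sum_add]
    simp [mul_add]

theorem IsTest.smul {a : Chains K n m} {F : List Edge → ℤ} {y : K} (hF : IsTest a F y) (c : ℤ) :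
    IsTest a (fun E => c * F E) (c * y) where
  invariant := ⟨fun l₁ l₂ e f => by rw [← mul_add, hF.invariant.order, mul_zero],
    fun ρ hρ E => by rw [hF.invariant.relabel ρ hρ]⟩
  length E h := hF.length E (right_ne_zero_of_mul h)
  value := by
    rw [← hF.value, chainSum, chainSum, Finsupp.sum, Finsupp.sum, Finset.mul_sum]
    refine Finset.sum_congr rfl fun E _ => ?_
    push_cast
    ring

variable [CharZero K]

/-- Terms with the wrong number of edges do not contribute to homogeneous elements. -/
theorem mkQ_eq_of_hasDegree {α : GraphLie K} (hα : HasDegree 1 α) {a : Chains K n m}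
    (ha : (relations K n m).mkQ a = α n m) :
    α n m = a.sum fun E c => c • if E.1.length + 2 = 2 * m + n then cls K n m E.1 else 0 := by
  set F : List Edge → DGraphs K n m :=
    fun E => if E.length + 2 = 2 * m + n then cls K n m E else 0 with hF
  -- All relations are homogeneous in the number of edges, so discarding graphs with a wrong number
  -- of edges descends to the quotient.
  have hk : relations K n m ≤ LinearMap.ker
      (Finsupp.linearCombination K fun E : {E : List Edge // Admissible n m E} => F E.1) := by
    refine relations_le_ker F ?_ ?_ ?_ ?_
    · intro l₁ l₂ e f
      simp only [hF, List.length_append, List.length_cons]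
      split_ifs
      · exact cls_order _ _ _ _ _ _
      · exact add_zero _
    · intro ρ hρ E
      simp only [hF, mapVertices, List.length_map]
      rw [show List.map (Prod.map (relabel ρ) (relabel ρ)) E = mapVertices (relabel ρ) E from rfl,
        cls_relabel ρ hρ]
    · rintro m' rfl E hE hc v hv
      have hs : ((subst (splitAt v (m' + 1)) E).map fun s =>
          F (s ++ [(Vertex.int v, Vertex.int (m' + 1))])) =
          (subst (splitAt v (m' + 1)) E).map fun s => if E.length + 1 + 2 = 2 * (m' + 1) + n then
            cls K n (m' + 1) (s ++ [(Vertex.int v, Vertex.int (m' + 1))]) else 0 := by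
        refine Multiset.map_congr rfl fun s hs => ?_
        simp only [hF]
        rw [List.length_append, length_of_mem_subst hs, List.length_singleton]
      rw [hs]
      split_ifs
      · exact cls_ihx hE hc hv
      · simp
    · intro E k hk h
      simp only [hF]
      rw [cls_of_not_admissible, ite_self]
      intro hE
      have := hE.incoming k hk
      have := hE.outgoing k hk
      omega
  -- The induced projection fixes `α n m`, which is spanned by graphs with the right number of
  -- edges; applied to the given representative it yields the claim.
  have h1 : (relations K n m).liftQ _ hk (α n m) = α n m := by
    have h2 := hα n m
    generalize α n m = y at h2
    induction h2 using Submodule.span_induction with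
    | mem x hx =>
      obtain ⟨E, hE, rfl⟩ := hx
      by_cases hA : Admissible n m E
      · rw [cls, Submodule.mkQ_apply, Submodule.liftQ_apply, toChain, dif_pos hA,
          Finsupp.linearCombination_single, one_smul]
        simp only [hF]
        rw [if_pos (by omega), cls, toChain, dif_pos hA]
        rfl
      · rw [cls_of_not_admissible hA, map_zero]
    | zero => exact map_zero _
    | add x y _ _ hx hy => rw [map_add, hx, hy]
    | smul c x _ hx => rw [map_smul, hx]
  rw [← h1, ← ha, Submodule.mkQ_apply, Submodule.liftQ_apply]
  rfl

/-- The possible edges between the given vertices. -/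
def edgeList (n m : ℕ) : List Edge :=
  (vertexList n m).flatMap fun a => ((vertexList n m).filter fun b => decide (a ≠ b)).map fun b =>
    (a, b)

/-- The edges are distinct and not loops, so up to order they form a sublist of the list of all
possible edges; this makes the enumeration of graphs finite. -/
theorem Admissible.exists_perm {E : List Edge} (hE : Admissible n m E) :
    ∃ S ∈ (edgeList n m).sublistsLen E.length, S.Perm E := by
  have h : E ⊆ edgeList n m := by
    intro e he
    have := hE.mem e he
    simp only [edgeList, List.mem_flatMap, List.mem_map, List.mem_filter, decide_eq_true_eq]
    exact ⟨e.1, mem_vertexList.2 this.1, e.2, ⟨mem_vertexList.2 this.2, hE.loopless e he⟩, rfl⟩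
  obtain ⟨S, hS, hS'⟩ := hE.nodup.subperm h
  exact ⟨S, List.mem_sublistsLen.2 ⟨hS', hS.length_eq⟩, hS⟩

/-- A decidable criterion for disconnected graphs. -/
def isDisconnected (n m : ℕ) (E : List Edge) : Bool :=
  (E.all fun e => decide (e.1 ∈ reach n E m) == decide (e.2 ∈ reach n E m)) &&
    (List.range m).any fun k => decide (Vertex.int (k + 1) ∉ reach n E m)

/-- The criterion includes that the set found is closed under adjacency; a closed set that contains
the external vertices but misses an internal one contradicts connectedness. -/
theorem not_admissible_of_isDisconnected {E : List Edge} (h : isDisconnected n m E = true) :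
    ¬ Admissible n m E := by
  intro hE
  simp only [isDisconnected, Bool.and_eq_true, List.all_eq_true, List.any_eq_true, beq_iff_eq,
    decide_eq_decide, decide_eq_true_eq, List.mem_range] at h
  obtain ⟨h, k, hk, h'⟩ := h
  refine h' (connected_iff.1 hE.connected _ (fun i hi => ?_) h _ (mem_vertices_int.2 (by omega)))
  have h0 : Vertex.ext i ∈ reach n E 0 :=
    mem_vertexList.2 (mem_vertices_ext.2 (mem_vertices_ext.1 hi))
  have hs : ∀ (F : List Edge) (S : List Vertex) (a : Vertex), a ∈ S → a ∈ F.foldl (fun S e =>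
      if e.1 ∈ S then e.2 :: S else if e.2 ∈ S then e.1 :: S else S) S := by
    intro F
    induction F with
    | nil => exact fun _ _ h => h
    | cons e F ih =>
      intro S a ha
      refine ih _ _ ?_
      dsimp only
      split_ifs
      · exact List.mem_cons_of_mem _ ha
      · exact List.mem_cons_of_mem _ ha
      · exact ha
  have hr : ∀ r, Vertex.ext i ∈ reach n E r := fun r => by
    induction r with
    | zero => exact h0
    | succ r ih => exact hs _ _ _ ih
  exact hr m

/-- Insertion of a graph that is not yet in the list. -/
def insertNew (G : List Edge) (l : List (List Edge)) : List (List Edge) :=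
  if l.any (sameGraph G) then l else G :: l

theorem mem_foldr_insertNew {G : List Edge} {l : List (List Edge)} :
    G ∈ l.foldr insertNew [] ↔ G ∈ l := by
  induction l with
  | nil => rfl
  | cons H l ih =>
    rw [List.foldr_cons, insertNew, List.mem_cons, ← ih]
    split_ifs with h
    · obtain ⟨N, hN, hN'⟩ := List.any_eq_true.1 h
      rw [sameGraph_iff.1 hN']
      refine ⟨.inr, ?_⟩
      rintro (rfl | h)
      · exact hN
      · exact h
    · exact List.mem_cons

theorem nodup_foldr_insertNew (l : List (List Edge)) : (l.foldr insertNew []).Nodup := by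
  induction l with
  | nil => exact List.nodup_nil
  | cons H l ih =>
    rw [List.foldr_cons, insertNew]
    split_ifs with h
    · exact ih
    · exact List.nodup_cons.2 ⟨fun hH => h (List.any_eq_true.2 ⟨H, hH, sameGraph_iff.2 rfl⟩), ih⟩

/-- The normal forms of the graphs with `2 m + n - 2` edges. -/
def normalForms (n m : ℕ) : List (List Edge) :=
  ((((edgeList n m).sublistsLen (2 * m + n - 2)).filter fun S =>
    !isDead m S && !isDisconnected n m S).filterMap fun S =>
      (normalForm m S).map Prod.snd).foldr insertNew []

/-- Up to order, every admissible graph is a sublist of the possible edges, and its normal form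
belongs to the list; the excluded sublists are not admissible. -/
theorem IsGraphFunction.eq_zero {M : Type*} [AddCommGroup M] [IsAddTorsionFree M]
    {F : List Edge → M} (hF : IsGraphFunction m F) (h0 : ∀ G ∈ normalForms n m, F G = 0)
    {E : List Edge} (hE : Admissible n m E) (hl : E.length + 2 = 2 * m + n) : F E = 0 := by
  obtain ⟨S, hS, hp⟩ := hE.exists_perm
  have hE' := hE.perm hp.symm
  refine hF.eq_zero_of_perm hp [] ?_
  have hd : isDead m S = false := by
    rw [← Bool.not_eq_true]
    exact fun h => not_admissible_of_isDead h hE'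
  rw [List.nil_append, normalForm_sign hF.order hF.relabel hd]
  rw [show E.length = 2 * m + n - 2 by omega] at hS
  cases hN : normalForm m S with
  | none => rfl
  | some c =>
    rw [Option.elim_some, h0, smul_zero]
    refine mem_foldr_insertNew.2 (List.mem_filterMap.2 ⟨S, List.mem_filter.2 ⟨hS, ?_⟩, ?_⟩)
    · rw [hd, Bool.not_false, Bool.true_and, Bool.not_eq_true', ← Bool.not_eq_true]
      exact fun h => not_admissible_of_isDisconnected h hE'
    · rw [hN, Option.map_some]

/-- The tests `F G` are dual to the graphs `G` in the list. -/
def dualCheck (Gs : List (List Edge)) (F : List Edge → List Edge → ℤ) : Bool :=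
  Gs.all fun G => decide (F G G ≠ 0) && Gs.all fun N => decide (F G N = 0) || sameGraph N G

/-- The expression of a graph by others, as a consequence of IHX relations. -/
structure Reduction where
  /-- The graph that is expressed by others. -/
  graph : List Edge
  /-- Multiples of IHX relations. -/
  ihx : List (ℤ × List Edge × ℕ)

/-- The expression of the graph by others. -/
def Reduction.terms (n m : ℕ) (H : Reduction) : GraphSum :=
  GraphSum.collect ((1, n, m, H.graph) ::
    H.ihx.flatMap fun r => (ihxSum n (m - 1) r.2.1 r.2.2).scale r.1)

/-- The graph is expressed by those in the list, and the tests are compatible with this. -/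
def Reduction.check (n m : ℕ) (Gs : List (List Edge)) (F : List Edge → List Edge → ℤ)
    (H : Reduction) : Bool :=
  (H.terms n m).all (fun t => decide (t.1 = 0) ||
    (Nat.beq t.2.1 n && Nat.beq t.2.2.1 m && Gs.any (sameGraph t.2.2.2))) &&
  (H.ihx.all (fun r => Nat.ble 1 r.2.2 && Nat.ble r.2.2 (m - 1) && isGood n (m - 1) r.2.1) &&
  Gs.all fun G => decide (F G H.graph = ((H.terms n m).map fun t => t.1 * F G t.2.2.2).sum))

/-- A combination of IHX relations has value zero, so adding it to a graph does not change the
class; what remains after collecting terms is the expression by the graphs of the list. -/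
theorem Reduction.cls_eq {Gs : List (List Edge)} {F : List Edge → List Edge → ℤ} {H : Reduction}
    (h : H.check n m Gs F = true) :
    cls K n m H.graph = ((H.terms n m).map fun t => (t.1 : K) • cls K n m t.2.2.2).sum := by
  simp only [Reduction.check, Bool.and_eq_true] at h
  have h1 := eval_collect (K := K) ((1, n, m, H.graph) ::
    H.ihx.flatMap fun r => (ihxSum n (m - 1) r.2.1 r.2.2).scale r.1)
  rw [GraphSum.eval_cons, eval_flatMap, List.sum_eq_zero, add_zero] at h1
  · have h2 := congrArg (component K n m) h1
    rw [map_smul, component_graph, if_pos ⟨rfl, rfl⟩, Int.cast_one, one_smul] at h2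
    rw [← h2, GraphSum.eval, map_list_sum, List.map_map]
    congr 1
    refine List.map_congr_left fun t ht => ?_
    have h3 := List.all_eq_true.1 h.1 t ht
    simp only [Bool.or_eq_true, Bool.and_eq_true, decide_eq_true_eq, Nat.beq_eq] at h3
    rw [Function.comp_apply, map_smul, component_graph]
    rcases h3 with h3 | h3
    · rw [h3, Int.cast_zero, zero_smul, zero_smul]
    · rw [if_pos ⟨h3.1.1.symm, h3.1.2.symm⟩]
  · intro x hx
    obtain ⟨r, hr, rfl⟩ := List.mem_map.1 hx
    have h3 := List.all_eq_true.1 h.2.1 r hr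
    simp only [Bool.and_eq_true, Nat.ble_eq] at h3
    rw [eval_scale, eval_ihxSum h3.2 h3.1, smul_zero]

/-- The normal forms that are not expressed by others. -/
def basisGraphs (n m : ℕ) (Hs : List Reduction) : List (List Edge) :=
  (normalForms n m).filter fun G => Hs.all fun H => !sameGraph G H.graph

theorem basisGraphs_nodup (n m : ℕ) (Hs : List Reduction) : (basisGraphs n m Hs).Nodup :=
  (nodup_foldr_insertNew _).filter _

/-- A combination of graphs is determined by the values of dual tests. -/
theorem eq_sum_of_isTest {α : GraphLie K} (hα : HasDegree 1 α) {a : Chains K n m}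
    (ha : (relations K n m).mkQ a = α n m) {F : List Edge → List Edge → ℤ} {Y : List Edge → K}
    {Hs : List Reduction} (hF : ∀ G ∈ basisGraphs n m Hs, IsTest a (F G) (Y G))
    (hd : dualCheck (basisGraphs n m Hs) F = true)
    (hH : (Hs.all fun H => H.check n m (basisGraphs n m Hs) F) = true) :
    α n m = ((basisGraphs n m Hs).map fun G => (Y G / F G G) • cls K n m G).sum := by
  have hGs := basisGraphs_nodup n m Hs
  have hN : ∀ G ∈ normalForms n m, G ∈ basisGraphs n m Hs ∨ ∃ H ∈ Hs, G = H.graph := by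
    intro G hG
    by_cases h : ∃ H ∈ Hs, G = H.graph
    · exact .inr h
    · push Not at h
      refine .inl (List.mem_filter.2 ⟨hG, List.all_eq_true.2 fun H hH => ?_⟩)
      rw [Bool.not_eq_true', ← Bool.not_eq_true, sameGraph_iff]
      exact h H hH
  generalize basisGraphs n m Hs = Gs at *
  have hd0 : ∀ G ∈ Gs, ∀ N ∈ Gs, N ≠ G → F G N = 0 := by
    intro G hG N hN h
    have := List.all_eq_true.1 (Bool.and_eq_true _ _ ▸ List.all_eq_true.1 hd G hG).2 N hN
    rw [Bool.or_eq_true, decide_eq_true_eq, sameGraph_iff] at this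
    exact this.resolve_right h
  have hd1 : ∀ G ∈ Gs, (F G G : K) ≠ 0 := by
    intro G hG
    have := (Bool.and_eq_true _ _ ▸ List.all_eq_true.1 hd G hG).1
    rw [decide_eq_true_eq] at this
    exact_mod_cast this
  -- The defect of the dual expansion. It is shown to vanish on the graphs of the list, by duality,
  -- then on the reduced graphs, and hence on all graphs of the right length.
  set D : List Edge → DGraphs K n m := fun E =>
    cls K n m E - (Gs.map fun G => ((F G E : K) / F G G) • cls K n m G).sum with hD
  have hsum : ∀ (f : List Edge → DGraphs K n m), (Gs.map f).sum = ∑ G ∈ Gs.toFinset, f G := by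
    intro f
    rw [List.sum_toFinset _ hGs]
  have hDi : IsGraphFunction m D := by
    refine ⟨fun l₁ l₂ e f => ?_, fun ρ hρ E => ?_⟩
    · simp only [hD, hsum]
      rw [sub_add_sub_comm, cls_order, ← Finset.sum_add_distrib, zero_sub, neg_eq_zero]
      refine Finset.sum_eq_zero fun G hG => ?_
      rw [← add_smul, ← add_div, ← Int.cast_add, (hF G (List.mem_toFinset.1 hG)).invariant.order]
      simp
    · simp only [hD, hsum]
      rw [isGraphFunction_cls.relabel ρ hρ]
      congr 1
      refine Finset.sum_congr rfl fun G hG => ?_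
      rw [(hF G (List.mem_toFinset.1 hG)).invariant.relabel ρ hρ]
  have hDG : ∀ N ∈ Gs, D N = 0 := by
    intro N hN
    simp only [hD, hsum]
    rw [Finset.sum_eq_single_of_mem N (List.mem_toFinset.2 hN), div_self (hd1 N hN), one_smul,
      sub_self]
    intro G hG h
    rw [hd0 G (List.mem_toFinset.1 hG) N hN h.symm]
    simp
  -- Here compatibility of the tests with IHX enters: the class and the tests transform in the same
  -- way under the reduction, so the defect of the graph is a combination of defects that vanish
  -- already.
  have hDH : ∀ H ∈ Hs, D H.graph = 0 := by
    intro H hH'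
    have hch := List.all_eq_true.1 hH H hH'
    have h1 := Reduction.cls_eq (K := K) hch
    simp only [Reduction.check, Bool.and_eq_true, List.all_eq_true, decide_eq_true_eq] at hch
    have h2 : D H.graph = ((H.terms n m).map fun t => (t.1 : K) • D t.2.2.2).sum := by
      simp only [hD, hsum]
      rw [h1]
      have h3 : ∑ G ∈ Gs.toFinset, ((F G H.graph : K) / F G G) • cls K n m G =
          ((H.terms n m).map fun t => (t.1 : K) • ∑ G ∈ Gs.toFinset, ((F G t.2.2.2 : K) / F G G) •
            cls K n m G).sum := by
        have h4 : ∑ G ∈ Gs.toFinset, ((F G H.graph : K) / F G G) • cls K n m G =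
            ∑ G ∈ Gs.toFinset, (((((H.terms n m).map fun t => t.1 * F G t.2.2.2).sum : ℤ) : K) /
              F G G) •
              cls K n m G :=
          Finset.sum_congr rfl fun G hG => by rw [hch.2.2 G (List.mem_toFinset.1 hG)]
        rw [h4]
        generalize H.terms n m = L
        induction L with
        | nil => simp
        | cons t L ih =>
          rw [List.map_cons, List.sum_cons, ← ih, Finset.smul_sum, ← Finset.sum_add_distrib]
          refine Finset.sum_congr rfl fun G _ => ?_
          rw [List.map_cons, List.sum_cons, Int.cast_add, Int.cast_mul, smul_smul, ← add_smul]
          congr 1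
          ring
      rw [h3]
      generalize H.terms n m = L
      induction L with
      | nil => simp
      | cons t L ih =>
        simp only [List.map_cons, List.sum_cons]
        rw [← ih, smul_sub]
        abel
    rw [h2]
    refine List.sum_eq_zero fun x hx => ?_
    obtain ⟨t, ht, rfl⟩ := List.mem_map.1 hx
    have h5 := hch.1 t ht
    simp only [Bool.or_eq_true, Bool.and_eq_true, decide_eq_true_eq] at h5
    rcases h5 with h5 | h5
    · rw [h5, Int.cast_zero, zero_smul]
    · obtain ⟨N, hN, hN'⟩ := List.any_eq_true.1 h5.2
      rw [sameGraph_iff.1 hN', hDG _ hN, smul_zero]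
  let _ : Module ℚ (DGraphs K n m) := Module.compHom _ (algebraMap ℚ K)
  have := IsAddTorsionFree.of_module_rat (M := DGraphs K n m)
  have hD0 : ∀ E, Admissible n m E → E.length + 2 = 2 * m + n → D E = 0 := by
    intro E hE hl
    refine hDi.eq_zero (fun G hG => ?_) hE hl
    rcases hN G hG with hG | ⟨H, hH, rfl⟩
    · exact hDG G hG
    · exact hDH H hH
  rw [mkQ_eq_of_hasDegree hα ha, hsum]
  have h5 : ∀ G ∈ Gs.toFinset, (Y G / F G G) • cls K n m G =
      a.sum fun E c => (c * F G E.1 / F G G) • cls K n m G := by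
    intro G hG
    rw [← (hF G (List.mem_toFinset.1 hG)).value, chainSum, Finsupp.sum, Finset.sum_div,
      Finset.sum_smul]
    rfl
  rw [Finset.sum_congr rfl h5, Finsupp.sum]
  simp only [Finsupp.sum]
  rw [Finset.sum_comm]
  refine Finset.sum_congr rfl fun E _ => ?_
  split_ifs with hl
  · have h6 := hD0 E.1 E.2 hl
    simp only [hD, hsum, sub_eq_zero] at h6
    rw [h6, Finset.smul_sum]
    refine Finset.sum_congr rfl fun G _ => ?_
    rw [smul_smul, mul_div_assoc]
  · rw [smul_zero]
    symm
    refine Finset.sum_eq_zero fun G hG => ?_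
    -- Tests see only graphs with `2m + n - 2` edges, so the terms of the representative with
    -- another number of edges disappear on both sides.
    rw [show F G E.1 = 0 by
      by_contra h
      exact hl ((hF G (List.mem_toFinset.1 hG)).length _ h)]
    simp

end

/-! ## Tests given by Lie algebras -/

section

universe u

variable {K : Type u} [Field K] [CharZero K] {n m d : ℕ}

/-- The pairing with a word is linear, antisymmetric in the edges and independent of labels. Its
value on the component with `m` internal vertices is the pairing of the whole operation, since by
the count of letters no other number of internal vertices can contribute. -/
theorem isTest_graphPairing (T : BracketTable d) {fs : ℕ → List (Fin d) × List (Fin d)}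
    {X Q : List (Fin d)} {a : (n m : ℕ) → Chains K n m} {y : SuperPoly K (Fin d)}
    (h : OperationEq (tableBasis K T) a (fun i : Fin n => word K (fs i).1 (fs i).2) y)
    (hX : argLength n fs + 2 = X.length + m + n) (hQ : argLength' n fs + 2 = Q.length + n) :
    IsTest (a n m) (graphPairing T.words fs X Q n m) (wordFunctional K X Q y) := by
  have hop : ∀ m E, wordFunctional K X Q (graphOperator (tableBasis K T) n m E
      (fun i => word K (fs i).1 (fs i).2)) = graphPairing T.words fs X Q n m E := by
    intro m E
    rw [graphOperator_eq_eval _ (bivector_table T), wordFunctional_eval]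
    rfl
  -- The count of letters `p` fixes the number of edges, and then the count of letters `x` fixes the
  -- number of internal vertices.
  have h0 : ∀ m' E, graphPairing T.words fs X Q n m' E ≠ 0 →
      E.length + 2 = 2 * m' + n ∧ m' = m := by
    intro m' E hne
    have h1 := mt (graphPairing_eq_zero T.words_hasLength) hne
    omega
  refine ⟨⟨fun l₁ l₂ e f => ?_, fun ρ hρ E => ?_⟩, fun E hE => (h0 m E hE).1, ?_⟩
  · have := congrArg (wordFunctional K X Q) (graphOperator_order (tableBasis K T) n m
      (fun i => word K (fs i).1 (fs i).2) l₁ l₂ e f)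
    rw [map_add, hop, hop, map_zero] at this
    exact_mod_cast this
  · have := congrArg (wordFunctional K X Q) (graphOperator_relabel (tableBasis K T)
      (bivector_table T) fs (n := n) hρ E)
    rw [hop, hop] at this
    exact_mod_cast this
  -- A stage is chosen at which the sum is already stationary and includes the summand for `m`.
  · obtain ⟨M, hM, hmM⟩ := (h.and (Filter.eventually_gt_atTop m)).exists
    rw [← hM, map_sum, Finset.sum_eq_single_of_mem m (Finset.mem_range.2 hmM)]
    · rw [chainOperator, Finsupp.sum, map_sum, chainSum, Finsupp.sum]
      refine Finset.sum_congr rfl fun E _ => ?_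
      rw [map_smul, hop, smul_eq_mul]
    · intro m' _ hm'
      rw [chainOperator, Finsupp.sum, map_sum]
      refine Finset.sum_eq_zero fun E _ => ?_
      rw [map_smul, hop]
      by_contra hne
      exact hm' (h0 m' E.1 fun h => hne (by rw [h, Int.cast_zero, smul_zero])).2

/-- The labels of the edges of a graph, given two labels for the outgoing edges and one label for
the incoming edge of each internal vertex; the edges between external vertices get new labels,
beginning with `z`. -/
def edgeLabels (ch : ℕ → Fin d × Fin d × Fin d) :
    List Edge → (ℕ → ℕ) → ℕ → List (Fin d × Edge)
  | [], _, _ => []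
  | (.int k, t) :: E, r, z => ((if Nat.beq (r k) 0 then (ch k).1 else (ch k).2.1), (.int k, t)) ::
      edgeLabels ch E (fun j => if Nat.beq j k then r j + 1 else r j) z
  | (.ext i, .int k) :: E, r, z => ((ch k).2.2, (.ext i, .int k)) :: edgeLabels ch E r z
  | (.ext i, .ext j) :: E, r, z => ((ch z).1, (.ext i, .ext j)) :: edgeLabels ch E r (z + 1)

/-- A Lie algebra, arguments for the operators of graphs, and a word to pair the result with. -/
structure TestData (d : ℕ) where
  table : BracketTable d
  arguments : ℕ → List (Fin d) × List (Fin d)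
  outX : List (Fin d)
  outP : List (Fin d)

/-- The test in which every edge of `E` can contract the letters with its label. -/
def TestData.ofGraph (T : BracketTable d) (ch : ℕ → Fin d × Fin d × Fin d) (m : ℕ)
    (E : List Edge) : TestData d where
  table := T
  arguments i := let L := edgeLabels ch E (fun _ => 0) (m + 1)
    ((L.filter fun e => decide (e.2.2 = .ext (i + 1))).map Prod.fst,
      (L.filter fun e => decide (e.2.1 = .ext (i + 1))).map Prod.fst)
  outX := ((List.range m).filter fun k => E.all fun e => decide (e.2 ≠ .int (k + 1))).map
    fun k => (ch (k + 1)).2.2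
  outP := (List.range m).flatMap fun k => [(ch (k + 1)).1, (ch (k + 1)).2.1].drop
    (E.countP fun e => decide (e.1 = .int (k + 1)))

/-- The linear form on graphs given by a test. -/
def TestData.form (D : TestData d) (n m : ℕ) : List Edge → ℤ :=
  balancedPairing D.table.words D.arguments D.outX D.outP n m

/-- The choice of labels given by a list. -/
def labelChoice (l : List (Fin 10 × Fin 10 × Fin 10)) (z : ℕ) (k : ℕ) : Fin 10 × Fin 10 × Fin 10 :=
  if Nat.ble k l.length then l.getD (k - 1) (0, 0, 0) else
    (Fin.ofNat 10 (z + k - l.length - 1), 0, 0)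

/-- `m` copies of the Heisenberg Lie algebra (`m ≤ 3`). -/
def heisenbergTable : ℕ → BracketTable 10
  | 0 => ⟨[], by decide +kernel⟩
  | 1 => ⟨[(1, 0, 1, 2)], by decide +kernel⟩
  | 2 => ⟨[(1, 0, 1, 2), (1, 3, 4, 5)], by decide +kernel⟩
  | _ => ⟨[(1, 0, 1, 2), (1, 3, 4, 5), (1, 6, 7, 8)], by decide +kernel⟩

/-- `x_5` is the double bracket `[[x_0, x_1], x_2] = [[x_0, x_2], x_1]`. The output of one bracket
is an input of the next, as required by an edge between two internal vertices. -/
def squareTable : BracketTable 10 :=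
  ⟨[(1, 0, 1, 3), (1, 3, 2, 5), (1, 0, 2, 4), (1, 4, 1, 5)], by decide +kernel⟩

/-- `x_0` and `x_1` both act on the abelian ideal of `x_2` and `x_3` by exchanging these. Composing
two such actions returns to the start, which detects oriented cycles of length two. -/
def hyperbolicTable : BracketTable 10 :=
  ⟨[(1, 0, 2, 3), (1, 0, 3, 2), (1, 1, 2, 3), (1, 1, 3, 2)], by decide +kernel⟩

/-- `squareTable` with a Heisenberg Lie algebra. -/
def squareTable' : BracketTable 10 :=
  ⟨[(1, 0, 1, 3), (1, 3, 2, 5), (1, 0, 2, 4), (1, 4, 1, 5), (1, 6, 7, 8)], by decide +kernel⟩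

/-- `hyperbolicTable` with a Heisenberg Lie algebra. -/
def hyperbolicTable' : BracketTable 10 :=
  ⟨[(1, 0, 2, 3), (1, 0, 3, 2), (1, 1, 2, 3), (1, 1, 3, 2), (1, 4, 5, 6)], by decide +kernel⟩

/-- The semidirect product for a cyclic permutation matrix. -/
def cyclicTable : BracketTable 10 :=
  ⟨[(1, 0, 1, 2), (1, 0, 2, 3), (1, 0, 3, 1)], by decide +kernel⟩

/-- `x_0` moves along the chains `x_1, x_3, x_4` and `x_5, x_6, x_7`, and the bracket with `x_2`
sends the first chain to the second. The iterated bracket `[x_0, [x_0, [x_1, x_2]]] = x_7` fits a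
path of three internal vertices. -/
def filiformTable : BracketTable 10 :=
  ⟨[(1, 0, 1, 3), (1, 0, 3, 4), (1, 1, 2, 5), (1, 3, 2, 6), (1, 4, 2, 7), (1, 0, 5, 6),
    (1, 0, 6, 7)], by decide +kernel⟩

/-- `x_7 = [[x_0, x_1], [x_0, x_2]]` fits an internal vertex with two internal successors; the other
entries complete this to a Lie algebra. -/
def nilpotentTable : BracketTable 10 :=
  ⟨[(1, 0, 1, 3), (1, 0, 3, 4), (1, 0, 2, 5), (1, 3, 5, 7), (-2, 4, 2, 7), (1, 3, 2, 6),
    (-1, 1, 5, 6), (-1, 0, 6, 7)], by decide +kernel⟩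

/-- An edge between external vertices. -/
abbrev ee (i j : ℕ) : Edge := (.ext i, .ext j)

/-- An edge from an external to an internal vertex. -/
abbrev ei (i j : ℕ) : Edge := (.ext i, .int j)

/-- An edge from an internal to an external vertex. -/
abbrev ie (i j : ℕ) : Edge := (.int i, .ext j)

/-- An edge between internal vertices. -/
abbrev ii (i j : ℕ) : Edge := (.int i, .int j)

/-- A test for a graph with at most two internal vertices. -/
def smallTest (m : ℕ) (E : List Edge) : TestData 10 :=
  if ii 1 2 ∈ E then
    if ii 2 1 ∈ E then .ofGraph hyperbolicTable (labelChoice [(0, 2, 3), (2, 0, 3)] 4) m E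
    else if ∃ e ∈ E, e.2 = .int 1 then
      .ofGraph squareTable (labelChoice [(2, 3, 5), (0, 1, 3)] 6) m E
    else .ofGraph squareTable (labelChoice [(2, 3, 5), (1, 0, 3)] 6) m E
  else if ii 2 1 ∈ E then .ofGraph squareTable (labelChoice [(0, 1, 3), (3, 2, 5)] 6) m E
  else .ofGraph (heisenbergTable m) (labelChoice ([(0, 1, 2), (3, 4, 5)].take m) (3 * m)) m E

/-- Tests for graphs with three internal vertices and one external vertex. -/
def specialTests : List (List Edge × BracketTable 10 × List (Fin 10 × Fin 10 × Fin 10)) :=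
  [([ei 1 1, ei 1 2, ie 1 1, ii 1 3, ie 2 1], squareTable', [(2, 3, 5), (6, 7, 8), (0, 1, 3)]),
    ([ei 1 1, ei 1 2, ie 1 1, ii 1 3, ie 3 1], squareTable', [(2, 3, 5), (6, 7, 8), (0, 1, 3)]),
    ([ei 1 1, ie 1 1, ii 1 2, ie 2 1, ii 2 3], filiformTable, [(0, 6, 7), (0, 5, 6), (1, 2, 5)]),
    ([ei 1 1, ie 1 1, ii 1 2, ie 2 1, ie 3 1], squareTable', [(2, 3, 5), (0, 1, 3), (1, 0, 3)]),
    ([ei 1 1, ie 1 1, ie 2 1, ii 2 3, ie 3 1], squareTable', [(0, 1, 3), (2, 3, 5), (1, 0, 3)]),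
    ([ei 1 1, ie 1 1, ie 2 1, ii 2 3, ii 3 2], hyperbolicTable', [(4, 5, 6), (0, 2, 3), (2, 0, 3)]),
    ([ei 1 1, ii 1 2, ii 1 3, ie 2 1, ie 3 1], nilpotentTable, [(3, 5, 7), (0, 1, 3), (0, 2, 5)]),
    ([ei 1 1, ie 2 1, ii 2 3, ie 3 1, ii 3 2], hyperbolicTable', [(4, 5, 6), (0, 2, 3), (0, 2, 3)]),
    ([ie 1 1, ii 1 2, ie 2 1, ii 2 1, ie 3 1], hyperbolicTable', [(0, 2, 3), (0, 2, 3), (4, 5, 6)]),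
    ([ie 1 1, ii 1 2, ie 2 1, ii 2 3, ie 3 1], cyclicTable, [(0, 1, 2), (0, 1, 2), (0, 2, 3)]),
    ([ie 1 1, ii 1 2, ie 2 1, ii 2 3, ii 3 1], cyclicTable, [(0, 1, 2), (0, 1, 2), (1, 0, 2)])]

/-- A test for a graph with three internal vertices and one external vertex. -/
def largeTest (E : List Edge) : TestData 10 :=
  (specialTests.find? fun t => decide (t.1 = E)).elim
    (.ofGraph (heisenbergTable 3) (labelChoice [(0, 1, 2), (3, 4, 5), (6, 7, 8)] 9) 3 E)
    fun t => .ofGraph t.2.1 (labelChoice t.2.2 9) 3 E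

/-- Reductions for one external and two internal vertices. -/
def reductions₁₂ : List Reduction :=
  [⟨[ei 1 1, ii 1 2, ie 2 1], [(1, [ei 1 1, ie 1 1], 1)]⟩]

/-- Reductions for two external and two internal vertices. -/
def reductions₂₂ : List Reduction :=
  [⟨[ei 1 1, ee 1 2, ii 1 2, ee 2 1], [(-1, [ee 1 2, ei 1 1, ee 2 1], 1)]⟩,
    ⟨[ei 1 1, ee 1 2, ii 1 2, ie 2 1], [(-1, [ee 1 2, ei 1 1, ie 1 1], 1)]⟩,
    ⟨[ei 1 1, ee 1 2, ii 1 2, ie 2 2], [(-1, [ee 1 2, ei 1 1, ie 1 2], 1)]⟩,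
    ⟨[ee 1 2, ii 1 2, ee 2 1, ei 2 1], [(-1, [ee 1 2, ee 2 1, ei 2 1], 1)]⟩,
    ⟨[ee 1 2, ie 1 1, ee 2 1, ii 2 1], [(1, [ee 1 2, ee 2 1, ie 1 1], 1)]⟩,
    ⟨[ee 1 2, ie 1 2, ee 2 1, ii 2 1], [(1, [ee 1 2, ee 2 1, ie 1 2], 1)]⟩,
    ⟨[ee 1 2, ie 1 1, ei 2 2, ii 2 1], [(1, [ee 1 2, ei 2 1, ie 1 1], 1)]⟩,
    ⟨[ee 1 2, ie 1 2, ei 2 2, ii 2 1], [(1, [ee 1 2, ei 2 1, ie 1 2], 1)]⟩,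
    ⟨[ee 1 2, ie 1 1, ii 2 1, ie 2 2], [(1, [ee 1 2, ie 1 1, ie 1 2], 1)]⟩,
    ⟨[ei 1 1, ii 1 2, ee 2 1, ie 2 1], [(-1, [ei 1 1, ee 2 1, ie 1 1], 1)]⟩,
    ⟨[ei 1 1, ii 1 2, ee 2 1, ie 2 2], [(-1, [ei 1 1, ee 2 1, ie 1 2], 1)]⟩,
    ⟨[ei 1 1, ii 1 2, ie 2 1, ie 2 2], [(-1, [ei 1 1, ie 1 1, ie 1 2], 1)]⟩,
    ⟨[ie 1 1, ee 2 1, ei 2 2, ii 2 1], [(-1, [ee 2 1, ei 2 1, ie 1 1], 1)]⟩,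
    ⟨[ie 1 2, ee 2 1, ei 2 2, ii 2 1], [(-1, [ee 2 1, ei 2 1, ie 1 2], 1)]⟩,
    ⟨[ie 1 1, ee 2 1, ii 2 1, ie 2 2], [(-1, [ee 2 1, ie 1 1, ie 1 2], 1)]⟩,
    ⟨[ie 1 1, ie 1 2, ei 2 2, ii 2 1], [(-1, [ei 2 1, ie 1 1, ie 1 2], 1)]⟩]

/-- Reductions for one external and three internal vertices. -/
def reductions₁₃ : List Reduction :=
  [⟨[ei 1 1, ei 1 2, ie 1 1, ii 2 3, ie 3 1], [(1, [ei 1 1, ei 1 2, ie 1 1, ie 2 1], 1)]⟩,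
    ⟨[ei 1 1, ie 1 1, ii 1 2, ii 2 3, ie 3 1], [(1, [ei 1 1, ie 1 1, ii 1 2, ie 2 1], 2)]⟩,
    ⟨[ei 1 1, ii 1 2, ie 2 1, ii 2 3, ie 3 1], [(1, [ei 1 1, ie 1 1, ii 1 2, ie 2 1], 1),
      (1, [ei 1 1, ie 1 1, ii 1 2, ie 2 1], 2)]⟩,
    ⟨[ie 1 1, ii 1 2, ii 2 1, ii 2 3, ie 3 1], [(-1, [ie 1 1, ii 1 2, ie 2 1, ii 2 1], 1)]⟩]

/-- The Lie algebra with basis `a`, `b` and `[a, b] = b`. -/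
def affineTable : BracketTable 2 := ⟨[(1, 0, 1, 1)], by decide +kernel⟩

/-- A test for graphs with two external vertices, given by three monomials. -/
def affineTest (t : List (Fin 2) × List (Fin 2) × List (Fin 2)) : TestData 2 where
  table := affineTable
  arguments i := if Nat.beq i 0 then (t.1, []) else (t.2.1, [])
  outX := t.2.2
  outP := []

end

/-! ## The values of the tests -/

section

universe u

variable {K : Type u} [Field K] {n m d : ℕ}

/-- The partial derivative `∂/∂x_l` of a formal sum of words. -/
def WordSum.partialX (l : Fin d) (F : WordSum (Fin d)) : WordSum (Fin d) :=
  F.flatMap fun w => (deletions l w.2.1).map fun Y => (w.1, Y, w.2.2)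

/-- The partial derivative `∂/∂p^l` of a formal sum of words. -/
def WordSum.partialP (l : Fin d) (F : WordSum (Fin d)) : WordSum (Fin d) :=
  F.flatMap fun w => (signedDeletions l w.2.2).map fun t => (w.1 * t.1, w.2.1, t.2)

theorem WordSum.eval_partialX (l : Fin d) (F : WordSum (Fin d)) :
    (WordSum.partialX l F).eval K = _root_.partialX l (F.eval K) := by
  rw [WordSum.partialX, WordSum.eval_flatMap, WordSum.eval, map_list_sum, List.map_map]
  congr 1
  refine List.map_congr_left fun w _ => ?_
  rw [Function.comp_apply, map_smul, partialX_word, List.smul_sum, List.map_map, WordSum.eval,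
    List.map_map]
  rfl

theorem WordSum.eval_partialP (l : Fin d) (F : WordSum (Fin d)) :
    (WordSum.partialP l F).eval K = _root_.partialP l (F.eval K) := by
  rw [WordSum.partialP, WordSum.eval_flatMap, WordSum.eval, map_list_sum, List.map_map]
  congr 1
  refine List.map_congr_left fun w _ => ?_
  rw [Function.comp_apply, map_smul, partialP_word, List.smul_sum, List.map_map, WordSum.eval,
    List.map_map]
  congr 1
  refine List.map_congr_left fun t _ => ?_
  simp only [Function.comp_apply, Int.cast_mul, mul_smul]

/-- The differential of a formal sum of words, for the bivector field `F`. -/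
def WordSum.differential (F G : WordSum (Fin d)) : WordSum (Fin d) :=
  (List.finRange d).flatMap fun l => (F.partialP l).mul (G.partialX l) ++
    (WordSum.partialP l G).mul (F.partialX l)

theorem WordSum.eval_differential {L : Type*} [LieRing L] [LieAlgebra K L]
    (x : Module.Basis (Fin d) K L) {F : WordSum (Fin d)} (hF : bivector x = F.eval K)
    (G : WordSum (Fin d)) : (F.differential G).eval K = _root_.differential x (G.eval K) := by
  rw [WordSum.differential, WordSum.eval_flatMap, _root_.differential, Fin.sum_univ_def, hF]
  simp only [WordSum.eval_append, WordSum.eval_mul, WordSum.eval_partialX, WordSum.eval_partialP]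

/-- The degrees of the arguments and of the result fit. -/
def TestData.degreeCheck (D : TestData d) (n m : ℕ) : Bool :=
  Nat.beq (argLength n D.arguments + 2) (D.outX.length + m + n) &&
    Nat.beq (argLength' n D.arguments + 2) (D.outP.length + n)

variable [CharZero K]

theorem TestData.isTest {D : TestData d} (hD : D.degreeCheck n m = true)
    {a : (n m : ℕ) → Chains K n m} {y : SuperPoly K (Fin d)} {z : K}
    (h : OperationEq (tableBasis K D.table) a
      (fun i : Fin n => word K (D.arguments i).1 (D.arguments i).2) y)
    (hz : wordFunctional K D.outX D.outP y = z) : IsTest (a n m) (D.form n m) z := by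
  simp only [TestData.degreeCheck, Bool.and_eq_true, Nat.beq_eq] at hD
  have := isTest_graphPairing D.table h hD.1 hD.2
  rw [hz] at this
  rwa [← funext (balancedPairing_eq D.table.words D.arguments D.outX D.outP n m)] at this

variable {α : GraphLie K} {a : (n m : ℕ) → Chains K n m}

/-- The part of `CorrespondsToDuflo` for given chains. -/
def ActsAsDuflo (a : (n m : ℕ) → Chains K n m) : Prop :=
  ∀ (L : Type u) [LieRing L] [LieAlgebra K L] (d : ℕ) (x : Module.Basis (Fin d) K L),
    (∀ f, OperationEq x a ![f] (differential x f)) ∧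
    (∀ (g h : MvPolynomial (Fin d) K) (v w : ExteriorAlgebra K (Fin d →₀ K)),
      OperationEq x a ![g ⊗ₜ[K] v, h ⊗ₜ[K] w] (dufloProduct x g h ⊗ₜ[K] (v * w))) ∧
    ∀ n, 3 ≤ n → ∀ f : Fin n → SuperPoly K (Fin d), OperationEq x a f 0

theorem ActsAsDuflo.isTest_of_three_le (ha : ActsAsDuflo a) (hn : 3 ≤ n) {D : TestData d}
    (hD : D.degreeCheck n m = true) : IsTest (a n m) (D.form n m) 0 :=
  TestData.isTest hD ((ha _ d (tableBasis K D.table)).2.2 n hn _) (map_zero _)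

theorem ActsAsDuflo.isTest_one (ha : ActsAsDuflo a) {D : TestData d}
    (hD : D.degreeCheck 1 m = true) : IsTest (a 1 m) (D.form 1 m)
      ((pairing D.outX D.outP (D.table.words.differential
        [(1, (D.arguments 0).1, (D.arguments 0).2)]) : ℤ) : K) := by
  refine TestData.isTest hD (y := differential (tableBasis K D.table)
    (word K (D.arguments 0).1 (D.arguments 0).2)) ?_ ?_
  · have := (ha _ d (tableBasis K D.table)).1 (word K (D.arguments 0).1 (D.arguments 0).2)
    convert this using 1
    funext i
    fin_cases i
    rfl
  · rw [← wordFunctional_eval, WordSum.eval_differential _ (bivector_table D.table)]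
    simp [WordSum.eval]

/-- The product on `A` is a tensor product, so the value factors into a coefficient of a Duflo
product and a contraction of letters `p`. If the latter is zero, nothing needs to be known about the
Duflo product. -/
theorem ActsAsDuflo.isTest_two (ha : ActsAsDuflo a) {D : TestData d}
    (hD : D.degreeCheck 2 m = true) : IsTest (a 2 m) (D.form 2 m)
      (MvPolynomial.coeff (Multiset.toFinsupp (D.outX : Multiset (Fin d)))
        (dufloProduct (tableBasis K D.table) ((D.arguments 0).1.map MvPolynomial.X).prod
          ((D.arguments 1).1.map MvPolynomial.X).prod) *
        contractWord D.outP ((D.arguments 0).2 ++ (D.arguments 1).2)) := by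
  have h := (ha _ d (tableBasis K D.table)).2.1 ((D.arguments 0).1.map MvPolynomial.X).prod
    ((D.arguments 1).1.map MvPolynomial.X).prod
    ((D.arguments 0).2.map fun s => ExteriorAlgebra.ι K (Finsupp.single s (1 : K))).prod
    ((D.arguments 1).2.map fun s => ExteriorAlgebra.ι K (Finsupp.single s (1 : K))).prod
  rw [← List.prod_append, ← List.map_append] at h
  refine TestData.isTest hD ?_ (wordFunctional_tmul _ _ _ _)
  convert h using 1
  funext i
  fin_cases i <;> rfl

end

/-! ## The Duflo product for the non-commutative Lie algebra of dimension two -/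

section

variable {K : Type*} [Field K]

/-- Polynomials of degree less than `k`. -/
noncomputable def degreeLT (K : Type*) [Field K] (k : ℕ) : Submodule K (MvPolynomial (Fin 2) K) :=
  Submodule.span K {f | ∃ s : Fin 2 →₀ ℕ, s.degree < k ∧ f = MvPolynomial.monomial s 1}

theorem monomial_mem_degreeLT {k : ℕ} {s : Fin 2 →₀ ℕ} (h : s.degree < k) (c : K) :
    MvPolynomial.monomial s c ∈ degreeLT K k := by
  have : MvPolynomial.monomial s c = c • MvPolynomial.monomial s (1 : K) := by
    rw [MvPolynomial.smul_monomial, smul_eq_mul, mul_one]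
  rw [this]
  exact Submodule.smul_mem _ _ (Submodule.subset_span ⟨s, h, rfl⟩)

theorem degreeLT_mono {k l : ℕ} (h : k ≤ l) : degreeLT K k ≤ degreeLT K l :=
  Submodule.span_mono fun _ ⟨s, hs, hf⟩ => ⟨s, by omega, hf⟩

theorem exists_mem_degreeLT (f : MvPolynomial (Fin 2) K) : ∃ k, f ∈ degreeLT K k := by
  induction f using MvPolynomial.induction_on' with
  | monomial s c => exact ⟨_, monomial_mem_degreeLT (Nat.lt_succ_self _) c⟩
  | add f g hf hg =>
    obtain ⟨k, hk⟩ := hf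
    obtain ⟨l, hl⟩ := hg
    exact ⟨k + l, Submodule.add_mem _ (degreeLT_mono (by omega) hk) (degreeLT_mono (by omega) hl)⟩

theorem degreeLT_zero : degreeLT K 0 = ⊥ := by
  rw [degreeLT, Submodule.span_eq_bot]
  rintro f ⟨s, hs, _⟩
  omega

/-- A linear map that changes polynomials only by terms of lower degree is injective. -/
theorem injective_of_sub_mem {W : Type*} [AddCommGroup W] [Module K W]
    (f : MvPolynomial (Fin 2) K →ₗ[K] W) (g : W →ₗ[K] MvPolynomial (Fin 2) K)
    (h : ∀ s, g (f (MvPolynomial.monomial s 1)) - MvPolynomial.monomial s 1 ∈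
      degreeLT K s.degree) : Function.Injective f := by
  have h1 : ∀ k, ∀ p ∈ degreeLT K (k + 1), g (f p) - p ∈ degreeLT K k := by
    intro k p hp
    induction hp using Submodule.span_induction with
    | mem p hp =>
      obtain ⟨s, hs, rfl⟩ := hp
      exact degreeLT_mono (by omega) (h s)
    | zero => simp
    | add p q _ _ hp hq =>
      rw [map_add, map_add, add_sub_add_comm]
      exact Submodule.add_mem _ hp hq
    | smul c p _ hp =>
      rw [map_smul, map_smul, ← smul_sub]
      exact Submodule.smul_mem _ _ hp
  have h2 : ∀ k, ∀ p ∈ degreeLT K k, f p = 0 → p = 0 := by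
    intro k
    induction k with
    | zero =>
      intro p hp _
      rw [degreeLT_zero] at hp
      exact hp
    | succ k ih =>
      intro p hp h0
      have := h1 k p hp
      rw [h0, map_zero, zero_sub] at this
      exact ih p (neg_neg p ▸ Submodule.neg_mem _ this) h0
  rw [← LinearMap.ker_eq_bot, LinearMap.ker_eq_bot']
  intro p hp
  obtain ⟨k, hk⟩ := exists_mem_degreeLT p
  exact h2 k p hk hp

theorem structureConstant_affine (i j k : Fin 2) :
    structureConstant (tableBasis K affineTable) i j k =
      if k = 1 then (if i = 0 ∧ j = 1 then 1 else if i = 1 ∧ j = 0 then -1 else 0) else 0 := by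
  rw [structureConstant_table]
  fin_cases i <;> fin_cases j <;> fin_cases k <;> simp [affineTable]

theorem adMatrix_affine : adMatrix (tableBasis K affineTable) =
    !![0, 0; -MvPolynomial.X 1, MvPolynomial.X 0] := by
  ext i j : 2
  simp only [adMatrix, Matrix.of_apply, structureConstant_affine, Fin.sum_univ_two]
  fin_cases i <;> fin_cases j <;> simp

/-- `ad_u` is lower triangular with diagonal `0, u_0`. The remaining entry of its powers does not
affect the determinant. -/
theorem adMatrix_affine_pow (k : ℕ) :
    (adMatrix (tableBasis K affineTable) ^ k) 0 0 = (if k = 0 then 1 else 0) ∧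
    (adMatrix (tableBasis K affineTable) ^ k) 0 1 = 0 ∧
    (adMatrix (tableBasis K affineTable) ^ k) 1 1 = MvPolynomial.X 0 ^ k := by
  induction k with
  | zero => simp
  | succ k ih =>
    have hM := adMatrix_affine (K := K)
    have h1 := congrFun (congrFun hM 0)
    have h2 := congrFun (congrFun hM 1)
    rw [pow_succ]
    simp only [Matrix.mul_apply, Fin.sum_univ_two, ih, h1, h2]
    simp [pow_succ]

/-- By triangularity `J` is the lower diagonal entry of the matrix series, that is, `sinh(u_0 / 2) /
(u_0 / 2)`. -/
theorem coeff_dufloElement (t : Fin 2 →₀ ℕ) :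
    MvPowerSeries.coeff t (dufloElement (tableBasis K affineTable)) =
      ∑ r ∈ Finset.range (t.degree + 1), if t = Finsupp.single 0 (2 * r) then
        ((4 : K) ^ r * (2 * r + 1).factorial)⁻¹ else 0 := by
  have h00 : sinhMatrix (tableBasis K affineTable) 0 0 = 1 := by
    ext s
    change (∑ r ∈ Finset.range (s.degree + 1), _) = _
    simp only [(adMatrix_affine_pow _).1, MvPowerSeries.coeff_one]
    rw [Finset.sum_eq_single_of_mem 0 (by simp)]
    · simp [MvPolynomial.coeff_one, eq_comm]
    · intro r _ hr
      simp [hr]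
  have h01 : sinhMatrix (tableBasis K affineTable) 0 1 = 0 := by
    ext s
    change (∑ r ∈ Finset.range (s.degree + 1), _) = _
    simp [(adMatrix_affine_pow _).2.1]
  rw [dufloElement, Matrix.det_fin_two, h00, h01, one_mul, zero_mul, sub_zero]
  change (∑ r ∈ Finset.range (t.degree + 1), _) = _
  refine Finset.sum_congr rfl fun r _ => ?_
  rw [(adMatrix_affine_pow _).2.2, MvPolynomial.coeff_X_pow]
  simp only [eq_comm (a := t)]
  split_ifs <;> simp

/-- `J = 1 + u_0² / 24 + ⋯`, hence `J^{1/2} = 1 + u_0² / 48 + ⋯`. Powers of `u_0` above the second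
are not needed for the products computed below. -/
theorem coeff_dufloSqrt [CharZero K] {t : Fin 2 →₀ ℕ} (ht : t 0 ≤ 2) :
    MvPowerSeries.coeff t (dufloSqrt (tableBasis K affineTable)) =
      if t = 0 then 1 else if t = Finsupp.single 0 2 then 1 / 48 else 0 := by
  set J := dufloElement (tableBasis K affineTable) with hJ
  have h1 : (MvPowerSeries.X 0 : MvPowerSeries (Fin 2) K) ^ 2 ∣ J - 1 := by
    rw [MvPowerSeries.X_pow_dvd_iff]
    intro s hs
    rw [map_sub, hJ, coeff_dufloElement, MvPowerSeries.coeff_one, Finset.sum_eq_single_of_mem 0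
      (by simp)]
    · simp
    · intro r _ hr
      rw [if_neg]
      rintro rfl
      simp only [Finsupp.single_eq_same] at hs
      omega
  -- `(J - 1)^r` is divisible by `u_0^{2r}`, so up to second order in `u_0` only the linear term of
  -- the binomial series contributes.
  have h2 : ∀ r, 2 ≤ r → MvPowerSeries.coeff t ((J - 1) ^ r) = 0 := by
    intro r hr
    have := pow_dvd_pow_of_dvd h1 r
    rw [← pow_mul, MvPowerSeries.X_pow_dvd_iff] at this
    exact this t (by omega)
  change (∑ r ∈ Finset.range (t.degree + 1), _) = _
  by_cases h0 : t = 0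
  · subst h0
    simp
  have hd : 1 ≤ t.degree := by
    rw [Nat.one_le_iff_ne_zero, Ne, Finsupp.degree_eq_zero_iff]
    exact h0
  rw [Finset.sum_eq_single_of_mem 1 (Finset.mem_range.2 (by omega)), if_neg h0, pow_one, map_sub,
    coeff_dufloElement, MvPowerSeries.coeff_one, if_neg h0, sub_zero]
  · split_ifs with h3
    · subst h3
      rw [Finset.sum_eq_single_of_mem 1 (by simp)]
      · norm_num [Nat.factorial]
      · intro r _ hr
        rw [if_neg]
        intro h
        have := DFunLike.congr_fun h 0
        simp only [Finsupp.single_eq_same] at this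
        omega
    · rw [Finset.sum_eq_zero, mul_zero]
      intro r _
      rw [if_neg]
      rintro rfl
      simp only [Finsupp.single_eq_same] at ht
      have : r = 0 ∨ r = 1 := by omega
      rcases this with rfl | rfl
      · simp at h0
      · exact h3 rfl
  · intro r _ hr
    rcases Nat.lt_or_ge r 2 with h | h
    · rw [show r = 0 by omega, pow_zero, MvPowerSeries.coeff_one, if_neg h0, mul_zero]
    · rw [h2 r h, mul_zero]

end

/-! ### A representation by differential operators, used in place of the Poincaré–Birkhoff–Witt
theorem. -/

section

variable {K : Type*} [Field K]

open MvPolynomial (X pderiv monomial)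

/-- The action of the first basis vector on polynomials. -/
noncomputable def affineOperator₀ (K : Type*) [Field K] : Module.End K (MvPolynomial (Fin 2) K) :=
  LinearMap.mulLeft K (X 0) + LinearMap.mulLeft K (X 1) * (pderiv 1).toLinearMap

/-- The action of the second basis vector on polynomials. -/
noncomputable def affineOperator₁ (K : Type*) [Field K] : Module.End K (MvPolynomial (Fin 2) K) :=
  LinearMap.mulLeft K (X 1)

/-- `x_0` acts as `X_0 + X_1 ∂_1` and `x_1` as multiplication by `X_1`; the Euler operator `X_1 ∂_1`
has eigenvalue `1` on `X_1`, which gives `[x_0, x_1] = x_1`. -/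
theorem affineOperator_lie : affineOperator₀ K * affineOperator₁ K -
    affineOperator₁ K * affineOperator₀ K = affineOperator₁ K := by
  have h : ∀ g : MvPolynomial (Fin 2) K, (pderiv (1 : Fin 2)).toLinearMap g = pderiv 1 g :=
    fun _ => rfl
  refine LinearMap.ext fun f => ?_
  simp only [affineOperator₀, affineOperator₁, LinearMap.sub_apply, Module.End.mul_apply,
    LinearMap.add_apply, LinearMap.mulLeft_apply,
    h, Derivation.leibniz, MvPolynomial.pderiv_X_self, smul_eq_mul]
  ring

noncomputable instance : LieRing (Module.End K (MvPolynomial (Fin 2) K)) :=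
    LieRing.ofAssociativeRing

noncomputable instance : LieAlgebra K (Module.End K (MvPolynomial (Fin 2) K)) :=
    LieAlgebra.ofAssociativeAlgebra

theorem linearCombination_tableBracket (u v : Fin 2 → K) :
    Fintype.linearCombination K ![affineOperator₀ K, affineOperator₁ K]
      (tableBracket K affineTable.terms u v) =
    Fintype.linearCombination K ![affineOperator₀ K, affineOperator₁ K] u *
      Fintype.linearCombination K ![affineOperator₀ K, affineOperator₁ K] v -
    Fintype.linearCombination K ![affineOperator₀ K, affineOperator₁ K] v *
      Fintype.linearCombination K ![affineOperator₀ K, affineOperator₁ K] u := by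
  rw [tableBracket_apply]
  simp only [affineTable, List.map_cons, List.map_nil, List.sum_cons, List.sum_nil, add_zero,
    Fintype.linearCombination_apply, Fin.sum_univ_two, Matrix.cons_val_zero, Matrix.cons_val_one,
    Int.cast_one, one_smul, mul_add, add_mul, smul_mul_smul_comm]
  have := affineOperator_lie (K := K)
  rw [sub_eq_iff_eq_add] at this
  simp [this]
  module

/-- A faithful representation of the non-commutative Lie algebra of dimension two. -/
noncomputable def affineRepresentation (K : Type*) [Field K] :
    TableLie K affineTable →ₗ⁅K⁆ Module.End K (MvPolynomial (Fin 2) K) where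
  toLinearMap := (Fintype.linearCombination K ![affineOperator₀ K, affineOperator₁ K] :
    (Fin 2 → K) →ₗ[K] Module.End K (MvPolynomial (Fin 2) K))
  map_lie' := linearCombination_tableBracket _ _

theorem affineRepresentation_basis (i : Fin 2) :
    affineRepresentation K (tableBasis K affineTable i) =
      ![affineOperator₀ K, affineOperator₁ K] i := by
  have : tableBasis K affineTable i = (Pi.single i 1 : Fin 2 → K) := by
    exact Pi.basisFun_apply K (Fin 2) i
  rw [this]
  change Fintype.linearCombination K ![affineOperator₀ K, affineOperator₁ K] _ = _
  rw [Fintype.linearCombination_apply_single, one_smul]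

theorem mul_mem_degreeLT (i : Fin 2) {k : ℕ} {f : MvPolynomial (Fin 2) K} (hf : f ∈ degreeLT K k) :
    X i * f ∈ degreeLT K (k + 1) := by
  induction hf using Submodule.span_induction with
  | mem f hf =>
    obtain ⟨s, hs, rfl⟩ := hf
    rw [MvPolynomial.X, MvPolynomial.monomial_mul]
    refine monomial_mem_degreeLT ?_ _
    rw [map_add, Finsupp.degree_single]
    omega
  | zero => simp
  | add f g _ _ hf hg => rw [mul_add]; exact Submodule.add_mem _ hf hg
  | smul c f _ hf => rw [mul_smul_comm]; exact Submodule.smul_mem _ _ hf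

theorem euler_mem_degreeLT {k : ℕ} {f : MvPolynomial (Fin 2) K} (hf : f ∈ degreeLT K k) :
    X 1 * pderiv 1 f ∈ degreeLT K k := by
  induction hf using Submodule.span_induction with
  | mem f hf =>
    obtain ⟨s, hs, rfl⟩ := hf
    rw [MvPolynomial.X_mul_pderiv_monomial]
    exact Submodule.smul_of_tower_mem _ _ (monomial_mem_degreeLT hs _)
  | zero => simp
  | add f g _ _ hf hg => rw [map_add, mul_add]; exact Submodule.add_mem _ hf hg
  | smul c f _ hf => rw [Derivation.map_smul, mul_smul_comm]; exact Submodule.smul_mem _ _ hf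

theorem prod_X_mem_degreeLT (l : List (Fin 2)) :
    (l.map X).prod ∈ degreeLT K (l.length + 1) := by
  induction l with
  | nil => exact monomial_mem_degreeLT (s := 0) (by simp) 1
  | cons i l ih => exact mul_mem_degreeLT i ih

/-- The symbol of an element of the universal enveloping algebra. -/
noncomputable def symbol (K : Type*) [Field K] :
    UniversalEnvelopingAlgebra K (TableLie K affineTable) →ₗ[K] MvPolynomial (Fin 2) K :=
  LinearMap.applyₗ (1 : MvPolynomial (Fin 2) K) ∘ₗ
    (UniversalEnvelopingAlgebra.lift K (affineRepresentation K)).toLinearMap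

/-- Applied to the polynomial `1`, a product of generators gives the corresponding monomial as
leading term. -/
theorem symbol_prod (l : List (Fin 2)) :
    symbol K (l.map fun i => UniversalEnvelopingAlgebra.ι K (tableBasis K affineTable i)).prod -
      (l.map X).prod ∈ degreeLT K l.length := by
  induction l with
  | nil => simp [symbol]
  | cons i l ih =>
    set g := symbol K
      (l.map fun i => UniversalEnvelopingAlgebra.ι K (tableBasis K affineTable i)).prod with hg
    have h1 : symbol K ((i :: l).map fun i =>
        UniversalEnvelopingAlgebra.ι K (tableBasis K affineTable i)).prod =
        ![affineOperator₀ K, affineOperator₁ K] i g := by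
      rw [hg, symbol, List.map_cons, List.prod_cons]
      simp [affineRepresentation_basis]
    have h2 : g ∈ degreeLT K (l.length + 1) := by
      have := Submodule.add_mem _ (degreeLT_mono (Nat.le_succ _) ih) (prod_X_mem_degreeLT l)
      rwa [sub_add_cancel] at this
    rw [h1, List.map_cons, List.prod_cons, List.length_cons]
    have h3 := mul_mem_degreeLT i ih
    rw [mul_sub] at h3
    -- The correction `X_1 ∂_1` in the action of `x_0` does not raise the degree, so it is of lower
    -- order than multiplication by `X_0`; the action of `x_1` has no correction.
    fin_cases i
    · have := Submodule.add_mem _ h3 (euler_mem_degreeLT h2)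
      convert this using 1
      simp [affineOperator₀]
      ring
    · exact h3

theorem symmetrization_monomial {L : Type*} [LieRing L] [LieAlgebra K L] {d : ℕ}
    (x : Module.Basis (Fin d) K L) {l : List (Fin d)} {s : Fin d →₀ ℕ}
    (hs : Multiset.toFinsupp (l : Multiset (Fin d)) = s) :
    symmetrization x (monomial s 1) = (l.length.factorial : K)⁻¹ • (l.permutations.map fun l =>
      (l.map fun i => UniversalEnvelopingAlgebra.ι K (x i)).prod).sum := by
  have h1 : symmetrization x (monomial s 1) = (s.degree.factorial : K)⁻¹ •
      (s.toMultiset.toList.permutations.map fun l =>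
        (l.map fun i => UniversalEnvelopingAlgebra.ι K (x i)).prod).sum := by
    exact (MvPolynomial.basisMonomials (Fin d) K).constr_basis K _ s
  subst hs
  have h2 : (Multiset.toFinsupp (l : Multiset (Fin d))).toMultiset.toList.Perm l := by
    rw [← Multiset.coe_eq_coe, Multiset.coe_toList, Multiset.toFinsupp_toMultiset]
  have h3 : (Multiset.toFinsupp (l : Multiset (Fin d))).degree = l.length := by
    have := Finsupp.card_toMultiset (Multiset.toFinsupp (l : Multiset (Fin d)))
    rw [Multiset.toFinsupp_toMultiset, Multiset.coe_card] at this
    exact this.symm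
  rw [h1, h3]
  congr 1
  exact ((h2.permutations).map _).sum_eq

theorem diffOperator_monomial {d : ℕ} (J : MvPowerSeries (Fin d) K) (s : Fin d →₀ ℕ) :
    diffOperator J (monomial s 1) = ∑ t ∈ Finset.Iic s, monomial (s - t)
      (MvPowerSeries.coeff t J * ∏ i, ((s i).descFactorial (t i) : K)) := by
  exact (MvPolynomial.basisMonomials (Fin d) K).constr_basis K _ s

end

/-! ### The Duflo map in dimension two: injectivity and values on monomials. -/

section

variable {K : Type*} [Field K]

open MvPolynomial (X monomial)

/-- The symmetrization of a monomial. -/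
noncomputable def symmetrized {L : Type*} [LieRing L] [LieAlgebra K L] {d : ℕ}
    (x : Module.Basis (Fin d) K L) (l : List (Fin d)) : UniversalEnvelopingAlgebra K L :=
  (l.length.factorial : K)⁻¹ • (l.permutations'.map fun l =>
    (l.map fun i => UniversalEnvelopingAlgebra.ι K (x i)).prod).sum

/-- The change to `List.permutations'` is for evaluation: symmetrizations of explicit words can then
be unfolded. -/
theorem symmetrization_prod {L : Type*} [LieRing L] [LieAlgebra K L] {d : ℕ}
    (x : Module.Basis (Fin d) K L) (l : List (Fin d)) :
    symmetrization x (l.map X).prod = symmetrized x l := by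
  rw [prod_X, symmetrization_monomial x rfl, symmetrized,
    ((List.permutations_perm_permutations' l).map _).sum_eq]

theorem degree_toFinsupp {d : ℕ} (l : List (Fin d)) :
    (Multiset.toFinsupp (l : Multiset (Fin d))).degree = l.length := by
  have := Finsupp.card_toMultiset (Multiset.toFinsupp (l : Multiset (Fin d)))
  rw [Multiset.toFinsupp_toMultiset, Multiset.coe_card] at this
  exact this.symm

theorem exists_list {d : ℕ} (s : Fin d →₀ ℕ) :
    ∃ l : List (Fin d), Multiset.toFinsupp (l : Multiset (Fin d)) = s :=
  ⟨s.toMultiset.toList, by rw [Multiset.coe_toList, Finsupp.toMultiset_toFinsupp]⟩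

variable [CharZero K]

/-- All reorderings of a word have the same leading monomial, and the symmetrization is their
average. -/
theorem symbol_symmetrization (s : Fin 2 →₀ ℕ) :
    symbol K (symmetrization (tableBasis K affineTable) (monomial s 1)) - monomial s 1 ∈
      degreeLT K s.degree := by
  obtain ⟨l, rfl⟩ := exists_list s
  rw [← prod_X, symmetrization_prod, symmetrized, degree_toFinsupp]
  have h0 : (l.length.factorial : K) ≠ 0 := Nat.cast_ne_zero.2 (Nat.factorial_ne_zero _)
  have h1 : ((l.map X).prod : MvPolynomial (Fin 2) K) =
      (l.length.factorial : K)⁻¹ • (l.permutations'.map fun _ => (l.map X).prod).sum := by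
    rw [List.map_const', List.sum_replicate, ← (List.permutations_perm_permutations' l).length_eq,
      List.length_permutations, ← Nat.cast_smul_eq_nsmul K, smul_smul, inv_mul_cancel₀ h0, one_smul]
  have h2 : ∀ P : List (List (Fin 2)), (∀ l' ∈ P, l'.Perm l) → symbol K (P.map fun l =>
      (l.map fun i => UniversalEnvelopingAlgebra.ι K (tableBasis K affineTable i)).prod).sum -
      (P.map fun _ => (l.map X).prod).sum ∈ degreeLT K l.length := by
    intro P hP
    induction P with
    | nil => simp
    | cons l' P ih =>
      have h3 := symbol_prod (K := K) l'
      have h4 := hP l' List.mem_cons_self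
      rw [h4.length_eq, (h4.map X).prod_eq] at h3
      rw [List.map_cons, List.sum_cons, List.map_cons, List.sum_cons, map_add, add_sub_add_comm]
      exact Submodule.add_mem _ h3 (ih fun l' h => hP l' (List.mem_cons_of_mem _ h))
  rw [h1, map_smul, ← smul_sub]
  exact Submodule.smul_mem _ _ (h2 _ fun l' h => List.mem_permutations'.1 h)

/-- The constant term of `J^{1/2}` is `1`, and every other term differentiates at least once. -/
theorem diffOperator_dufloSqrt {s : Fin 2 →₀ ℕ} :
    diffOperator (dufloSqrt (tableBasis K affineTable)) (monomial s 1) - monomial s 1 ∈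
      degreeLT K s.degree := by
  rw [diffOperator_monomial, ← Finset.add_sum_erase _ _ (Finset.mem_Iic.2 zero_le),
    coeff_dufloSqrt (by simp)]
  have : ∏ i, ((s i).descFactorial ((0 : Fin 2 →₀ ℕ) i) : K) = 1 := by simp
  rw [if_pos rfl, this, mul_one, tsub_zero, add_sub_cancel_left]
  refine Submodule.sum_mem _ fun t ht => monomial_mem_degreeLT ?_ _
  rw [Finset.mem_erase, Finset.mem_Iic] at ht
  have h1 : (s - t).degree + t.degree = s.degree := by
    rw [← map_add, tsub_add_cancel_of_le ht.2]
  have h2 : t.degree ≠ 0 := by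
    rw [Ne, Finsupp.degree_eq_zero_iff]
    exact ht.1
  omega

/-- Followed by the symbol, the Duflo map is unitriangular for the filtration by degree. -/
theorem dufloMap_injective : Function.Injective (dufloMap (tableBasis K affineTable)) := by
  refine injective_of_sub_mem _ (symbol K) fun s => ?_
  have h1 : ∀ k, ∀ p ∈ degreeLT K k,
      symbol K (symmetrization (tableBasis K affineTable) p) ∈ degreeLT K k := by
    intro k p hp
    induction hp using Submodule.span_induction with
    | mem p hp =>
      obtain ⟨s, hs, rfl⟩ := hp
      have := Submodule.add_mem _ (degreeLT_mono hs.le (symbol_symmetrization (K := K) s))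
        (monomial_mem_degreeLT hs 1)
      rwa [sub_add_cancel] at this
    | zero => simp
    | add p q _ _ hp hq =>
      rw [map_add, map_add]
      exact Submodule.add_mem _ hp hq
    | smul c p _ hp =>
      rw [map_smul, map_smul]
      exact Submodule.smul_mem _ _ hp
  have h2 := Submodule.add_mem _ (h1 _ _ (diffOperator_dufloSqrt (K := K) (s := s)))
    (symbol_symmetrization (K := K) s)
  rwa [map_sub, map_sub, sub_add_sub_cancel] at h2

/-- Only `1 + u_0² / 48` acts, and `∂_0²` applied to `x_0²` contributes a factor `2`, whence `1 /
24`. -/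
theorem diffOperator_affine {s : Fin 2 →₀ ℕ} (hs : s 0 ≤ 2) :
    diffOperator (dufloSqrt (tableBasis K affineTable)) (monomial s 1) = monomial s 1 +
      if s 0 = 2 then (1 / 24 : K) • monomial (s - Finsupp.single 0 2) 1 else 0 := by
  rw [diffOperator_monomial]
  have h1 : ∀ t ∈ Finset.Iic s, monomial (s - t) (MvPowerSeries.coeff t
      (dufloSqrt (tableBasis K affineTable)) * ∏ i, ((s i).descFactorial (t i) : K)) =
      (if t = 0 then monomial s 1 else 0) + if t = Finsupp.single 0 2 then
        if s 0 = 2 then (1 / 24 : K) • monomial (s - Finsupp.single 0 2) 1 else 0 else 0 := by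
    intro t ht
    have h2 : t 0 ≤ s 0 := Finset.mem_Iic.1 ht 0
    rw [coeff_dufloSqrt (by omega)]
    by_cases h0 : t = 0
    · subst h0
      have : (0 : Fin 2 →₀ ℕ) ≠ Finsupp.single 0 2 := by
        intro h
        simpa using DFunLike.congr_fun h 0
      simp [this]
    · rw [if_neg h0, if_neg h0, zero_add]
      split_ifs with h3 h4
      · subst h3
        rw [Fin.prod_univ_two, h4, MvPolynomial.smul_monomial]
        norm_num [Nat.descFactorial]
      · subst h3
        simp only [Finsupp.single_eq_same] at h2
        omega
      · simp
  rw [Finset.sum_congr rfl h1, Finset.sum_add_distrib, Finset.sum_ite_eq' , Finset.sum_ite_eq',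
    if_pos (by simp)]
  congr 1
  split_ifs with h2 h3 h3 <;> try rfl
  exfalso
  apply h2
  rw [Finset.mem_Iic, Finsupp.single_le_iff]
  omega

theorem dufloMap_prod {l : List (Fin 2)} (hl : l.count 0 ≤ 1) :
    dufloMap (tableBasis K affineTable) (l.map X).prod =
      symmetrized (tableBasis K affineTable) l := by
  rw [dufloMap, LinearMap.comp_apply, prod_X, diffOperator_affine, if_neg, add_zero,
    ← prod_X, symmetrization_prod]
  all_goals
    rw [Multiset.toFinsupp_apply, Multiset.coe_count]
    omega

theorem dufloMap_prod' {l : List (Fin 2)} (hl : l.count 0 = 0) :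
    dufloMap (tableBasis K affineTable) ((0 :: 0 :: l).map X).prod =
      symmetrized (tableBasis K affineTable) (0 :: 0 :: l) +
        (1 / 24 : K) • symmetrized (tableBasis K affineTable) l := by
  have h0 : Multiset.toFinsupp ((0 :: 0 :: l : List (Fin 2)) : Multiset (Fin 2)) 0 = 2 := by
    simp [Multiset.toFinsupp_apply, hl]
  have h1 : Multiset.toFinsupp ((0 :: 0 :: l : List (Fin 2)) : Multiset (Fin 2)) =
      Finsupp.single 0 2 + Multiset.toFinsupp (l : Multiset (Fin 2)) := by
    rw [← Multiset.cons_coe, ← Multiset.cons_coe, ← Multiset.singleton_add,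
      ← Multiset.singleton_add, map_add, map_add, Multiset.toFinsupp_singleton, ← add_assoc,
      ← Finsupp.single_add]
  rw [dufloMap, LinearMap.comp_apply, prod_X, diffOperator_affine h0.le, if_pos h0, map_add,
    map_smul, h1, add_tsub_cancel_left, ← h1, ← prod_X, ← prod_X, symmetrization_prod,
    symmetrization_prod]

/-- The product is defined by `Function.invFun`, which returns a chosen preimage; by injectivity the
only preimage is `z`. -/
theorem dufloProduct_eq {g h z : MvPolynomial (Fin 2) K}
    (H : dufloMap (tableBasis K affineTable) g * dufloMap (tableBasis K affineTable) h =
      dufloMap (tableBasis K affineTable) z) :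
    dufloProduct (tableBasis K affineTable) g h = z := by
  rw [dufloProduct, H]
  exact Function.leftInverse_invFun dufloMap_injective z

end

/-! ### Duflo products computed by reordering words in the enveloping algebra. -/

section

variable {K : Type*} [Field K]

open MvPolynomial (X)

local notation "A" => UniversalEnvelopingAlgebra.ι K (tableBasis K affineTable (0 : Fin 2))
local notation "B" => UniversalEnvelopingAlgebra.ι K (tableBasis K affineTable (1 : Fin 2))

theorem affine_relation : A * B = B * A + B := by
  have h1 : ⁅tableBasis K affineTable 0, tableBasis K affineTable 1⁆ =
      tableBasis K affineTable 1 := by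
    refine (tableBasis K affineTable).ext_elem fun k => ?_
    have := structureConstant_affine (K := K) 0 1 k
    rw [structureConstant] at this
    rw [this, Module.Basis.repr_self]
    fin_cases k <;> simp
  let _ : LieRing (UniversalEnvelopingAlgebra K (TableLie K affineTable)) :=
    LieRing.ofAssociativeRing
  have h2 : UniversalEnvelopingAlgebra.ι K ⁅tableBasis K affineTable 0,
      tableBasis K affineTable 1⁆ = A * B - B * A :=
    LieHom.map_lie _ _ _
  rw [h1] at h2
  rw [add_comm]
  exact sub_eq_iff_eq_add.1 h2.symm

/-- With `affine_relation` this is a rewriting rule that moves the second generator to the left, so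
that equal elements are brought to the same ordered form. -/
theorem affine_relation_mul (Z : UniversalEnvelopingAlgebra K (TableLie K affineTable)) :
    A * (B * Z) = B * (A * Z) + B * Z := by
  rw [← mul_assoc, affine_relation, add_mul, mul_assoc]

theorem coeff_prod_map_X {d : ℕ} (l l' : List (Fin d)) :
    MvPolynomial.coeff (Multiset.toFinsupp (l : Multiset (Fin d))) (l'.map X).prod =
      if l'.isPerm l then (1 : K) else 0 := by
  rw [prod_X, MvPolynomial.coeff_monomial]
  simp only [EmbeddingLike.apply_eq_iff_eq, Multiset.coe_eq_coe, List.isPerm_iff]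

theorem symmetrized_nil : symmetrized (tableBasis K affineTable) [] = 1 := by
  simp [symmetrized]

theorem symmetrized_singleton (i : Fin 2) : symmetrized (tableBasis K affineTable) [i] =
    UniversalEnvelopingAlgebra.ι K (tableBasis K affineTable i) := by
  simp [symmetrized]

variable [CharZero K]

/-- The averages over all orders of the letters are written in the ordered words `B^j A^i`, in which
products can be compared coefficient by coefficient. -/
theorem symmetrized_affine :
    symmetrized (tableBasis K affineTable) [0, 0] = A * A ∧
    symmetrized (tableBasis K affineTable) [1, 1] = B * B ∧
    symmetrized (tableBasis K affineTable) [0, 1] = B * A + (1 / 2 : K) • B ∧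
    symmetrized (tableBasis K affineTable) [0, 0, 1] = B * (A * A) + B * A + (1 / 3 : K) • B ∧
    symmetrized (tableBasis K affineTable) [0, 1, 1] = B * (B * A) + B * B ∧
    symmetrized (tableBasis K affineTable) [0, 0, 1, 1] =
      B * (B * (A * A)) + (2 : K) • (B * (B * A)) + (7 / 6 : K) • (B * B) := by
  refine ⟨?_, ?_, ?_, ?_, ?_, ?_⟩
  all_goals
    simp only [symmetrized, List.permutations', List.map_cons, List.map_nil, List.flatMap_cons,
      List.flatMap_nil, List.permutations'Aux, List.cons_append, List.nil_append, List.append_nil,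
      List.sum_cons, List.sum_nil, List.prod_cons, List.prod_nil, mul_one, List.length_cons,
      List.length_nil, affine_relation, affine_relation_mul, mul_add, Nat.factorial]
    push_cast
    module

theorem dufloMap_affine :
    dufloMap (tableBasis K affineTable) (([] : List (Fin 2)).map X).prod = 1 ∧
    dufloMap (tableBasis K affineTable) (([0] : List (Fin 2)).map X).prod = A ∧
    dufloMap (tableBasis K affineTable) (([1] : List (Fin 2)).map X).prod = B ∧
    dufloMap (tableBasis K affineTable) (([0, 0] : List (Fin 2)).map X).prod =
      A * A + (1 / 24 : K) • 1 ∧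
    dufloMap (tableBasis K affineTable) (([1, 1] : List (Fin 2)).map X).prod = B * B ∧
    dufloMap (tableBasis K affineTable) (([0, 1] : List (Fin 2)).map X).prod =
      B * A + (1 / 2 : K) • B ∧
    dufloMap (tableBasis K affineTable) (([0, 0, 1] : List (Fin 2)).map X).prod =
      B * (A * A) + B * A + (3 / 8 : K) • B ∧
    dufloMap (tableBasis K affineTable) (([0, 1, 1] : List (Fin 2)).map X).prod =
      B * (B * A) + B * B ∧
    dufloMap (tableBasis K affineTable) (([0, 0, 1, 1] : List (Fin 2)).map X).prod =
      B * (B * (A * A)) + (2 : K) • (B * (B * A)) + (29 / 24 : K) • (B * B) := by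
  obtain ⟨h1, h2, h3, h4, h5, h6⟩ := symmetrized_affine (K := K)
  refine ⟨?_, ?_, ?_, ?_, ?_, ?_, ?_, ?_, ?_⟩
  all_goals
    first | rw [dufloMap_prod (by decide)] | rw [dufloMap_prod' (by decide)]
    simp only [h1, h2, h3, h4, h5, h6, symmetrized_nil, symmetrized_singleton]
    try module

/-- The coefficients of some Duflo products that are used as tests. -/
def affineCoefficients : List ((List (Fin 2) × List (Fin 2) × List (Fin 2)) × ℤ) :=
  [(([], [], []), 24), (([0], [1], [1]), 12), (([0, 0], [1], [1]), 4), (([1], [0, 0], [1]), 4),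
    (([0, 0], [], []), 0), (([], [0, 0], []), 0), (([0], [0], []), -1),
    (([0, 0], [1, 1], [1, 1]), 20)]

theorem coeff_dufloProduct_affine : ∀ t ∈ affineCoefficients,
    MvPolynomial.coeff (Multiset.toFinsupp (t.1.2.2 : Multiset (Fin 2)))
      (dufloProduct (tableBasis K affineTable) (t.1.1.map X).prod (t.1.2.1.map X).prod) =
        (t.2 : K) / 24 := by
  obtain ⟨h1, h2, h3, h4, h5, h6, h7, h8, h9⟩ := dufloMap_affine (K := K)
  simp only [affineCoefficients, List.forall_mem_cons]
  refine ⟨?_, ?_, ?_, ?_, ?_, ?_, ?_, ?_, fun _ h => absurd h List.not_mem_nil⟩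
  · rw [dufloProduct_eq (z := (([] : List (Fin 2)).map X).prod) (by simp only [h1, mul_one]),
      coeff_prod_map_X, if_pos (by decide)]
    norm_num
  -- Here and below the polynomial `z` is found from the top degree downwards: after the image of
  -- the leading monomial is subtracted from the product, the remainder is again ordered and of
  -- lower degree.
  · rw [dufloProduct_eq (z := (([0, 1] : List (Fin 2)).map X).prod +
      (1 / 2 : K) • (([1] : List (Fin 2)).map X).prod)]
    · simp only [MvPolynomial.coeff_add, MvPolynomial.coeff_smul, coeff_prod_map_X]
      rw [if_neg (by decide), if_pos (by decide)]
      norm_num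
    · simp only [map_add, map_smul, h2, h3, h6, affine_relation]
      module
  · rw [dufloProduct_eq (z := (([0, 0, 1] : List (Fin 2)).map X).prod +
      ((([0, 1] : List (Fin 2)).map X).prod + (1 / 6 : K) • (([1] : List (Fin 2)).map X).prod))]
    · simp only [MvPolynomial.coeff_add, MvPolynomial.coeff_smul, coeff_prod_map_X]
      rw [if_neg (by decide), if_neg (by decide), if_pos (by decide)]
      norm_num
    · simp only [map_add, map_smul, h3, h4, h6, h7, add_mul, smul_mul_assoc, one_mul, mul_assoc,
        affine_relation, affine_relation_mul, mul_add]
      module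
  · rw [dufloProduct_eq (z := (([0, 0, 1] : List (Fin 2)).map X).prod +
      ((-1 : K) • (([0, 1] : List (Fin 2)).map X).prod +
        (1 / 6 : K) • (([1] : List (Fin 2)).map X).prod))]
    · simp only [MvPolynomial.coeff_add, MvPolynomial.coeff_smul, coeff_prod_map_X]
      rw [if_neg (by decide), if_neg (by decide), if_pos (by decide)]
      norm_num
    · simp only [map_add, map_smul, h3, h4, h6, h7, mul_smul_comm, mul_one, mul_add]
      module
  · rw [dufloProduct_eq (z := (([0, 0] : List (Fin 2)).map X).prod) (by simp only [h1, mul_one]),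
      coeff_prod_map_X, if_neg (by decide)]
    norm_num
  · rw [dufloProduct_eq (z := (([0, 0] : List (Fin 2)).map X).prod) (by simp only [h1, one_mul]),
      coeff_prod_map_X, if_neg (by decide)]
    norm_num
  · rw [dufloProduct_eq (z := (([0, 0] : List (Fin 2)).map X).prod +
      (-1 / 24 : K) • (([] : List (Fin 2)).map X).prod)]
    · simp only [MvPolynomial.coeff_add, MvPolynomial.coeff_smul, coeff_prod_map_X]
      rw [if_neg (by decide), if_pos (by decide)]
      norm_num
    · simp only [map_add, map_smul, h1, h2, h4]
      module
  · rw [dufloProduct_eq (z := (([0, 0, 1, 1] : List (Fin 2)).map X).prod +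
      ((2 : K) • (([0, 1, 1] : List (Fin 2)).map X).prod +
        (5 / 6 : K) • (([1, 1] : List (Fin 2)).map X).prod))]
    · simp only [MvPolynomial.coeff_add, MvPolynomial.coeff_smul, coeff_prod_map_X]
      rw [if_neg (by decide), if_neg (by decide), if_pos (by decide)]
      norm_num
    · simp only [map_add, map_smul, h4, h5, h8, h9, add_mul, smul_mul_assoc, one_mul, mul_assoc,
        affine_relation, affine_relation_mul, mul_add]
      module

end

/-! ## The coefficients in low orders -/

section

universe u

variable {K : Type u} [Field K] {n m : ℕ}

theorem IsTest.zero (a : Chains K n m) : IsTest a (fun _ => 0) 0 where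
  invariant := ⟨fun _ _ _ _ => add_zero 0, fun _ _ _ => rfl⟩
  length _ h := absurd rfl h
  value := by simp [chainSum]

/-- The terms of `dufloSum` with given numbers of vertices. -/
def dufloPart (n m : ℕ) : GraphSum :=
  GraphSum.collect (dufloSum.filter fun t => Nat.beq t.2.1 n && Nat.beq t.2.2.1 m)

/-- The coefficient of a graph in `dufloSum`. -/
def dufloCoefficient (n m : ℕ) (G : List Edge) : ℤ :=
  ((dufloPart n m).map fun t => if sameGraph t.2.2.2 G then t.1 else 0).sum

/-- Application of a function to a number, which is evaluated first. -/
def applyNat {α : Type*} (k : ℕ → α) : ℕ → α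
  | 0 => k 0
  | i + 1 => k i.succ

theorem applyNat_eq {α : Type*} (k : ℕ → α) (i : ℕ) : applyNat k i = k i := by
  cases i <;> rfl

/-- Application of a function to a vertex, which is evaluated first. -/
def applyVertex {α : Type*} (k : Vertex → α) : Vertex → α
  | .ext i => applyNat (fun i => k (.ext i)) i
  | .int i => applyNat (fun i => k (.int i)) i

theorem applyVertex_eq {α : Type*} (k : Vertex → α) (a : Vertex) : applyVertex k a = k a := by
  cases a with
  | ext i => exact applyNat_eq (fun i => k (.ext i)) i
  | int i => exact applyNat_eq (fun i => k (.int i)) i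

/-- Application of a function to a graph, which is evaluated first. -/
def applyGraph {α : Type*} : (List Edge → α) → List Edge → α
  | k, [] => k []
  | k, e :: E => applyVertex (fun a => applyVertex (fun b =>
      applyGraph (fun E => k ((a, b) :: E)) E) e.2) e.1

theorem applyGraph_eq {α : Type*} (k : List Edge → α) (E : List Edge) : applyGraph k E = k E := by
  induction E generalizing k with
  | nil => rfl
  | cons e E ih => rw [applyGraph, applyVertex_eq, applyVertex_eq, ih]

/-- Application of a function to a list of graphs, which is evaluated first. -/
def applyGraphs {α : Type*} : (List (List Edge) → α) → List (List Edge) → α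
  | k, [] => k []
  | k, E :: L => applyGraph (fun E => applyGraphs (fun L => k (E :: L)) L) E

theorem applyGraphs_eq {α : Type*} (k : List (List Edge) → α) (L : List (List Edge)) :
    applyGraphs k L = k L := by
  induction L generalizing k with
  | nil => rfl
  | cons E L ih => rw [applyGraphs, applyGraph_eq, ih]

/-- The tests `F G` with the values `v G` determine the terms of `dufloSum`. -/
def partCheck (n m : ℕ) (Hs : List Reduction) (F : List Edge → List Edge → ℤ)
    (v : List Edge → ℤ) (cond : List Edge → Bool) : Bool :=
  applyGraphs (fun Gs =>
    Gs.all (fun G => cond G && decide (v G = dufloCoefficient n m G * F G G)) &&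
    (dualCheck Gs F && ((Hs.all fun H => H.check n m Gs F) &&
    (dufloPart n m).all fun t => (Nat.beq t.2.1 n && Nat.beq t.2.2.1 m) &&
      Gs.any (sameGraph t.2.2.2)))) (basisGraphs n m Hs)

variable [CharZero K]

theorem component_eval_dufloSum (n m : ℕ) :
    component K n m (dufloSum.eval K) = component K n m ((dufloPart n m).eval K) := by
  rw [dufloPart, eval_collect]
  generalize dufloSum = F
  induction F with
  | nil => rfl
  | cons t F ih =>
    rw [GraphSum.eval_cons, map_add, ih, List.filter_cons]
    split_ifs with h
    · rw [GraphSum.eval_cons, map_add]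
    · rw [map_smul, component_graph, if_neg, smul_zero, zero_add]
      rintro ⟨rfl, rfl⟩
      simp at h

/-- The check says that the value of each dual test equals the claimed coefficient times the test on
its own graph, and that `dufloSum` has no further terms. So both components have the same dual
expansion. The condition `cond` ensures that the linear form is a test with known value. -/
theorem component_eq_of_partCheck {α : GraphLie K} (hα : HasDegree 1 α) {a : Chains K n m}
    (ha : (relations K n m).mkQ a = α n m) {F : List Edge → List Edge → ℤ} {v : List Edge → ℤ}
    {cond : List Edge → Bool} {Hs : List Reduction}
    (hF : ∀ G, cond G = true → IsTest a (F G) ((v G : K) / 24))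
    (h : partCheck n m Hs F v cond = true) :
    α n m = component K n m ((24 : K)⁻¹ • dufloSum.eval K) := by
  simp only [partCheck, applyGraphs_eq, Bool.and_eq_true] at h
  obtain ⟨h1, hd, hH, h2⟩ := h
  simp only [List.all_eq_true, Bool.and_eq_true, decide_eq_true_eq, Nat.beq_eq, List.any_eq_true,
    sameGraph_iff] at h1 h2
  have hd' : ∀ G ∈ basisGraphs n m Hs, F G G ≠ 0 := by
    intro G hG
    have := List.all_eq_true.1 hd G hG
    rw [Bool.and_eq_true, decide_eq_true_eq] at this
    exact this.1
  rw [eq_sum_of_isTest hα ha (fun G hG => hF G (h1 G hG).1) hd hH, map_smul,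
    component_eval_dufloSum]
  have h3 : ((basisGraphs n m Hs).map fun G => ((v G : K) / 24 / F G G) • cls K n m G) =
      (basisGraphs n m Hs).map fun G =>
        (24 : K)⁻¹ • (dufloCoefficient n m G : K) • cls K n m G := by
    refine List.map_congr_left fun G hG => ?_
    rw [(h1 G hG).2, smul_smul]
    have : (F G G : K) ≠ 0 := Int.cast_ne_zero.2 (hd' G hG)
    congr 1
    push_cast
    field_simp
  rw [h3, ← List.sum_toFinset _ (basisGraphs_nodup n m Hs), ← Finset.smul_sum]
  congr 1
  unfold dufloCoefficient
  generalize dufloPart n m = L at h2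
  induction L with
  | nil => simp [GraphSum.eval_nil]
  | cons t L ih =>
    obtain ⟨⟨rfl, rfl⟩, G, hG, hG'⟩ := h2 t List.mem_cons_self
    rw [GraphSum.eval_cons, map_add, map_smul, component_graph, if_pos ⟨rfl, rfl⟩,
      ← ih fun s hs => h2 s (List.mem_cons_of_mem _ hs)]
    simp only [List.map_cons, List.sum_cons, Int.cast_add, add_smul, Finset.sum_add_distrib]
    congr 1
    rw [Finset.sum_eq_single_of_mem G (List.mem_toFinset.2 hG), if_pos (sameGraph_iff.2 hG'), hG']
    intro N _ hN
    rw [if_neg, Int.cast_zero, zero_smul]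
    rw [sameGraph_iff, hG']
    exact fun h => hN h.symm

/-- A graph of degree `1` with one external and no internal vertex would have `-1` edges. -/
theorem component_one_zero {α : GraphLie K} (hα : HasDegree 1 α) {a : Chains K 1 0}
    (ha : (relations K 1 0).mkQ a = α 1 0) :
    α 1 0 = component K 1 0 ((24 : K)⁻¹ • dufloSum.eval K) := by
  rw [map_smul, component_eval_dufloSum, show dufloPart 1 0 = [] by decide, GraphSum.eval_nil,
    map_zero, smul_zero, mkQ_eq_of_hasDegree hα ha, Finsupp.sum, Finset.sum_eq_zero]
  intro E _
  rw [if_neg (by omega), smul_zero]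

/-- Tests that detect some graphs with two external vertices. -/
def binaryTests (G : List Edge) :
    List (ℤ × (List (Fin 2) × List (Fin 2) × List (Fin 2)) × ℤ) :=
  if sameGraph G [ie 1 1, ie 1 2, ie 2 1, ie 2 2] then
    [(1, ([0, 0], [1, 1], [1, 1]), 20), (-2, ([0, 0], [1], [1]), 4), (1, ([0, 0], [], []), 0)]
  else if sameGraph G [ie 1 1, ie 1 2, ie 2 1, ii 2 1] then
    [(1, ([0, 0], [1], [1]), 4), (-1, ([0, 0], [], []), 0)]
  else if sameGraph G [ie 1 1, ie 1 2, ii 2 1, ie 2 2] then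
    [(1, ([1], [0, 0], [1]), 4), (-1, ([], [0, 0], []), 0)]
  else if sameGraph G [ie 1 1, ii 1 2, ii 2 1, ie 2 2] then [(1, ([0], [0], []), -1)]
  else if sameGraph G [ie 1 1, ii 1 2, ie 2 1, ii 2 1] then [(1, ([0, 0], [], []), 0)]
  else if sameGraph G [ie 1 2, ii 1 2, ii 2 1, ie 2 2] then [(1, ([], [0, 0], []), 0)]
  else if sameGraph G [ie 1 1, ie 1 2] then [(1, ([0], [1], [1]), 12)]
  else if sameGraph G [] then [(1, ([], [], []), 24)]
  else []

/-- A linear form that detects a given graph with two external vertices. -/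
def binaryForm (m : ℕ) (G : List Edge) : List Edge → ℤ :=
  if (binaryTests G).isEmpty then (smallTest m G).form 2 m else
    fun E => ((binaryTests G).map fun t => t.1 * (affineTest t.2.1).form 2 m E).sum

/-- The value of `binaryForm`, multiplied by `24`. -/
def binaryValue (G : List Edge) : ℤ := ((binaryTests G).map fun t => t.1 * t.2.2).sum

/-- The value of `binaryForm` is known. -/
def binaryCheck (m : ℕ) (G : List Edge) : Bool :=
  if (binaryTests G).isEmpty then (smallTest m G).degreeCheck 2 m && decide (contractWord
    (smallTest m G).outP (((smallTest m G).arguments 0).2 ++ ((smallTest m G).arguments 1).2) = 0)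
  else (binaryTests G).all fun t =>
    decide (t.2 ∈ affineCoefficients) && (affineTest t.2.1).degreeCheck 2 m

variable {a : (n m : ℕ) → Chains K n m}

/-- The arguments contain no letters `p`, so the contraction factor is `1` and the value is the
coefficient of the Duflo product. -/
theorem ActsAsDuflo.isTest_affineTest (ha : ActsAsDuflo a)
    {t : (List (Fin 2) × List (Fin 2) × List (Fin 2)) × ℤ} (ht : t ∈ affineCoefficients)
    (hD : (affineTest t.1).degreeCheck 2 m = true) :
    IsTest (a 2 m) ((affineTest t.1).form 2 m) ((t.2 : K) / 24) := by
  have := ha.isTest_two hD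
  convert this using 1
  rw [← coeff_dufloProduct_affine (K := K) t ht]
  exact (by simp [contractWord] : ∀ z : K, z = z * contractWord [] ([] ++ [] : List (Fin 2))) _

/-- Two kinds of tests are combined: those whose letters `p` do not match, with value zero, and
integral combinations of coefficients of Duflo products. The combinations are needed because a
single product usually sees several graphs. -/
theorem ActsAsDuflo.isTest_binaryForm (ha : ActsAsDuflo a) {G : List Edge}
    (h : binaryCheck m G = true) :
    IsTest (a 2 m) (binaryForm m G) ((binaryValue G : K) / 24) := by
  rw [binaryCheck] at h
  rw [binaryForm, binaryValue]
  split_ifs at h ⊢ with h0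
  · rw [Bool.and_eq_true, decide_eq_true_eq] at h
    have := ha.isTest_two h.1
    rw [h.2, Int.cast_zero, mul_zero] at this
    rwa [List.isEmpty_iff.1 h0, List.map_nil, List.sum_nil, Int.cast_zero, zero_div]
  · generalize binaryTests G = L at h
    clear h0
    induction L with
    | nil => simpa using IsTest.zero (a 2 m)
    | cons t L ih =>
      rw [List.all_cons, Bool.and_eq_true, Bool.and_eq_true, decide_eq_true_eq] at h
      have := ((ha.isTest_affineTest h.1.1 h.1.2).smul t.1).add (ih h.2)
      have e : ((((t :: L).map fun t => t.1 * t.2.2).sum : ℤ) : K) / 24 =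
          t.1 * ((t.2.2 : K) / 24) + (((L.map fun t => t.1 * t.2.2).sum : ℤ) : K) / 24 := by
        rw [List.map_cons, List.sum_cons]
        push_cast
        ring
      rw [e]
      exact this

end

/-! ### Evaluation of the tests for each number of vertices. -/

section

universe u

variable {K : Type u} [Field K] [CharZero K] {n m : ℕ}

/-- The value of a test with one argument. -/
def TestData.unaryValue {d : ℕ} (D : TestData d) : ℤ :=
  24 * pairing D.outX D.outP (D.table.words.differential
    [(1, (D.arguments 0).1, (D.arguments 0).2)])

variable {a : (n m : ℕ) → Chains K n m} {α : GraphLie K}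

theorem ActsAsDuflo.component_unary (ha : ActsAsDuflo a) (hα : HasDegree 1 α)
    (hq : (relations K 1 m).mkQ (a 1 m) = α 1 m) {d : ℕ} {D : List Edge → TestData d}
    {Hs : List Reduction} (h : partCheck 1 m Hs (fun G => (D G).form 1 m)
      (fun G => (D G).unaryValue) (fun G => (D G).degreeCheck 1 m) = true) :
    α 1 m = component K 1 m ((24 : K)⁻¹ • dufloSum.eval K) := by
  refine component_eq_of_partCheck hα hq (fun G hG => ?_) h
  have := ha.isTest_one hG
  rwa [TestData.unaryValue, Int.cast_mul, Int.cast_ofNat, mul_div_cancel_left₀ _ (by norm_num)]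

theorem ActsAsDuflo.component_binary (ha : ActsAsDuflo a) (hα : HasDegree 1 α)
    (hq : (relations K 2 m).mkQ (a 2 m) = α 2 m)
    {Hs : List Reduction} (h : partCheck 2 m Hs (binaryForm m) binaryValue (binaryCheck m) = true) :
    α 2 m = component K 2 m ((24 : K)⁻¹ • dufloSum.eval K) :=
  component_eq_of_partCheck hα hq (fun _ => ha.isTest_binaryForm) h

/-- All operations with three or more arguments vanish, so every test has value zero and the
component must be zero. -/
theorem ActsAsDuflo.component_of_three_le (ha : ActsAsDuflo a) (hα : HasDegree 1 α) (hn : 3 ≤ n)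
    (hq : (relations K n m).mkQ (a n m) = α n m) {d : ℕ} {D : List Edge → TestData d}
    {Hs : List Reduction} (h : partCheck n m Hs (fun G => (D G).form n m)
      (fun _ => 0) (fun G => (D G).degreeCheck n m) = true) :
    α n m = component K n m ((24 : K)⁻¹ • dufloSum.eval K) := by
  refine component_eq_of_partCheck hα hq (fun G hG => ?_) h
  rw [Int.cast_zero, zero_div]
  exact ha.isTest_of_three_le hn hG

set_option maxRecDepth 100000

/-- This and the following checks enumerate all graphs of degree `1` with the given numbers of
vertices and evaluate the tests on them; they establish duality, compatibility with the reductions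
and agreement with the claimed coefficients. -/
theorem partCheck_one_one : partCheck 1 1 [] (fun G => (smallTest 1 G).form 1 1)
    (fun G => (smallTest 1 G).unaryValue) (fun G => (smallTest 1 G).degreeCheck 1 1) = true := by
  decide +kernel

theorem partCheck_one_two : partCheck 1 2 reductions₁₂ (fun G => (smallTest 2 G).form 1 2)
    (fun G => (smallTest 2 G).unaryValue) (fun G => (smallTest 2 G).degreeCheck 1 2) = true := by
  decide +kernel

theorem partCheck_one_three : partCheck 1 3 reductions₁₃ (fun G => (largeTest G).form 1 3)
    (fun G => (largeTest G).unaryValue) (fun G => (largeTest G).degreeCheck 1 3) = true := by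
  decide +kernel

theorem partCheck_two_zero :
    partCheck 2 0 [] (binaryForm 0) binaryValue (binaryCheck 0) = true := by
  decide +kernel

theorem partCheck_two_one :
    partCheck 2 1 [] (binaryForm 1) binaryValue (binaryCheck 1) = true := by
  decide +kernel

theorem partCheck_two_two :
    partCheck 2 2 reductions₂₂ (binaryForm 2) binaryValue (binaryCheck 2) = true := by
  decide +kernel

theorem partCheck_three_zero : partCheck 3 0 [] (fun G => (smallTest 0 G).form 3 0)
    (fun _ => 0) (fun G => (smallTest 0 G).degreeCheck 3 0) = true := by
  decide +kernel

theorem partCheck_three_one : partCheck 3 1 [] (fun G => (smallTest 1 G).form 3 1)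
    (fun _ => 0) (fun G => (smallTest 1 G).degreeCheck 3 1) = true := by
  decide +kernel

theorem partCheck_four_zero : partCheck 4 0 [] (fun G => (smallTest 0 G).form 4 0)
    (fun _ => 0) (fun G => (smallTest 0 G).degreeCheck 4 0) = true := by
  decide +kernel

end

/-- The pairs `(n, m)` with `n + m ≤ 4` are treated one by one; for `n = 0` there are no graphs. -/
theorem ActsAsDuflo.component_eq.{u} {K : Type u} [Field K] [CharZero K]
    {a : (n m : ℕ) → Chains K n m} {α : GraphLie K} (ha : ActsAsDuflo a) (hα : HasDegree 1 α)
    (hq : ∀ n m, (relations K n m).mkQ (a n m) = α n m) {n m : ℕ} (h : n + m ≤ 4) :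
    α n m = component K n m ((24 : K)⁻¹ • dufloSum.eval K) := by
  have : n ≤ 4 := by omega
  have : m ≤ 4 := by omega
  interval_cases n
  · rw [component_zero_left]
    exact component_zero_left (K := K) α m
  · interval_cases m
    · exact component_one_zero hα (hq 1 0)
    · exact ha.component_unary hα (hq 1 1) partCheck_one_one
    · exact ha.component_unary hα (hq 1 2) partCheck_one_two
    · exact ha.component_unary hα (hq 1 3) partCheck_one_three
    · omega
  · interval_cases m
    · exact ha.component_binary hα (hq 2 0) partCheck_two_zero
    · exact ha.component_binary hα (hq 2 1) partCheck_two_one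
    · exact ha.component_binary hα (hq 2 2) partCheck_two_two
    all_goals omega
  · interval_cases m
    · exact ha.component_of_three_le hα le_rfl (hq 3 0) partCheck_three_zero
    · exact ha.component_of_three_le hα le_rfl (hq 3 1) partCheck_three_one
    all_goals omega
  · obtain rfl : m = 0 := by omega
    exact ha.component_of_three_le hα (by norm_num) (hq 4 0) partCheck_four_zero

theorem mainTheorem3 (K : Type*) [Field K] [CharZero K] (α : GraphLie K)
    (hα : IsMaurerCartan α) (hDuf : CorrespondsToDuflo α) :
    EqUpTo 4 α (a₁ K + a₂ K + (1 / 2 : K) • a₃ K - (1 / 12 : K) • a₄ K + (1 / 8 : K) • a₅ K +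
      (1 / 24 : K) • a₆ K) ∧
    ∃ ξ α' : GraphLie K,
      HasDegree 0 ξ ∧
      EqUpTo 3 ξ (-(1 / 4 : K) • ξ₁ K - (1 / 16 : K) • ξ₂ K + (1 / 48 : K) • ξ₃ K) ∧
      IsMaurerCartan α' ∧
      EqUpTo 4 α' (a₁ K + a₂ K + (1 / 24 : K) • obstructionGraph K) ∧
      α' = gaugeAction ξ α := by
  obtain ⟨a, hq, ha⟩ := hDuf
  have h : EqUpTo 4 α (a₁ K + a₂ K + (1 / 2 : K) • a₃ K - (1 / 12 : K) • a₄ K +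
      (1 / 8 : K) • a₅ K + (1 / 24 : K) • a₆ K) := by
    rw [sum_eq_eval_dufloSum]
    exact fun n m hnm => ActsAsDuflo.component_eq ha hα.1 hq hnm
  exact ⟨h, exists_gauge hα h⟩
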